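/- Let $G$ be a finite abelian group with a fixed element $u$ of order $2$, put $n=\#G/2$, and let $\mathbb{Z}\langle G\rangle=\mathbb{Z}[G]/(u+1)$. A $G$-lattice is a finitely generated abelian group $L$ with a symmetric, bilinear, positive definite map $\langle\cdot,\cdot\rangle:L\times L\to\mathbb{Z}$ and a homomorphism from $G$ to the group of automorphisms of $(L,\langle\cdot,\cdot\rangle)$ under which $u$ acts as $-1$; it is a $\mathbb{Z}\langle G\rangle$-module. It is called invertible if (i) $\mathrm{rank}(L)=n$; (ii) $L$ is unimodular, i.e. $L\to\mathrm{Hom}(L,\mathbb{Z})$, $x\mapsto(y\mapsto\langle x,y\rangle)$, is bijective; and (iii) for each integer $m>0$ there is $e_m\in L$ such that $\{\sigma e_m+mL:\sigma\in G\}$ generates the abelian group $L/mL$. In algorithms, $G$ is specified by a multiplication table, and $L$ by the Gram matrix on a $\mathbb{Z}$-basis and, for each $\sigma\in G$, the matrix of the action of $\sigma$ on that basis; elements of $L$ are specified by coefficient vectors. Consider the following algorithm, which takes as input $G$, $u$ and a $G$-lattice $L$. 1. If $\mathrm{rank}(L)\ne n$, output "no" and stop. 2. Compute the determinant of the Gram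 matrix of $L$. If it is not $1$, output "no" and stop. 3. Decide whether there is $e_2\in L$ such that $\{\sigma e_2+2L:\sigma\in G\}$ generates $L/2L$. If there is none, output "no" and stop; otherwise compute such an $e_2$. 4. Compute the order $q$ of the group $L/(\mathbb{Z}\langle G\rangle e_2)$. 5. Decide whether there is $e_q\in L$ such that $\{\sigma e_q+qL:\sigma\in G\}$ generates $L/qL$. If there is none, output "no"; otherwise output "yes". Then there are deterministic polynomial-time algorithms for the tasks that occur in these steps: testing whether $\mathrm{rank}(L)=n$; computing the determinant; given $G$, $u$, $L$ and an integer $m>0$, deciding whether there is $e_m\in L$ such that $\{\sigma e_m+mL:\sigma\in G\}$ generates $L/mL$, and finding one if there is; and, given $G$, $u$, $L$ with $\mathrm{rank}(L)=n$ and $e\in L$ with $L/(\mathbb{Z}\langle G\rangle e)$ finite, computing the order of that group. Moreover, with any deterministic polynomial-time algorithms for these tasks as subroutines (the third one being used in both steps 3 and 5), the algorithm above is a deterministic polynomial-time algorithm that, given $G$, $u$ and a $G$-lattice $L$, decides whether $L$ is invertible. -/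

import Mathlib

/-! ### A deterministic model of computation with bit cost

Programs are terms of a small first-order language that compute with binary trees whose leaves
are integers in binary. Every operation is charged at least the number of bits that it reads or
writes, integer arithmetic is charged quadratically in the length of the operands. So a run of
cost `t` only ever handles data of total bit length polynomial in `t`, and polynomial time in
this model is polynomial time on a Turing machine. -/

namespace BitCost

/-- The data on which programs operate: binary trees with integer leaves. -/
inductive Data : Type
  | int : ℤ → Data
  | pair : Data → Data → Data

namespace Data

/-- The number of bits of a datum, up to a constant factor; `Nat.size` is the binary length. -/
def size : Data → ℕ
  | int z => 1 + Nat.size z.natAbs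
  | pair a b => 1 + a.size + b.size

/-- The list `[a₁, …, aₖ]` is the tree `(a₁, (a₂, … (aₖ, 0)))`. -/
def list : List Data → Data
  | [] => int 0
  | a :: l => pair a (list l)

/-- Integer vectors, as lists of their entries. -/
def vec {k : ℕ} (v : Fin k → ℤ) : Data :=
  list (List.ofFn fun i => int (v i))

/-- Integer matrices, as lists of their rows. -/
def matrix {k l : ℕ} (M : Matrix (Fin k) (Fin l) ℤ) : Data :=
  list (List.ofFn fun i => vec (M i))

end Data

/-- The arithmetical operations and comparisons that programs may use. -/
inductive BinOp : Type
  | add | sub | mul | div | eq | lt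

/-- The effect of the operations; comparisons return `1` (true) or `0` (false), and `div` is
the quotient in division with remainder (with `a / 0 = 0`). -/
def BinOp.apply : BinOp → ℤ → ℤ → ℤ
  | add, a, b => a + b
  | sub, a, b => a - b
  | mul, a, b => a * b
  | div, a, b => a / b
  | eq, a, b => if a = b then 1 else 0
  | lt, a, b => if a < b then 1 else 0

/-- Programs. -/
inductive Prog : Type
  /-- return the input -/
  | id : Prog
  /-- return an integer constant -/
  | const : ℤ → Prog
  /-- left subtree of the input -/
  | fst : Prog
  /-- right subtree of the input -/
  | snd : Prog
  /-- `1` if the input is a pair, and `0` if it is an integer -/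
  | isPair : Prog
  /-- apply an operation to a pair of integers -/
  | op : BinOp → Prog
  /-- run two programs on the same input, and return the pair of their outputs -/
  | pair : Prog → Prog → Prog
  /-- run the first program, and then the second one on its output -/
  | seq : Prog → Prog → Prog
  /-- run the first program; if it returns a nonzero integer then run the second program on the
  original input, and if it returns `0` then run the third one on the original input -/
  | ite : Prog → Prog → Prog → Prog
  /-- as long as the first program returns a nonzero integer, replace the input `x` by the output
  of the second program on `x`; when it returns `0`, return `x` -/
  | loop : Prog → Prog → Prog

/-- `Run p x y t`: on input `x`, the program `p` halts with output `y`, at cost `t`. -/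
inductive Run : Prog → Data → Data → ℕ → Prop
  | id (x : Data) : Run .id x x (1 + x.size)
  | const (z : ℤ) (x : Data) : Run (.const z) x (.int z) (1 + x.size + (Data.int z).size)
  | fst (a b : Data) : Run .fst (.pair a b) a (1 + (Data.pair a b).size)
  | snd (a b : Data) : Run .snd (.pair a b) b (1 + (Data.pair a b).size)
  | isPair_pair (a b : Data) : Run .isPair (.pair a b) (.int 1) (1 + (Data.pair a b).size)
  | isPair_int (z : ℤ) : Run .isPair (.int z) (.int 0) (1 + (Data.int z).size)
  | op (o : BinOp) (a b : ℤ) :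
      Run (.op o) (.pair (.int a) (.int b)) (.int (o.apply a b))
        ((Data.pair (.int a) (.int b)).size ^ 2)
  | pair {p q : Prog} {x y z : Data} {s t : ℕ} :
      Run p x y s → Run q x z t → Run (.pair p q) x (.pair y z) (1 + x.size + s + t)
  | seq {p q : Prog} {x y z : Data} {s t : ℕ} :
      Run p x y s → Run q y z t → Run (.seq p q) x z (1 + s + t)
  | ite_true {c p q : Prog} {x y : Data} {z : ℤ} {s t : ℕ} :
      Run c x (.int z) s → z ≠ 0 → Run p x y t → Run (.ite c p q) x y (1 + x.size + s + t)
  | ite_false {c p q : Prog} {x y : Data} {s t : ℕ} :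
      Run c x (.int 0) s → Run q x y t → Run (.ite c p q) x y (1 + x.size + s + t)
  | loop_done {c p : Prog} {x : Data} {s : ℕ} :
      Run c x (.int 0) s → Run (.loop c p) x x (1 + x.size + s)
  | loop_step {c p : Prog} {x y w : Data} {z : ℤ} {s t r : ℕ} :
      Run c x (.int z) s → z ≠ 0 → Run p x y t → Run (.loop c p) y w r →
        Run (.loop c p) x w (1 + x.size + s + t + r)

/-- The model is deterministic: a program has at most one output, and one cost, on each input. -/
theorem Run.unique {p : Prog} {x y : Data} {t : ℕ} (h : Run p x y t) :
    ∀ {y' : Data} {t' : ℕ}, Run p x y' t' → y = y' ∧ t = t' := by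
  induction h with
  | id | const | fst | snd | isPair_pair | isPair_int | op =>
    intro y' t' h'; cases h'; exact ⟨rfl, rfl⟩
  | pair _ _ ih₁ ih₂ =>
    intro y' t' h'
    cases h' with
    | pair h₁ h₂ =>
      obtain ⟨rfl, rfl⟩ := ih₁ h₁
      obtain ⟨rfl, rfl⟩ := ih₂ h₂
      exact ⟨rfl, rfl⟩
  | seq _ _ ih₁ ih₂ =>
    intro y' t' h'
    cases h' with
    | seq h₁ h₂ =>
      obtain ⟨rfl, rfl⟩ := ih₁ h₁
      obtain ⟨rfl, rfl⟩ := ih₂ h₂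
      exact ⟨rfl, rfl⟩
  | ite_true _ hz _ ih₁ ih₂ =>
    intro y' t' h'
    cases h' with
    | ite_true h₁ _ h₂ =>
      obtain ⟨_, rfl⟩ := ih₁ h₁
      obtain ⟨rfl, rfl⟩ := ih₂ h₂
      exact ⟨rfl, rfl⟩
    | ite_false h₁ h₂ =>
      have := (ih₁ h₁).1
      injection this with this
      exact absurd this hz
  | ite_false _ _ ih₁ ih₂ =>
    intro y' t' h'
    cases h' with
    | ite_true h₁ hz h₂ =>
      have := (ih₁ h₁).1
      injection this with this
      exact absurd this.symm hz
    | ite_false h₁ h₂ =>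
      obtain ⟨_, rfl⟩ := ih₁ h₁
      obtain ⟨rfl, rfl⟩ := ih₂ h₂
      exact ⟨rfl, rfl⟩
  | loop_done _ ih₁ =>
    intro y' t' h'
    cases h' with
    | loop_done h₁ =>
      obtain ⟨_, rfl⟩ := ih₁ h₁
      exact ⟨rfl, rfl⟩
    | loop_step h₁ hz _ _ =>
      have := (ih₁ h₁).1
      injection this with this
      exact absurd this.symm hz
  | loop_step _ hz _ _ ih₁ ih₂ ih₃ =>
    intro y' t' h'
    cases h' with
    | loop_done h₁ =>
      have := (ih₁ h₁).1
      injection this with this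
      exact absurd this hz
    | loop_step h₁ _ h₂ h₃ =>
      obtain ⟨_, rfl⟩ := ih₁ h₁
      obtain ⟨rfl, rfl⟩ := ih₂ h₂
      obtain ⟨rfl, rfl⟩ := ih₃ h₃
      exact ⟨rfl, rfl⟩

/-- `p` solves, in polynomial time, the problem whose instances `i : ι` are presented to it as
the data `enc i`, and whose acceptable answers on the instance `i` are the `y` with `R i y`. -/
def SolvesInPolyTime {ι : Type*} (p : Prog) (enc : ι → Data) (R : ι → Data → Prop) : Prop :=
  ∃ P : Polynomial ℕ, ∀ i : ι, ∃ (y : Data) (t : ℕ),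
    Run p (enc i) y t ∧ t ≤ P.eval (enc i).size ∧ R i y

/-- `p` decides the property `Q` in polynomial time: it answers `1` for yes and `0` for no. -/
def DecidesInPolyTime {ι : Type*} (p : Prog) (enc : ι → Data) (Q : ι → Prop) : Prop :=
  SolvesInPolyTime p enc fun i y => (Q i ∧ y = .int 1) ∨ (¬ Q i ∧ y = .int 0)

end BitCost

/-! ### Lattices with an action of a finite abelian group -/

/-- An integral lattice structure on an abelian group `L`. -/
structure IntegralLattice (L : Type*) [AddCommGroup L] where
  fg : Module.Finite ℤ L
  inner : L →ₗ[ℤ] L →ₗ[ℤ] ℤ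
  inner_symm : ∀ x y, inner x y = inner y x
  inner_pos : ∀ x, x ≠ 0 → 0 < inner x x

/-- The map `L → Hom(L, ℤ)` given by the inner product is bijective. -/
def IntegralLattice.Unimodular {L : Type*} [AddCommGroup L] (Λ : IntegralLattice L) : Prop :=
  Function.Bijective Λ.inner

/-- The Gram matrix of a lattice with respect to a basis. -/
noncomputable def IntegralLattice.gram {L : Type*} [AddCommGroup L] (Λ : IntegralLattice L) {r : ℕ}
    (b : Module.Basis (Fin r) ℤ L) : Matrix (Fin r) (Fin r) ℤ :=
  Matrix.of fun i j => Λ.inner (b i) (b j)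

/-- A `G`-lattice structure on `L`: an integral lattice with a homomorphism from `G` to its group
of automorphisms that maps `u` to `-1`. -/
structure GLattice (G : Type*) [CommGroup G] (u : G) (L : Type*) [AddCommGroup L] extends
    IntegralLattice L where
  act : G →* (L ≃ₗ[ℤ] L)
  inner_act : ∀ σ x y, inner (act σ x) (act σ y) = inner x y
  act_u : ∀ x, act u x = -x

/-- The modified group ring `A⟨G⟩ = A[G]/(u+1)`. -/
abbrev ModGroupRing (A : Type*) [CommRing A] (G : Type*) [CommGroup G] (u : G) : Type _ :=
  MonoidAlgebra A G ⧸ Ideal.span {MonoidAlgebra.of A G u + 1}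

namespace GLattice

variable {G : Type*} [CommGroup G] {u : G} {L : Type*} [AddCommGroup L] (Λ : GLattice G u L)

/-- The action of `ℤ[G]` on a `G`-lattice. -/
noncomputable def groupRingAct : MonoidAlgebra ℤ G →ₐ[ℤ] Module.End ℤ L :=
  MonoidAlgebra.lift ℤ (Module.End ℤ L) G
    (LinearEquiv.automorphismGroup.toLinearMapMonoidHom.comp Λ.act)

theorem groupRingAct_eq_zero (a : MonoidAlgebra ℤ G)
    (ha : a ∈ Ideal.span {MonoidAlgebra.of ℤ G u + 1}) : Λ.groupRingAct a = 0 := by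
  obtain ⟨c, rfl⟩ := Ideal.mem_span_singleton'.1 ha
  have h : Λ.groupRingAct (MonoidAlgebra.of ℤ G u + 1) = 0 := by
    ext x
    simp [groupRingAct, Λ.act_u]
  rw [map_mul, h, mul_zero]

/-- The `ℤ⟨G⟩`-module structure of a `G`-lattice, as a homomorphism `ℤ⟨G⟩ → End(L)`. -/
noncomputable def ringAct : ModGroupRing ℤ G u →+* Module.End ℤ L :=
  Ideal.Quotient.lift _ Λ.groupRingAct.toRingHom Λ.groupRingAct_eq_zero

/-- The subgroup `ℤ⟨G⟩ · e` of `L`. -/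
noncomputable def cyclicSubgroup (e : L) : AddSubgroup L where
  carrier := {x | ∃ a : ModGroupRing ℤ G u, Λ.ringAct a e = x}
  zero_mem' := ⟨0, by simp⟩
  add_mem' := by
    rintro _ _ ⟨a, rfl⟩ ⟨b, rfl⟩
    exact ⟨a + b, by simp⟩
  neg_mem' := by
    rintro _ ⟨a, rfl⟩
    exact ⟨-a, by simp⟩

/-- The elements `σ e + mL` of `L/mL`, for `σ ∈ G`, generate the abelian group `L/mL`. -/
def GeneratesMod (m : ℕ) (e : L) : Prop :=
  AddSubgroup.closure
    (Set.range fun σ : G => (QuotientAddGroup.mk (Λ.act σ e) :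
      L ⧸ (nsmulAddMonoidHom m : L →+ L).range)) = ⊤

/-- Invertible `G`-lattices. -/
structure Invertible : Prop where
  finrank_eq : Module.finrank ℤ L = Nat.card G / 2
  unimodular : Λ.Unimodular
  exists_generatesMod : ∀ m : ℕ, 0 < m → ∃ e : L, Λ.GeneratesMod m e

end GLattice

/-! ### Inputs -/

universe v w

open BitCost

/-- A finite abelian group `G` with an element `u` of order `2` and a `G`-lattice `L`, together
with what is needed to write them down: an enumeration of `G` and a basis of `L`. -/
structure GLatticeInput where
  G : Type v
  [commGroup : CommGroup G]
  u : G
  orderOf_u : orderOf u = 2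
  L : Type w
  [addCommGroup : AddCommGroup L]
  lat : GLattice G u L
  N : ℕ
  enum : Fin N ≃ G
  r : ℕ
  basis : Module.Basis (Fin r) ℤ L

namespace GLatticeInput

attribute [instance] GLatticeInput.commGroup GLatticeInput.addCommGroup

variable (I : GLatticeInput)

/-- The multiplication table of `G`, as a list of rows; elements of `G` are given by their
positions in the enumeration. -/
def table : Data :=
  Data.matrix (Matrix.of fun i j : Fin I.N => ((I.enum.symm (I.enum i * I.enum j) : ℕ) : ℤ))

/-- The group `G` is given by its multiplication table, `u` by its position, the lattice by its
Gram matrix, and the action of `G` by the list of the matrices of the elements of `G`. -/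
noncomputable def encode : Data :=
  Data.list
    [I.table,
      .int ((I.enum.symm I.u : ℕ) : ℤ),
      Data.matrix (I.lat.gram I.basis),
      Data.list (List.ofFn fun i : Fin I.N =>
        Data.matrix (LinearMap.toMatrix I.basis I.basis (I.lat.act (I.enum i)).toLinearMap))]

/-- An element of the lattice is given by its coefficient vector. -/
noncomputable def encodeElt (e : I.L) : Data :=
  Data.vec (I.basis.repr e)

end GLatticeInput

/-! ### The algorithm -/

namespace InvertibilityAlgorithm

/-- `p` decides in polynomial time whether `rank(L) = #G / 2`. -/
def SolvesRank (p : Prog) : Prop :=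
  DecidesInPolyTime p GLatticeInput.encode.{v, w}
    fun I => Module.finrank ℤ I.L = Nat.card I.G / 2

/-- `p` computes in polynomial time the determinant of the Gram matrix. -/
def SolvesDet (p : Prog) : Prop :=
  SolvesInPolyTime p GLatticeInput.encode.{v, w}
    fun I y => y = .int (I.lat.gram I.basis).det

/-- Given `L` and an integer `m > 0`, the program `p` decides in polynomial time whether there is
an `e ∈ L` for which the elements `σ e + mL` generate `L/mL`, and if there is then it finds one.
The answer is the empty list if there is none, and a list `[e]` otherwise. -/
def SolvesCyclic (p : Prog) : Prop :=
  SolvesInPolyTime (ι := GLatticeInput.{v, w} × {m : ℕ // 0 < m}) p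
    (fun i => .pair i.1.encode (.int (i.2 : ℕ)))
    fun i y =>
      (∃ e : i.1.L, i.1.lat.GeneratesMod i.2 e ∧ y = Data.list [i.1.encodeElt e]) ∨
      ((¬ ∃ e : i.1.L, i.1.lat.GeneratesMod i.2 e) ∧ y = Data.list [])

/-- Given `L` of rank `#G / 2` and `e ∈ L` for which `L / (ℤ⟨G⟩ e)` is finite, the program `p`
computes in polynomial time the order of that group. -/
def SolvesIndex (p : Prog) : Prop :=
  SolvesInPolyTime
    (ι := {i : (I : GLatticeInput.{v, w}) × I.L //
      Module.finrank ℤ i.1.L = Nat.card i.1.G / 2 ∧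
        Finite (i.1.L ⧸ i.1.lat.cyclicSubgroup i.2)})
    p
    (fun i => .pair i.1.1.encode (i.1.1.encodeElt i.1.2))
    fun i y => y = .int (Nat.card (i.1.1.L ⧸ i.1.1.lat.cyclicSubgroup i.1.2))

/-- Test whether an integer is `1`. -/
def isOne : Prog := .seq (.pair .id (.const 1)) (.op .eq)

/-- On input `(L, e)`: compute the order `q` of `L / (ℤ⟨G⟩ e)` and return whether `L/qL` is
generated by the `σ e' + qL` for some `e'`. -/
def finalSteps (cyclic index : Prog) : Prog :=
  .seq (.pair .fst index) (.seq cyclic .isPair)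

/-- The algorithm that is to decide whether `L` is invertible, with the subroutines that it calls
as parameters.
* If the rank of `L` is not `#G / 2`, answer `0`.
* If the determinant of `L` is not `1`, answer `0`.
* Call `cyclic` on `(L, 2)`. If it finds no `e₂`, answer `0`.
* Call `index` on `(L, e₂)` to compute the order `q` of `L / (ℤ⟨G⟩ e₂)`.
* Call `cyclic` on `(L, q)`. If it finds no `e_q`, answer `0`, and otherwise `1`. -/
def algorithm (rank det cyclic index : Prog) : Prog :=
  .ite rank
    (.ite (.seq det isOne)
      (.seq (.pair .id (.seq (.pair .id (.const 2)) cyclic))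
        (.ite (.seq .snd .isPair)
          (.seq (.pair .fst (.seq .snd .fst)) (finalSteps cyclic index))
          (.const 0)))
      (.const 0))
    (.const 0)

end InvertibilityAlgorithm

/-! ### Polynomial-time functions on encoded types -/

namespace BitCost

/-! Correctness of the algorithm. Let `e₂` generate `L/2L`, and let `N` be the subgroup `ℤ⟨G⟩ e₂`.
Then `L/N = 2(L/N)`, so some odd integer kills the finitely generated group `L/N`, which is
therefore finite (`finite_quotient_cyclicSubgroup`); let `q` be its order. By the Chinese remainder
theorem it suffices to find generators of `L/mL` for prime powers `m`, and a generator modulo a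
prime `p` is one modulo all powers of `p` (`GenMod.mul`, `GenMod.pow`). If `p` does not divide `q`,
then `qL ⊆ N` shows that `e₂` itself generates `L/pL`; if `p` divides `q`, a generator modulo `q`
serves. So one generator modulo `q` gives generators for all moduli (`exists_genMod`,
`invertible_iff`). Positive definiteness makes the Gram determinant positive, so that unimodularity
amounts to its being `1` (`unimodular_iff_gram_det`).

The subroutines. Running times come from closure rules for the class `PF` of polynomial-time
functions; the main one is `PF.foldl`, for folds whose intermediate states have controlled size. All
linear algebra is Euclidean elimination modulo an integer, so entries stay short. Its meaning is
expressed by submodules (`elimCol_spec`) and, for determinants, by products in the exterior algebra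
(`detCol_spec`). An absolute determinant is recovered from its residue, up to sign, modulo an
integer that exceeds twice its size (`absDet_ofFn`). The index of `N` is such a determinant, formed
from one translate of `e₂` for each pair `{σ, uσ}` (`index_cyclicSubgroup`).

The remaining task is to find a generator of `L/mL` without factoring `m`. A vector `g` is one if
and only if it avoids every maximal submodule `M` containing `mL` (`genMod_of_forall_coatom`). For a
basis vector `x`, linear algebra yields generators `a` of the ideal of all `a` with `aL ⊆ Rx + mL`,
where `R = ℤ[G]`. On the simple module `L/M`, `a` acts either as zero or injectively. Solving a
linear equation for a high power of `a`, as in Fitting's lemma, changes `g` into a vector that is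
congruent to `x` modulo every `M` of the second kind and to `g` modulo every `M` of the first kind
(`update_spec`). After all `x` and `a` have been used, `g` avoids every `M`, provided that `L/mL` is
cyclic (`genMod_generator`); whether it is cyclic is tested by checking `g`
(`spans_eq_one_iff_genMod`). -/

theorem Data.one_le_size : ∀ x : Data, 1 ≤ x.size
  | .int _ => by simp [Data.size]
  | .pair _ _ => by simp only [Data.size]; omega

theorem size_le_of_natAbs_le {a : ℤ} {n k : ℕ} (h : a.natAbs ≤ n) (hn : n < 2 ^ k) :
    Nat.size a.natAbs ≤ k :=
  Nat.size_le.2 (h.trans_lt hn)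

theorem size_natAbs_add_le (a b : ℤ) :
    Nat.size (a + b).natAbs ≤ Nat.size a.natAbs + Nat.size b.natAbs + 1 := by
  refine size_le_of_natAbs_le (Int.natAbs_add_le a b) ?_
  have ha := Nat.lt_size_self a.natAbs
  have hb := Nat.lt_size_self b.natAbs
  have h1 : 2 ^ Nat.size a.natAbs ≤ 2 ^ (Nat.size a.natAbs + Nat.size b.natAbs) :=
    Nat.pow_le_pow_right (by norm_num) (by omega)
  have h2 : 2 ^ Nat.size b.natAbs ≤ 2 ^ (Nat.size a.natAbs + Nat.size b.natAbs) :=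
    Nat.pow_le_pow_right (by norm_num) (by omega)
  rw [pow_succ]
  omega

theorem size_natAbs_mul_le (a b : ℤ) :
    Nat.size (a * b).natAbs ≤ Nat.size a.natAbs + Nat.size b.natAbs := by
  rw [Int.natAbs_mul, Nat.size_le, pow_add]
  exact Nat.mul_lt_mul'' (Nat.lt_size_self _) (Nat.lt_size_self _)

theorem BinOp.size_apply_le (o : BinOp) (a b : ℤ) :
    (Data.int (o.apply a b)).size ≤ (Data.pair (.int a) (.int b)).size ^ 2 := by
  have key : Nat.size (o.apply a b).natAbs ≤ Nat.size a.natAbs + Nat.size b.natAbs + 1 := by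
    cases o with
    | add => exact size_natAbs_add_le a b
    | sub =>
      have := size_natAbs_add_le a (-b)
      simpa [BinOp.apply, sub_eq_add_neg] using this
    | mul => exact (size_natAbs_mul_le a b).trans (Nat.le_succ _)
    | div =>
      have : Nat.size (a / b).natAbs ≤ Nat.size a.natAbs :=
        Nat.size_le_size (Int.natAbs_ediv_le_natAbs a b)
      simp only [BinOp.apply]; omega
    | eq => simp only [BinOp.apply]; split_ifs <;> simp
    | lt => simp only [BinOp.apply]; split_ifs <;> simp
  simp only [Data.size]
  nlinarith

/-- A run costs at least the size of its output. -/
theorem Run.size_le {p : Prog} {x y : Data} {t : ℕ} (h : Run p x y t) : y.size ≤ t := by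
  induction h with
  | id | const => omega
  | fst | snd => simp only [Data.size]; omega
  | isPair_pair a b =>
    have := a.one_le_size; have := b.one_le_size
    simp only [Data.size, Int.natAbs_one, Nat.size_one]; omega
  | isPair_int => simp [Data.size]
  | op o a b => exact o.size_apply_le a b
  | @pair p q x y z s t _ _ ih₁ ih₂ =>
    have := x.one_le_size
    simp only [Data.size]; omega
  | seq | ite_true | ite_false | loop_done | loop_step => omega

theorem polynomial_eval_mono (P : Polynomial ℕ) {a b : ℕ} (h : a ≤ b) : P.eval a ≤ P.eval b := by
  rw [Polynomial.eval_eq_sum_range, Polynomial.eval_eq_sum_range]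
  gcongr

/-! ### Calculus of polynomial bounds. -/

/-- `f` is bounded by a polynomial in `g`. -/
def PolyBdd {α : Type*} (f g : α → ℕ) : Prop :=
  ∃ P : Polynomial ℕ, ∀ a, f a ≤ P.eval (g a)

namespace PolyBdd

variable {α β : Type*} {f f' g g' h : α → ℕ}

theorem refl (f : α → ℕ) : PolyBdd f f := ⟨.X, by simp⟩

theorem const (n : ℕ) (g : α → ℕ) : PolyBdd (fun _ => n) g := ⟨.C n, by simp⟩

theorem add (hf : PolyBdd f g) (hf' : PolyBdd f' g) : PolyBdd (fun a => f a + f' a) g := by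
  obtain ⟨P, hP⟩ := hf
  obtain ⟨Q, hQ⟩ := hf'
  exact ⟨P + Q, fun a => by simpa using add_le_add (hP a) (hQ a)⟩

theorem mul (hf : PolyBdd f g) (hf' : PolyBdd f' g) : PolyBdd (fun a => f a * f' a) g := by
  obtain ⟨P, hP⟩ := hf
  obtain ⟨Q, hQ⟩ := hf'
  exact ⟨P * Q, fun a => by simpa using Nat.mul_le_mul (hP a) (hQ a)⟩

theorem pow (hf : PolyBdd f g) (n : ℕ) : PolyBdd (fun a => f a ^ n) g := by
  obtain ⟨P, hP⟩ := hf
  exact ⟨P ^ n, fun a => by simpa using Nat.pow_le_pow_left (hP a) n⟩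

theorem trans (hf : PolyBdd f g) (hg : PolyBdd g h) : PolyBdd f h := by
  obtain ⟨P, hP⟩ := hf
  obtain ⟨Q, hQ⟩ := hg
  exact ⟨P.comp Q, fun a => by
    simpa using (hP a).trans (polynomial_eval_mono P (hQ a))⟩

theorem mono (hf : PolyBdd f g) (h : ∀ a, f' a ≤ f a) : PolyBdd f' g := by
  obtain ⟨P, hP⟩ := hf
  exact ⟨P, fun a => (h a).trans (hP a)⟩

theorem comp {f g : β → ℕ} (hf : PolyBdd f g) (k : α → β) :
    PolyBdd (fun a => f (k a)) (fun a => g (k a)) := by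
  obtain ⟨P, hP⟩ := hf
  exact ⟨P, fun a => hP _⟩

theorem eval (P : Polynomial ℕ) (hf : PolyBdd f g) : PolyBdd (fun a => P.eval (f a)) g := by
  obtain ⟨Q, hQ⟩ := hf
  exact ⟨P.comp Q, fun a => by simpa using polynomial_eval_mono P (hQ a)⟩

end PolyBdd

/-- Types whose elements are presented to programs as data. -/
class Enc (α : Type*) where
  toData : α → Data

/-- The datum that presents `a`. -/
def enc {α : Type*} [Enc α] (a : α) : Data := Enc.toData a

/-- The size of the datum that presents `a`. -/
def sz {α : Type*} [Enc α] (a : α) : ℕ := (enc a).size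

instance : Enc ℤ := ⟨.int⟩

instance {α β : Type*} [Enc α] [Enc β] : Enc (α × β) := ⟨fun p => .pair (enc p.1) (enc p.2)⟩

instance {α : Type*} [Enc α] : Enc (List α) := ⟨fun l => .list (l.map enc)⟩

section

variable {α β : Type*} [Enc α] [Enc β]

theorem enc_pair (a : α) (b : β) : enc (a, b) = .pair (enc a) (enc b) := rfl

theorem enc_nil : enc ([] : List α) = .int 0 := rfl

theorem enc_cons (a : α) (l : List α) : enc (a :: l) = .pair (enc a) (enc l) := rfl

theorem sz_int (z : ℤ) : sz z = 1 + Nat.size z.natAbs := rfl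

theorem sz_pair (p : α × β) : sz p = 1 + sz p.1 + sz p.2 := rfl

theorem sz_nil : sz ([] : List α) = 1 := by simp [sz, enc_nil, Data.size]

theorem sz_cons (a : α) (l : List α) : sz (a :: l) = 1 + sz a + sz l := rfl

theorem one_le_sz (a : α) : 1 ≤ sz a := Data.one_le_size _

theorem length_lt_sz (l : List α) : l.length < sz l := by
  induction l with
  | nil => simp [sz_nil]
  | cons a l ih => rw [sz_cons, List.length_cons]; omega

theorem sz_lt_of_mem {a : α} {l : List α} (h : a ∈ l) : sz a < sz l := by
  induction l with
  | nil => simp at h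
  | cons b l ih =>
    rw [sz_cons]
    rcases List.mem_cons.1 h with rfl | h
    · omega
    · have := ih h; omega

theorem sz_list_le {l : List α} {B : ℕ} (h : ∀ a ∈ l, sz a ≤ B) :
    sz l ≤ 1 + l.length * (1 + B) := by
  induction l with
  | nil => simp [sz_nil]
  | cons a l ih =>
    have h1 := h a (by simp)
    have h2 := ih fun b hb => h b (by simp [hb])
    rw [sz_cons, List.length_cons, add_mul]
    omega

end

/-- The invariant may depend on the number of steps made, because accumulators grow: the bound for
their size is typically linear in that number. -/
theorem foldl_counter {α σ : Type*} {Inv : ℕ → σ → Prop} {step : σ → α → σ} :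
    ∀ (l : List α) (k : ℕ) (s : σ), Inv k s →
      (∀ j s, ∀ a ∈ l, j < k + l.length → Inv j s → Inv (j + 1) (step s a)) →
      Inv (k + l.length) (l.foldl step s)
  | [], _, _, h, _ => h
  | a :: l, k, s, h, hs => by
    have := foldl_counter l (k + 1) (step s a)
      (hs k s a (by simp) (by simp) h)
      (fun j s b hb hj => hs j s b (by simp [hb]) (by simp; omega))
    simpa [add_assoc, add_comm 1] using this

/-! ### Polynomial-time functions and their closure properties. -/

/-- Functions that are computed by a program in polynomial time. -/
@[fun_prop]
def PF {α β : Type*} [Enc α] [Enc β] (f : α → β) : Prop :=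
  ∃ (p : Prog) (T : α → ℕ), (∀ a, Run p (enc a) (enc (f a)) (T a)) ∧ PolyBdd T sz

/-- Properties that are decided by a program in polynomial time. -/
def PP {α : Type*} [Enc α] (c : α → Prop) [DecidablePred c] : Prop :=
  PF fun a => if c a then (1 : ℤ) else 0

section

variable {α β γ δ σ : Type*} [Enc α] [Enc β] [Enc γ] [Enc δ] [Enc σ]

theorem PF.polyBdd_sz {f : α → β} (hf : PF f) : PolyBdd (fun a => sz (f a)) sz := by
  obtain ⟨p, T, hT, hb⟩ := hf
  exact hb.mono fun a => (hT a).size_le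

@[fun_prop]
theorem PF.id : PF fun a : α => a :=
  ⟨.id, _, fun _ => .id _, (PolyBdd.const 1 _).add (PolyBdd.refl _)⟩

@[fun_prop]
theorem PF.comp {g : β → γ} {f : α → β} (hg : PF g) (hf : PF f) : PF fun a => g (f a) := by
  have hs := hf.polyBdd_sz
  obtain ⟨p, T, hT, hb⟩ := hf
  obtain ⟨q, U, hU, hc⟩ := hg
  exact ⟨.seq p q, _, fun a => .seq (hT a) (hU (f a)),
    ((PolyBdd.const 1 _).add hb).add ((hc.comp f).trans hs)⟩

/-- The only constants of the language are integers, so a constant tree is assembled from its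
leaves; the factor `c` depends on the tree alone. -/
theorem exists_run_const (y : Data) : ∃ (p : Prog) (c : ℕ), ∀ x : Data,
    ∃ t, Run p x y t ∧ t ≤ c * (1 + x.size) := by
  induction y with
  | int z =>
    refine ⟨.const z, 1 + (Data.int z).size, fun x => ⟨_, .const z x, ?_⟩⟩
    nlinarith [x.one_le_size, (Data.int z).one_le_size]
  | pair a b ha hb =>
    obtain ⟨p, c, h⟩ := ha
    obtain ⟨q, d, h'⟩ := hb
    refine ⟨.pair p q, 1 + c + d, fun x => ?_⟩
    obtain ⟨t, ht, htc⟩ := h x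
    obtain ⟨s, hs, hsd⟩ := h' x
    exact ⟨_, .pair ht hs, by linarith⟩

@[fun_prop]
theorem PF.const (b : β) : PF fun _ : α => b := by
  obtain ⟨p, c, h⟩ := exists_run_const (enc b)
  choose T hT hc using fun a : α => h (enc a)
  exact ⟨p, T, hT, ((PolyBdd.const c _).mul ((PolyBdd.const 1 _).add (PolyBdd.refl _))).mono hc⟩

@[fun_prop]
theorem PF.prodMk {f : α → β} {g : α → γ} (hf : PF f) (hg : PF g) : PF fun a => (f a, g a) := by
  obtain ⟨p, T, hT, hb⟩ := hf
  obtain ⟨q, U, hU, hc⟩ := hg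
  exact ⟨.pair p q, _, fun a => .pair (hT a) (hU a),
    (((PolyBdd.const 1 _).add (PolyBdd.refl _)).add hb).add hc⟩

@[fun_prop]
theorem PF.fst : PF (Prod.fst : α × β → α) :=
  ⟨.fst, _, fun p => .fst (enc p.1) (enc p.2), (PolyBdd.const 1 _).add (PolyBdd.refl _)⟩

@[fun_prop]
theorem PF.snd : PF (Prod.snd : α × β → β) :=
  ⟨.snd, _, fun p => .snd (enc p.1) (enc p.2), (PolyBdd.const 1 _).add (PolyBdd.refl _)⟩

theorem PF.op (o : BinOp) : PF fun p : ℤ × ℤ => o.apply p.1 p.2 :=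
  ⟨.op o, _, fun p => .op o p.1 p.2, (PolyBdd.refl _).pow 2⟩

@[fun_prop]
theorem PF.add {f g : α → ℤ} (hf : PF f) (hg : PF g) : PF fun a => f a + g a :=
  (PF.op .add).comp (hf.prodMk hg)

@[fun_prop]
theorem PF.sub {f g : α → ℤ} (hf : PF f) (hg : PF g) : PF fun a => f a - g a :=
  (PF.op .sub).comp (hf.prodMk hg)

@[fun_prop]
theorem PF.mul {f g : α → ℤ} (hf : PF f) (hg : PF g) : PF fun a => f a * g a :=
  (PF.op .mul).comp (hf.prodMk hg)

@[fun_prop]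
theorem PF.div {f g : α → ℤ} (hf : PF f) (hg : PF g) : PF fun a => f a / g a :=
  (PF.op .div).comp (hf.prodMk hg)

@[fun_prop]
theorem PF.neg {f : α → ℤ} (hf : PF f) : PF fun a => -f a := by
  simpa using (PF.const (0 : ℤ)).sub hf

theorem PF.mod {f g : α → ℤ} (hf : PF f) (hg : PF g) : PF fun a => f a % g a := by
  simp_rw [Int.emod_def]
  fun_prop

theorem PP.eq {f g : α → ℤ} (hf : PF f) (hg : PF g) : PP fun a => f a = g a :=
  (PF.op .eq).comp (hf.prodMk hg)

theorem PP.lt {f g : α → ℤ} (hf : PF f) (hg : PF g) : PP fun a => f a < g a :=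
  (PF.op .lt).comp (hf.prodMk hg)

theorem PF.ite {c : α → Prop} [DecidablePred c] {f g : α → β} (hc : PP c) (hf : PF f)
    (hg : PF g) : PF fun a => if c a then f a else g a := by
  obtain ⟨r, S, hS, hs⟩ := hc
  obtain ⟨p, T, hT, hb⟩ := hf
  obtain ⟨q, U, hU, hc⟩ := hg
  refine ⟨.ite r p q, fun a => 1 + sz a + S a + if c a then T a else U a, fun a => ?_, ?_⟩
  · have h := hS a
    by_cases ha : c a
    · simp only [ha, if_true] at h ⊢
      exact .ite_true h one_ne_zero (hT a)
    · simp only [ha, if_false] at h ⊢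
      exact .ite_false h (hU a)
  · refine ((((PolyBdd.const 1 _).add (PolyBdd.refl _)).add hs).add (hb.add hc)).mono fun a => ?_
    split_ifs <;> omega

/-- Unrolls a loop along a prescribed orbit. The cost is a sum over the rounds, so a uniform bound
for one round turns into a bound for the whole loop. -/
theorem Run.loop_of_forall {c b : Prog} {x : ℕ → Data} {s t : ℕ → ℕ} :
    ∀ {n : ℕ}, (∀ i < n, Run c (x i) (.int 1) (s i)) → Run c (x n) (.int 0) (s n) →
      (∀ i < n, Run b (x i) (x (i + 1)) (t i)) →
      ∃ T, Run (.loop c b) (x 0) (x n) T ∧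
        T ≤ ∑ i ∈ Finset.range n, (1 + (x i).size + s i + t i) + (1 + (x n).size + s n) := by
  intro n
  induction n generalizing x s t with
  | zero => exact fun _ h _ => ⟨_, .loop_done h, by simp⟩
  | succ n ih =>
    intro h1 h2 h3
    obtain ⟨T, hT, hle⟩ := ih (x := fun i => x (i + 1)) (s := fun i => s (i + 1))
      (t := fun i => t (i + 1)) (fun i hi => h1 _ (by omega)) h2 (fun i hi => h3 _ (by omega))
    refine ⟨_, .loop_step (h1 0 (by omega)) one_ne_zero (h3 0 (by omega)) hT, ?_⟩
    rw [Finset.sum_range_succ']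
    omega

/-- Iteration of a polynomial-time function, as long as a polynomial-time condition holds. -/
theorem PF.iterate {f : σ → σ} {c : σ → Prop} [DecidablePred c] {init : γ → σ} {n : γ → ℕ}
    (hf : PF f) (hc : PP c) (hi : PF init) (hn : PolyBdd n sz)
    (h1 : ∀ g, ∀ i < n g, c (f^[i] (init g))) (h2 : ∀ g, ¬ c (f^[n g] (init g)))
    (P : Polynomial ℕ) (hP : ∀ g, ∀ i ≤ n g, sz (f^[i] (init g)) ≤ P.eval (sz g)) :
    PF fun g => f^[n g] (init g) := by
  obtain ⟨b, U, hU, Q, hQ⟩ := hf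
  obtain ⟨r, S, hS, R, hR⟩ := hc
  replace hS : ∀ a, Run r (enc a) (.int (if c a then 1 else 0)) (S a) := hS
  -- All states have size at most `P`, so a test costs at most `R ∘ P` and a round of the body at
  -- most `Q ∘ P`; there are `n g + 1` tests and `n g` rounds.
  have hloop : ∀ g, ∃ T, Run (.loop r b) (enc (init g)) (enc (f^[n g] (init g))) T ∧
      T ≤ (n g + 1) * (1 + P.eval (sz g) + R.eval (P.eval (sz g)) + Q.eval (P.eval (sz g))) := by
    intro g
    obtain ⟨T, hT, hle⟩ := Run.loop_of_forall (c := r) (b := b) (n := n g)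
      (x := fun i => enc (f^[i] (init g))) (s := fun i => S (f^[i] (init g)))
      (t := fun i => U (f^[i] (init g)))
      (fun i hi => by simpa only [h1 g i hi, if_true] using hS (f^[i] (init g)))
      (by simpa only [h2 g, if_false] using hS (f^[n g] (init g)))
      (fun i _ => by simpa only [Function.iterate_succ_apply'] using hU (f^[i] (init g)))
    refine ⟨T, hT, hle.trans ?_⟩
    have hs : ∀ i ≤ n g, S (f^[i] (init g)) ≤ R.eval (P.eval (sz g)) := fun i hi =>
      (hR _).trans (polynomial_eval_mono R (hP g i hi))
    have hu : ∀ i ≤ n g, U (f^[i] (init g)) ≤ Q.eval (P.eval (sz g)) := fun i hi =>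
      (hQ _).trans (polynomial_eval_mono Q (hP g i hi))
    have hsum : ∑ i ∈ Finset.range (n g),
        (1 + (enc (f^[i] (init g))).size + S (f^[i] (init g)) + U (f^[i] (init g))) ≤
        n g * (1 + P.eval (sz g) + R.eval (P.eval (sz g)) + Q.eval (P.eval (sz g))) := by
      refine (Finset.sum_le_card_nsmul _ _ (1 + P.eval (sz g) + R.eval (P.eval (sz g)) +
        Q.eval (P.eval (sz g))) fun i hi => ?_).trans (by simp)
      have hi' := (Finset.mem_range.1 hi).le
      have := hP g i hi'; have := hs i hi'; have := hu i hi'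
      unfold sz at *
      omega
    have := hP g _ le_rfl
    have := hs _ le_rfl
    unfold sz at *
    rw [add_mul, one_mul]
    omega
  choose T hT hle using hloop
  obtain ⟨p, V, hV, hb⟩ := hi
  refine ⟨.seq p (.loop r b), _, fun g => .seq (hV g) (hT g),
    ((PolyBdd.const 1 _).add hb).add (PolyBdd.mono ?_ hle)⟩
  have hP' : PolyBdd (fun g : γ => P.eval (sz g)) sz := .eval P (.refl _)
  exact (hn.add (.const 1 _)).mul
    ((((PolyBdd.const 1 _).add hP').add (.eval R hP')).add (.eval Q hP'))

/-! ### Lists -/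

-- A nonempty list is encoded exactly as the pair of its head and its tail, so the program for the
-- pair serves unchanged.
@[fun_prop]
theorem PF.cons {f : γ → α} {l : γ → List α} (hf : PF f) (hl : PF l) :
    PF fun c => f c :: l c := by
  obtain ⟨p, T, hT, hb⟩ := hf.prodMk hl
  exact ⟨p, T, hT, hb⟩

/-- A nonempty list is encoded by a pair and the empty one by an integer, so `isPair` separates the
cases. The parameter has to travel with the list, since the program for a nonempty list sees nothing
but its input. -/
theorem PF.listCases {l : γ → List α} {f : γ → β} {g : γ → α → List α → β} (hl : PF l)
    (hf : PF f) (hg : PF fun p : γ × α × List α => g p.1 p.2.1 p.2.2) :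
    PF fun c => match l c with
      | [] => f c
      | a :: t => g c a t := by
  have hs := (PF.id.prodMk hl).polyBdd_sz
  obtain ⟨q, U, hU, hc⟩ := PF.id.prodMk hl
  obtain ⟨p, T, hT, hb⟩ := hl
  obtain ⟨r, S, hS, hd⟩ := hf
  obtain ⟨w, V, hV, he⟩ := hg
  obtain ⟨P, hP⟩ := he
  refine ⟨.ite (.seq p .isPair) (.seq q w) r, fun c => 1 + sz c + (1 + T c + (1 + sz (l c))) +
    (match l c with
      | [] => S c
      | a :: t => 1 + U c + V (c, a, t)), fun c => ?_, ?_⟩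
  · have h := hT c
    have h' : Run q (enc c) (.pair (enc c) (enc (l c))) (U c) := hU c
    dsimp only
    unfold sz
    cases hlc : l c with
    | nil =>
      rw [hlc, enc_nil] at h
      dsimp only
      exact .ite_false (.seq h (.isPair_int 0)) (hS c)
    | cons a t =>
      rw [hlc, enc_cons] at h
      rw [hlc] at h'
      dsimp only
      exact .ite_true (.seq h (.isPair_pair _ _)) one_ne_zero (.seq h' (hV (c, a, t)))
  · have hs' : PolyBdd (fun c => sz (l c)) sz := hb.mono fun c => (hT c).size_le
    refine ((((PolyBdd.const 1 _).add (PolyBdd.refl _)).add (((PolyBdd.const 1 _).add hb).add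
      ((PolyBdd.const 1 _).add hs'))).add (hd.add (((PolyBdd.const 1 _).add hc).add
        (.eval P hs)))).mono fun c => ?_
    cases hlc : l c with
    | nil => simp only; omega
    | cons a t =>
      have := hP (c, a, t)
      have e : sz ((c, a, t) : γ × α × List α) = sz (c, a :: t) := rfl
      simp only
      rw [e] at this
      omega

@[fun_prop]
theorem PF.headD {l : γ → List α} {d : γ → α} (hl : PF l) (hd : PF d) :
    PF fun c => (l c).headD (d c) := by
  have := PF.listCases (g := fun _ a _ => a) hl hd (by fun_prop)
  convert this using 2 with c
  cases l c <;> rfl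

@[fun_prop]
theorem PF.tail {l : γ → List α} (hl : PF l) : PF fun c => (l c).tail := by
  have := PF.listCases (g := fun _ _ t => t) hl (PF.const []) (by fun_prop)
  convert this using 2 with c
  cases l c <;> rfl

theorem PP.ne_nil {l : γ → List α} [DecidablePred fun c => l c ≠ []] (hl : PF l) :
    PP fun c => l c ≠ [] := by
  have := PF.listCases (g := fun _ _ _ => (1 : ℤ)) hl (PF.const 0) (by fun_prop)
  unfold PP
  convert this using 2 with c
  cases h : l c <;> simp [h]

/-- Folding a polynomial-time function over a list, if an invariant (which may depend on the
number of steps that have been made) bounds the size of the intermediate states. -/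
theorem PF.foldl {l : γ → List α} {init : γ → σ} {step : γ → σ → α → σ} (hl : PF l)
    (hi : PF init) (hs : PF fun p : γ × σ × α => step p.1 p.2.1 p.2.2)
    (Inv : γ → ℕ → σ → Prop) (h0 : ∀ c, Inv c 0 (init c))
    (h1 : ∀ c k s, ∀ a ∈ l c, k < (l c).length → Inv c k s → Inv c (k + 1) (step c s a))
    (h2 : ∃ B : γ → ℕ, PolyBdd B sz ∧ ∀ c k s, k ≤ (l c).length → Inv c k s → sz s ≤ B c) :
    PF fun c => (l c).foldl (step c) (init c) := by
  obtain ⟨B, ⟨P, hP⟩, hB⟩ := h2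
  have hsl := hl.polyBdd_sz
  obtain ⟨Q, hQ⟩ := hsl
  -- The loop state carries the parameter and the unread part of the list next to the accumulator.
  let F : (γ × σ) × List α → (γ × σ) × List α := fun x => match x.2 with
    | [] => x
    | a :: t => ((x.1.1, step x.1.1 x.1.2 a), t)
  have hF : PF F := PF.listCases (l := fun x : (γ × σ) × List α => x.2) (f := fun x => x)
    (g := fun x a t => ((x.1.1, step x.1.1 x.1.2 a), t)) (by fun_prop) (by fun_prop) (by
      have : PF fun p : ((γ × σ) × List α) × α × List α => step p.1.1.1 p.1.1.2 p.2.1 :=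
        hs.comp (f := fun p : ((γ × σ) × List α) × α × List α => (p.1.1.1, p.1.1.2, p.2.1))
          (by fun_prop)
      fun_prop)
  have hiter : ∀ (c : γ) (l : List α) (s : σ) (i : ℕ), i ≤ l.length →
      F^[i] ((c, s), l) = ((c, (l.take i).foldl (step c) s), l.drop i) := by
    intro c l
    induction l with
    | nil => intro s i hi; simp at hi; subst hi; rfl
    | cons a l ih =>
      intro s i hi
      cases i with
      | zero => rfl
      | succ i =>
        rw [Function.iterate_succ_apply]
        exact ih _ i (by simpa using hi)
  have hmain : PF fun c => F^[(l c).length] ((c, init c), l c) := by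
    classical
    refine PF.iterate (c := fun x : (γ × σ) × List α => x.2 ≠ []) hF (PP.ne_nil (by fun_prop))
      (by fun_prop) (hl.polyBdd_sz.mono fun c => (length_lt_sz _).le) ?_ ?_
      (.C 2 + .X + P + Q) ?_
    · intro c i hi
      rw [hiter c _ _ i hi.le]
      simpa using hi
    · intro c
      rw [hiter c _ _ _ le_rfl]
      simp
    · intro c i hi
      rw [hiter c _ _ i hi]
      have hk : Inv c i (((l c).take i).foldl (step c) (init c)) := by
        have := foldl_counter (Inv := Inv c) (step := step c) ((l c).take i) 0 (init c) (h0 c)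
          (fun j s a ha hj => h1 c j s a (List.mem_of_mem_take ha) (by
            rw [List.length_take] at hj; omega))
        simpa [hi] using this
      have e1 := (hB c i _ hi hk).trans (hP c)
      have e2 : sz ((l c).drop i) ≤ sz (l c) := by
        generalize l c = t
        induction t generalizing i with
        | nil => simp
        | cons a t ih =>
          cases i with
          | zero => simp
          | succ i =>
            rw [sz_cons, List.drop_succ_cons]
            have : sz (t.drop i) ≤ sz t := by
              clear * -
              induction t generalizing i with
              | nil => simp
              | cons b t ih =>
                cases i with
                | zero => simp
                | succ i => rw [sz_cons, List.drop_succ_cons]; have := ih i; omega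
            omega
      have e3 : sz (l c) ≤ _ := hQ c
      simp only [sz_pair, Polynomial.eval_add, Polynomial.eval_C, Polynomial.eval_X]
      omega
  have := PF.snd.comp (PF.fst.comp hmain)
  convert this using 2 with c
  rw [hiter c _ _ _ le_rfl]
  simp

end
end BitCost

namespace BitCost

theorem foldl_cons_eq {α β : Type*} (f : α → β) (l : List α) (t : List β) :
    l.foldl (fun s a => f a :: s) t = (l.map f).reverse ++ t := by
  induction l generalizing t with
  | nil => rfl
  | cons a l ih => simp [ih]

section

variable {α β γ δ σ : Type*} [Enc α] [Enc β] [Enc γ] [Enc δ] [Enc σ]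

theorem sz_tail_le (l : List α) : sz l.tail ≤ sz l := by
  cases l with
  | nil => simp
  | cons a l => rw [sz_cons, List.tail_cons]; omega

theorem sz_headD_le (l : List α) (d : α) : sz (l.headD d) ≤ sz l + sz d := by
  cases l with
  | nil => simp
  | cons a l => rw [sz_cons, List.headD_cons]; omega

theorem PF.mapRev {l : γ → List α} {f : γ → α → β} (hl : PF l)
    (hf : PF fun p : γ × α => f p.1 p.2) :
    PF fun c => (l c).foldl (fun s a => f c a :: s) [] := by
  obtain ⟨P, hP⟩ := hf.polyBdd_sz
  refine PF.foldl (step := fun c s a => f c a :: s) hl (PF.const []) (PF.cons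
    (hf.comp (f := fun p : γ × List β × α => (p.1, p.2.2)) (by fun_prop)) (by fun_prop))
    (fun c k s => sz s ≤ 1 + k * (1 + P.eval (1 + sz c + sz (l c))))
    (fun c => by simp [sz_nil]) (fun c k s a ha _ hs => ?_)
    ⟨fun c => 1 + sz (l c) * (1 + P.eval (1 + sz c + sz (l c))), ?_, fun c k s hk hs => ?_⟩
  · have h : sz (f c a) ≤ P.eval (1 + sz c + sz (l c)) :=
      (hP (c, a)).trans (polynomial_eval_mono P (by
        have := sz_lt_of_mem ha
        rw [sz_pair]; dsimp only; omega))
    rw [sz_cons, add_mul]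
    omega
  · have h := hl.polyBdd_sz
    exact (PolyBdd.const 1 _).add (h.mul ((PolyBdd.const 1 _).add
      (.eval P (((PolyBdd.const 1 _).add (.refl _)).add h))))
  · refine hs.trans ?_
    have := length_lt_sz (l c)
    dsimp only
    gcongr
    omega

@[fun_prop]
theorem PF.reverse {l : γ → List α} (hl : PF l) : PF fun c => (l c).reverse := by
  simpa [foldl_cons_eq] using PF.mapRev (f := fun _ a => a) hl (by fun_prop)

theorem PF.map {l : γ → List α} {f : γ → α → β} (hl : PF l)
    (hf : PF fun p : γ × α => f p.1 p.2) : PF fun c => (l c).map (f c) := by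
  simpa [foldl_cons_eq] using (PF.mapRev hl hf).reverse

@[fun_prop]
theorem PF.append {l t : γ → List α} (hl : PF l) (ht : PF t) : PF fun c => l c ++ t c := by
  have := PF.foldl (step := fun _ s a => a :: s) hl.reverse ht (by fun_prop)
    (fun c k s => sz s ≤ sz (t c) + k * (1 + sz (l c))) (fun c => by simp)
    (fun c k s a ha _ hs => by
      have := sz_lt_of_mem (List.mem_reverse.1 ha)
      rw [sz_cons, add_mul]
      omega)
    ⟨fun c => sz (t c) + sz (l c) * (1 + sz (l c)), ?_, fun c k s hk hs => hs.trans (by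
      have := length_lt_sz (l c)
      rw [List.length_reverse] at hk
      dsimp only
      gcongr
      omega)⟩
  · have e := fun (l t : List α) => foldl_cons_eq (fun a => a) l t
    simpa [e] using this
  · have h := hl.polyBdd_sz
    exact ht.polyBdd_sz.add (h.mul ((PolyBdd.const 1 _).add h))

/-- The list of the values of `f` on the pairs of entries of two lists; the second list is
continued by `d`, and `g` is applied to what remains of it at the end of the first list. -/
def zipPad {α β δ : Type*} (f : α → β → δ) (g : β → δ) (d : β) : List α → List β → List δ
  | [], ys => ys.map g
  | a :: l, ys => f a (ys.headD d) :: zipPad f g d l ys.tail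

/-- Replaces the recursion by a fold, so that `PF.foldl` applies. -/
theorem zipPad_eq_foldl {α β δ : Type*} (f : α → β → δ) (g : β → δ) (d : β) (l : List α)
    (ys : List β) :
    zipPad f g d l ys =
      (l.foldl (fun s a => (s.1.tail, f a (s.1.headD d) :: s.2)) (ys, ([] : List δ))).2.reverse ++
      (l.foldl (fun s a => (s.1.tail, f a (s.1.headD d) :: s.2)) (ys, ([] : List δ))).1.map g := by
  suffices h : ∀ acc : List δ, acc.reverse ++ zipPad f g d l ys =
      (l.foldl (fun s a => (s.1.tail, f a (s.1.headD d) :: s.2)) (ys, acc)).2.reverse ++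
      (l.foldl (fun s a => (s.1.tail, f a (s.1.headD d) :: s.2)) (ys, acc)).1.map g from h []
  induction l generalizing ys with
  | nil => intro acc; simp [zipPad]
  | cons a l ih =>
    intro acc
    rw [List.foldl_cons, ← ih]
    simp [zipPad]

theorem PF.zipPad {l : γ → List α} {ys : γ → List β} {f : γ → α → β → δ} {g : γ → β → δ}
    {d : β} (hl : PF l) (hy : PF ys) (hf : PF fun p : γ × α × β => f p.1 p.2.1 p.2.2)
    (hg : PF fun p : γ × β => g p.1 p.2) :
    PF fun c => zipPad (f c) (g c) d (l c) (ys c) := by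
  obtain ⟨P, hP⟩ := hf.polyBdd_sz
  have key := PF.foldl (l := l) (init := fun c => (ys c, ([] : List δ)))
    (step := fun c s a => (s.1.tail, f c a (s.1.headD d) :: s.2)) hl (by fun_prop)
    (PF.prodMk (by fun_prop) (PF.cons (hf.comp
      (f := fun p : γ × (List β × List δ) × α => (p.1, p.2.2, p.2.1.1.headD d)) (by fun_prop))
      (by fun_prop)))
    (fun c k s => sz s.1 ≤ sz (ys c) ∧
      sz s.2 ≤ 1 + k * (1 + P.eval (2 + sz c + sz (l c) + sz (ys c) + sz d)))
    (fun c => by simp [sz_nil]) (fun c k s a ha _ hs => ⟨(sz_tail_le _).trans hs.1, ?_⟩)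
    ⟨fun c => 1 + sz (ys c) +
      (1 + sz (l c) * (1 + P.eval (2 + sz c + sz (l c) + sz (ys c) + sz d))), ?_,
      fun c k s hk hs => ?_⟩
  · simp_rw [zipPad_eq_foldl]
    exact (PF.reverse (by fun_prop)).append (PF.map (by fun_prop) hg)
  · have h : sz (f c a (s.1.headD d)) ≤ P.eval (2 + sz c + sz (l c) + sz (ys c) + sz d) :=
      (hP (c, a, s.1.headD d)).trans (polynomial_eval_mono P (by
        have := sz_lt_of_mem ha
        have := sz_headD_le s.1 d
        have := hs.1
        rw [sz_pair, sz_pair]; dsimp only; omega))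
    have := hs.2
    rw [sz_cons, add_mul]
    omega
  · have h := hl.polyBdd_sz
    have h' := hy.polyBdd_sz
    exact ((PolyBdd.const 1 _).add h').add ((PolyBdd.const 1 _).add (h.mul
      ((PolyBdd.const 1 _).add (.eval P (((((PolyBdd.const 2 _).add (.refl _)).add h).add h').add
        (.const _ _))))))
  · have h1 := length_lt_sz (l c)
    have h2 : 1 + k * (1 + P.eval (2 + sz c + sz (l c) + sz (ys c) + sz d)) ≤
        1 + sz (l c) * (1 + P.eval (2 + sz c + sz (l c) + sz (ys c) + sz d)) := by
      gcongr; omega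
    have := hs.1
    have := hs.2
    rw [sz_pair]
    dsimp only
    omega

@[fun_prop]
theorem PF.abs {f : γ → ℤ} (hf : PF f) : PF fun c => |f c| := by
  have := PF.ite (PP.lt hf (PF.const 0)) hf.neg hf
  convert this using 2 with c
  split_ifs with h
  · exact abs_of_neg h
  · exact abs_of_nonneg (not_lt.1 h)

/-- A list whose length is the number of binary digits of `m`. -/
def fuel (m : ℤ) : List ℤ := List.replicate (Nat.size m.natAbs) 0

-- Halving `|m|` until it vanishes takes as many rounds as `m` has binary digits. Folding over `fuel
-- m` is the way to repeat a step a number of times that is logarithmic in `m`.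
@[fun_prop]
theorem PF.fuel {m : γ → ℤ} (hm : PF m) : PF fun c => fuel (m c) := by
  suffices h : PF BitCost.fuel from h.comp hm
  have hiter : ∀ (i : ℕ) (m : ℤ), (fun s : ℤ × List ℤ => (s.1 / 2, 0 :: s.2))^[i] (|m|, []) =
      (((m.natAbs / 2 ^ i : ℕ) : ℤ), List.replicate i 0) := by
    intro i m
    induction i with
    | zero => simp
    | succ i ih =>
      rw [Function.iterate_succ_apply', ih, List.replicate_succ, pow_succ, ← Nat.div_div_eq_div_mul]
      push_cast
      rfl
  have hpos : ∀ (i : ℕ) (n : ℕ), 0 < n / 2 ^ i ↔ i < Nat.size n := by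
    intro i n
    rw [Nat.div_pos_iff, Nat.lt_size]
    exact ⟨fun h => h.2, fun h => ⟨by positivity, h⟩⟩
  have key := PF.iterate (f := fun s : ℤ × List ℤ => (s.1 / 2, 0 :: s.2)) (c := fun s => 0 < s.1)
    (init := fun m : ℤ => (|m|, [])) (n := fun m => Nat.size m.natAbs)
    (by fun_prop) (PP.lt (by fun_prop) (by fun_prop)) (by fun_prop)
    ((PolyBdd.refl _).mono fun m => by rw [sz_int]; omega)
    (fun m i hi => by
      rw [hiter]
      exact Int.natCast_pos.2 ((hpos i _).2 hi))
    (fun m => by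
      rw [hiter]
      exact mt Int.natCast_pos.1 (mt (hpos (Nat.size m.natAbs) _).1 (lt_irrefl _)))
    (.C 2 + .C 3 * .X) (fun m i hi => by
      have h1 : sz (List.replicate i (0 : ℤ)) ≤ 1 + i * (1 + 1) := by
        simpa using sz_list_le (l := List.replicate i (0 : ℤ)) (B := 1) (fun a ha => by
          rw [List.eq_of_mem_replicate ha, sz_int]; simp)
      have h2 : Nat.size (m.natAbs / 2 ^ i) ≤ Nat.size m.natAbs :=
        Nat.size_le_size (Nat.div_le_self _ _)
      rw [hiter, sz_pair]
      simp only [sz_int, Int.natAbs_natCast, Polynomial.eval_add, Polynomial.eval_mul,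
        Polynomial.eval_C, Polynomial.eval_X]
      omega)
  have := PF.snd.comp key
  convert this using 2 with m
  rw [hiter]
  rfl

end

/-! ### Linear algebra modulo an integer -/

/-- Reduction modulo `m`, which is meaningful for `m > 0`. -/
def red (m z : ℤ) : ℤ := if 0 < m then z % m else 0

/-- The vector `p - q x`, with entries reduced modulo `m`. -/
def comb (m q : ℤ) : List ℤ → List ℤ → List ℤ :=
  zipPad (fun a b => red m (a - q * b)) (fun b => red m (-(q * b))) 0

/-- The matrix `p - q x`, with entries reduced modulo `m`. -/
def combM (m q : ℤ) : List (List ℤ) → List (List ℤ) → List (List ℤ) :=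
  zipPad (comb m q) (comb m q []) []

/-- A row of a system of linear equations consists of a vector, on which elimination is
performed, and a matrix, to which the same operations are applied. -/
abbrev Row := List ℤ × List (List ℤ)

/-- The row `p - q x`, with entries reduced modulo `m`. -/
def rowComb (m q : ℤ) (p x : Row) : Row := (comb m q p.1 x.1, combM m q p.2 x.2)

/-- The leading coefficient of a row. -/
def Row.hd (p : Row) : ℤ := p.1.headD 0

/-- Remove the leading coefficient of a row. -/
def Row.dropHd (p : Row) : Row := (p.1.tail, p.2)

/-- One step of the Euclidean algorithm on the leading coefficients of two rows. -/
def eucStep (m : ℤ) (s : Row × Row) : Row × Row :=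
  if s.2.hd = 0 then s else (s.2, rowComb m (s.1.hd / s.2.hd) s.1 s.2)

/-- The Euclidean algorithm on the leading coefficients of two rows. -/
def euclid (m : ℤ) (s : Row × Row) : Row × Row :=
  (fuel (2 * m * m)).foldl (fun s _ => eucStep m s) s

/-- Clear the leading coefficients of `rows` by means of the pivot row `p`. -/
def clear (m : ℤ) (p : Row) (rows : List Row) : Row × List Row :=
  rows.foldl (fun s x => ((euclid m (s.1, x)).1, (euclid m (s.1, x)).2.dropHd :: s.2)) (p, [])

/-- Eliminate the first column: a pivot row, and the remaining rows. -/
def elimCol (m : ℤ) (rows : List Row) : Row × List Row :=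
  clear m ([m], []) (rows.map fun x => rowComb m 0 x ([], []))

/-- The rows that remain after elimination of as many columns as the list `tmpl` is long. -/
def elimCols {α : Type*} (m : ℤ) (rows : List Row) (tmpl : List α) : List Row :=
  tmpl.foldl (fun rows _ => (elimCol m rows).2) rows

/-- The linear combination modulo `m` of the entries of `C` with coefficients `v`. -/
def lincomb (m : ℤ) (v : List ℤ) (C : List (List ℤ)) : List ℤ :=
  (zipPad Prod.mk (Prod.mk 0) [] v C).foldl (fun s p => comb m (-p.1) s p.2) []

/-! ### Size bounds that elimination modulo `m` preserves. -/

section Bounds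

/-- `v` has at most `S` entries, of at most `S` bits. -/
def VB (S : ℕ) (v : List ℤ) : Prop := v.length ≤ S ∧ ∀ z ∈ v, Nat.size z.natAbs ≤ S

/-- `P` has at most `S` entries, which are vectors with at most `S` entries of at most `S` bits. -/
def MB (S : ℕ) (P : List (List ℤ)) : Prop := P.length ≤ S ∧ ∀ v ∈ P, VB S v

/-- Both parts of a row are bounded by `S`. -/
def RB (S : ℕ) (p : Row) : Prop := VB S p.1 ∧ MB S p.2

/-- A bound for the size of `v` when `VB S v`. -/
def vbd (S : ℕ) : ℕ := 1 + S * (1 + (1 + S))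

/-- A bound for the size of `P` when `MB S P`. -/
def mbd (S : ℕ) : ℕ := 1 + S * (1 + vbd S)

/-- A bound for the size of `p` when `RB S p`. -/
def rbd (S : ℕ) : ℕ := 1 + vbd S + mbd S

variable {α : Type*} {f g : α → ℕ}

theorem PolyBdd.vbd (hf : PolyBdd f g) : PolyBdd (fun a => vbd (f a)) g :=
  (PolyBdd.const 1 _).add (hf.mul ((PolyBdd.const 1 _).add ((PolyBdd.const 1 _).add hf)))

theorem PolyBdd.mbd (hf : PolyBdd f g) : PolyBdd (fun a => mbd (f a)) g :=
  (PolyBdd.const 1 _).add (hf.mul ((PolyBdd.const 1 _).add hf.vbd))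

theorem PolyBdd.rbd (hf : PolyBdd f g) : PolyBdd (fun a => rbd (f a)) g :=
  ((PolyBdd.const 1 _).add hf.vbd).add hf.mbd

variable {S : ℕ}

theorem VB.sz_le {v : List ℤ} (h : VB S v) : sz v ≤ vbd S := by
  refine (sz_list_le (B := 1 + S) fun z hz => by rw [sz_int]; have := h.2 z hz; omega).trans ?_
  unfold vbd
  gcongr
  exact h.1

theorem MB.sz_le {P : List (List ℤ)} (h : MB S P) : sz P ≤ mbd S := by
  refine (sz_list_le (B := vbd S) fun z hz => (h.2 z hz).sz_le).trans ?_
  unfold mbd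
  gcongr
  exact h.1

theorem RB.sz_le {p : Row} (h : RB S p) : sz p ≤ rbd S := by
  have := h.1.sz_le
  have := h.2.sz_le
  rw [sz_pair]
  unfold rbd
  omega

theorem VB.of_sz_le {v : List ℤ} (h : sz v ≤ S) : VB S v :=
  ⟨(length_lt_sz v).le.trans h, fun z hz => by
    have := sz_lt_of_mem hz
    rw [sz_int] at this
    omega⟩

theorem MB.of_sz_le {P : List (List ℤ)} (h : sz P ≤ S) : MB S P :=
  ⟨(length_lt_sz P).le.trans h, fun _ hv => .of_sz_le ((sz_lt_of_mem hv).le.trans h)⟩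

theorem RB.of_sz_le {p : Row} (h : sz p ≤ S) : RB S p := by
  rw [sz_pair] at h
  exact ⟨.of_sz_le (by omega), .of_sz_le (by omega)⟩

theorem VB.nil : VB S [] := ⟨by simp, by simp⟩

theorem MB.nil : MB S [] := ⟨by simp, by simp⟩

/-- The value `0` given to `red` for nonpositive moduli makes this valid for every `m`, so that
running times can be estimated on all inputs, meaningful or not. -/
theorem size_red_le {m : ℤ} (hm : Nat.size m.natAbs ≤ S) (z : ℤ) :
    Nat.size (red m z).natAbs ≤ S := by
  unfold red
  split_ifs with h
  · refine (Nat.size_le_size ?_).trans hm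
    have h1 := Int.emod_nonneg z h.ne'
    have h2 := Int.emod_lt_of_pos z h
    omega
  · simp

theorem length_zipPad {α β δ : Type*} (f : α → β → δ) (g : β → δ) (d : β) (l : List α)
    (ys : List β) : (zipPad f g d l ys).length = max l.length ys.length := by
  induction l generalizing ys with
  | nil => simp [zipPad]
  | cons a l ih => cases ys <;> simp [zipPad, ih]

theorem forall_mem_zipPad {α β δ : Type*} {f : α → β → δ} {g : β → δ} {d : β} {l : List α}
    {ys : List β} {Q : δ → Prop} (hf : ∀ a ∈ l, ∀ b ∈ d :: ys, Q (f a b))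
    (hg : ∀ b ∈ ys, Q (g b)) : ∀ z ∈ zipPad f g d l ys, Q z := by
  induction l generalizing ys with
  | nil => simpa [zipPad] using hg
  | cons a l ih =>
    intro z hz
    rcases List.mem_cons.1 hz with rfl | hz
    · exact hf a (by simp) _ (by cases ys <;> simp)
    · refine ih (fun a ha b hb => hf a (by simp [ha]) b ?_)
        (fun b hb => hg b (List.mem_of_mem_tail hb)) z hz
      rcases List.mem_cons.1 hb with rfl | hb
      · simp
      · exact List.mem_cons_of_mem _ (List.mem_of_mem_tail hb)

theorem VB.comb {m : ℤ} (hm : Nat.size m.natAbs ≤ S) (q : ℤ) {p x : List ℤ} (hp : p.length ≤ S)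
    (hx : x.length ≤ S) : VB S (comb m q p x) :=
  ⟨by rw [BitCost.comb, length_zipPad]; omega,
    forall_mem_zipPad (fun _ _ _ _ => size_red_le hm _) fun _ _ => size_red_le hm _⟩

theorem MB.combM {m : ℤ} (hm : Nat.size m.natAbs ≤ S) (q : ℤ) {p x : List (List ℤ)}
    (hp : MB S p) (hx : MB S x) : MB S (combM m q p x) := by
  refine ⟨by rw [BitCost.combM, length_zipPad]; have := hp.1; have := hx.1; omega,
    forall_mem_zipPad (fun a ha b hb => .comb hm _ (hp.2 a ha).1 ?_) fun b hb =>
      .comb hm _ (by simp) (hx.2 b hb).1⟩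
  rcases List.mem_cons.1 hb with rfl | hb
  · simp
  · exact (hx.2 b hb).1

theorem RB.rowComb {m : ℤ} (hm : Nat.size m.natAbs ≤ S) (q : ℤ) {p x : Row} (hp : RB S p)
    (hx : RB S x) : RB S (rowComb m q p x) :=
  ⟨.comb hm q hp.1.1 hx.1.1, .combM hm q hp.2 hx.2⟩

theorem RB.dropHd {p : Row} (hp : RB S p) : RB S p.dropHd :=
  ⟨⟨by have := hp.1.1; simp only [Row.dropHd, List.length_tail]; omega,
    fun z hz => hp.1.2 z (List.mem_of_mem_tail hz)⟩, hp.2⟩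

theorem RB.eucStep {m : ℤ} (hm : Nat.size m.natAbs ≤ S) {s : Row × Row}
    (hs : RB S s.1 ∧ RB S s.2) : RB S (eucStep m s).1 ∧ RB S (eucStep m s).2 := by
  unfold BitCost.eucStep
  split_ifs
  · exact hs
  · exact ⟨hs.2, .rowComb hm _ hs.1 hs.2⟩

theorem foldl_induction {α σ : Type*} {Q : σ → Prop} {step : σ → α → σ} {l : List α} {s : σ}
    (h0 : Q s) (h1 : ∀ s, ∀ a ∈ l, Q s → Q (step s a)) : Q (l.foldl step s) :=
  List.foldlRecOn l step h0 fun s hs a ha => h1 s a ha hs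

theorem RB.euclid {m : ℤ} (hm : Nat.size m.natAbs ≤ S) {s : Row × Row}
    (hs : RB S s.1 ∧ RB S s.2) : RB S (euclid m s).1 ∧ RB S (euclid m s).2 :=
  foldl_induction (Q := fun s : Row × Row => RB S s.1 ∧ RB S s.2) hs
    fun _ _ _ h => RB.eucStep hm h

/-- A list of at most `k` rows that are bounded by `S`. -/
def RsB (S k : ℕ) (rows : List Row) : Prop := rows.length ≤ k ∧ ∀ x ∈ rows, RB S x

theorem RsB.sz_le {k : ℕ} {rows : List Row} (h : RsB S k rows) :
    sz rows ≤ 1 + k * (1 + rbd S) := by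
  refine (sz_list_le (B := rbd S) fun z hz => (h.2 z hz).sz_le).trans ?_
  gcongr
  exact h.1

theorem RsB.cons {k : ℕ} {x : Row} {rows : List Row} (hx : RB S x) (h : RsB S k rows) :
    RsB S (k + 1) (x :: rows) :=
  ⟨by have := h.1; simp only [List.length_cons]; omega,
    fun y hy => (List.mem_cons.1 hy).elim (fun e => e ▸ hx) (h.2 y)⟩

/-- Every row cleared leaves exactly one row, with entries reduced modulo `m`. Hence elimination of
any number of columns never makes the data grow. -/
theorem RsB.clear {m : ℤ} (hm : Nat.size m.natAbs ≤ S) {p : Row} {k : ℕ} {rows : List Row}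
    (hp : RB S p) (hr : RsB S k rows) :
    RB S (clear m p rows).1 ∧ RsB S k (clear m p rows).2 := by
  have := foldl_counter (Inv := fun k (s : Row × List Row) => RB S s.1 ∧ RsB S k s.2)
    (step := fun s x => ((BitCost.euclid m (s.1, x)).1,
      (BitCost.euclid m (s.1, x)).2.dropHd :: s.2)) rows 0 (p, [])
    ⟨hp, by simp [RsB]⟩ fun k s x hx _ h => by
      have := RB.euclid (s := (s.1, x)) hm ⟨h.1, hr.2 x hx⟩
      exact ⟨this.1, .cons this.2.dropHd h.2⟩
  exact ⟨this.1, this.2.1.trans (by simpa using hr.1), this.2.2⟩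

theorem RsB.elimCol {m : ℤ} (hm : sz m ≤ S) {k : ℕ} {rows : List Row}
    (hr : RsB S k rows) : RB S (elimCol m rows).1 ∧ RsB S k (elimCol m rows).2 := by
  rw [sz_int] at hm
  have hm' : Nat.size m.natAbs ≤ S := by omega
  refine RsB.clear hm' ⟨⟨by simp; omega, by simpa using hm'⟩, .nil⟩ ⟨by simpa using hr.1, ?_⟩
  intro x hx
  obtain ⟨y, hy, rfl⟩ := List.mem_map.1 hx
  exact .rowComb hm' _ (hr.2 y hy) ⟨.nil, .nil⟩

theorem RsB.elimCols {α : Type*} {m : ℤ} (hm : sz m ≤ S) {k : ℕ} {rows : List Row}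
    (hr : RsB S k rows) (tmpl : List α) : RsB S k (elimCols m rows tmpl) :=
  foldl_induction (Q := RsB S k) hr fun _ _ _ h => (RsB.elimCol hm h).2

theorem VB.lincomb {m : ℤ} (hm : Nat.size m.natAbs ≤ S) (v : List ℤ) {C : List (List ℤ)}
    (hC : ∀ w ∈ C, w.length ≤ S) : VB S (lincomb m v C) := by
  have h : ∀ p ∈ BitCost.zipPad Prod.mk (Prod.mk (0 : ℤ)) [] v C, p.2.length ≤ S := by
    refine forall_mem_zipPad (fun a _ b hb => ?_) hC
    rcases List.mem_cons.1 hb with rfl | hb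
    · simp
    · exact hC b hb
  exact foldl_induction (Q := VB S) .nil fun s p hp hs => .comb hm _ hs.1 (h p hp)

end Bounds

/-! ### Elimination runs in polynomial time. -/

section

variable {γ α : Type*} [Enc γ] [Enc α]

@[fun_prop]
theorem PF.red {m z : γ → ℤ} (hm : PF m) (hz : PF z) : PF fun c => red (m c) (z c) :=
  .ite (.lt (.const 0) hm) (.mod hz hm) (.const 0)

@[fun_prop]
theorem PF.comb {m q : γ → ℤ} {p x : γ → List ℤ} (hm : PF m) (hq : PF q) (hp : PF p)
    (hx : PF x) : PF fun c => comb (m c) (q c) (p c) (x c) :=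
  PF.zipPad hp hx (by fun_prop) (by fun_prop)

@[fun_prop]
theorem PF.combM {m q : γ → ℤ} {p x : γ → List (List ℤ)} (hm : PF m) (hq : PF q) (hp : PF p)
    (hx : PF x) : PF fun c => combM (m c) (q c) (p c) (x c) :=
  PF.zipPad hp hx (by fun_prop) (by fun_prop)

@[fun_prop]
theorem PF.rowComb {m q : γ → ℤ} {p x : γ → Row} (hm : PF m) (hq : PF q) (hp : PF p)
    (hx : PF x) : PF fun c => rowComb (m c) (q c) (p c) (x c) := by
  unfold BitCost.rowComb
  fun_prop

@[fun_prop]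
theorem PF.hd {p : γ → Row} (hp : PF p) : PF fun c => (p c).hd := by
  unfold Row.hd
  fun_prop

@[fun_prop]
theorem PF.dropHd {p : γ → Row} (hp : PF p) : PF fun c => (p c).dropHd := by
  unfold Row.dropHd
  fun_prop

@[fun_prop]
theorem PF.eucStep {m : γ → ℤ} {s : γ → Row × Row} (hm : PF m) (hs : PF s) :
    PF fun c => eucStep (m c) (s c) :=
  .ite (.eq (by fun_prop) (.const 0)) hs (by fun_prop)

@[fun_prop]
theorem PF.euclid {m : γ → ℤ} {s : γ → Row × Row} (hm : PF m) (hs : PF s) :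
    PF fun c => euclid (m c) (s c) := by
  suffices h : PF fun c : ℤ × Row × Row => BitCost.euclid c.1 c.2 from h.comp (hm.prodMk hs)
  unfold BitCost.euclid
  refine PF.foldl (γ := ℤ × Row × Row) (l := fun c => BitCost.fuel (2 * c.1 * c.1))
    (init := fun c => c.2) (step := fun c s _ => BitCost.eucStep c.1 s) (by fun_prop) (by fun_prop)
    (by fun_prop) (fun c _ s => RB (sz c) s.1 ∧ RB (sz c) s.2) (fun c => ?_)
    (fun c k s _ _ _ hs => RB.eucStep ?_ hs) ⟨fun c => 1 + rbd (sz c) + rbd (sz c), ?_, ?_⟩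
  · simp only [sz_pair]
    exact ⟨.of_sz_le (by rw [sz_pair]; omega), .of_sz_le (by rw [sz_pair]; omega)⟩
  · rw [sz_pair, sz_int]; omega
  · have := (PolyBdd.refl (sz : ℤ × Row × Row → ℕ)).rbd
    exact ((PolyBdd.const 1 _).add this).add this
  · rintro c k s - ⟨h1, h2⟩
    rw [sz_pair]
    exact add_le_add (add_le_add_right h1.sz_le 1) h2.sz_le

theorem RsB.of_sz_le {S : ℕ} {rows : List Row} (h : sz rows ≤ S) : RsB S S rows :=
  ⟨(length_lt_sz rows).le.trans h, fun _ hx => .of_sz_le ((sz_lt_of_mem hx).le.trans h)⟩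

@[fun_prop]
theorem PF.clear {m : γ → ℤ} {p : γ → Row} {rows : γ → List Row} (hm : PF m) (hp : PF p)
    (hr : PF rows) : PF fun c => clear (m c) (p c) (rows c) := by
  suffices h : PF fun c : ℤ × Row × List Row => BitCost.clear c.1 c.2.1 c.2.2 from
    h.comp (hm.prodMk (hp.prodMk hr))
  unfold BitCost.clear
  refine PF.foldl (γ := ℤ × Row × List Row) (l := fun c => c.2.2) (init := fun c => (c.2.1, []))
    (step := fun c s x => ((BitCost.euclid c.1 (s.1, x)).1,
      (BitCost.euclid c.1 (s.1, x)).2.dropHd :: s.2)) (by fun_prop) (by fun_prop)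
    (by fun_prop) (fun c k s => RB (sz c) s.1 ∧ RsB (sz c) k s.2) (fun c => ?_)
    (fun c k s x hx _ hs => ?_)
    ⟨fun c => 1 + rbd (sz c) + (1 + sz c * (1 + rbd (sz c))), ?_, ?_⟩
  · exact ⟨.of_sz_le (by rw [sz_pair c, sz_pair c.2]; dsimp only; omega), by simp [RsB]⟩
  · have := RB.euclid (m := c.1) (s := (s.1, x)) (S := sz c) (by rw [sz_pair, sz_int]; omega)
      ⟨hs.1, .of_sz_le (by
        have := sz_lt_of_mem hx
        rw [sz_pair c, sz_pair c.2]
        dsimp only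
        omega)⟩
    exact ⟨this.1, .cons this.2.dropHd hs.2⟩
  · have h := PolyBdd.refl (sz : ℤ × Row × List Row → ℕ)
    exact ((PolyBdd.const 1 _).add h.rbd).add ((PolyBdd.const 1 _).add
      (h.mul ((PolyBdd.const 1 _).add h.rbd)))
  · rintro c k s hk ⟨h1, h2⟩
    have h3 := h1.sz_le
    have h4 := h2.sz_le
    have h5 : 1 + k * (1 + rbd (sz c)) ≤ 1 + sz c * (1 + rbd (sz c)) := by
      have := length_lt_sz c.2.2
      gcongr
      rw [sz_pair, sz_pair]
      omega
    rw [sz_pair]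
    dsimp only
    omega

@[fun_prop]
theorem PF.elimCol {m : γ → ℤ} {rows : γ → List Row} (hm : PF m) (hr : PF rows) :
    PF fun c => elimCol (m c) (rows c) :=
  .clear hm (by fun_prop) (.map hr (by fun_prop))

@[fun_prop]
theorem PF.elimCols {m : γ → ℤ} {rows : γ → List Row} {tmpl : γ → List α} (hm : PF m)
    (hr : PF rows) (ht : PF tmpl) : PF fun c => elimCols (m c) (rows c) (tmpl c) := by
  suffices h : PF fun c : ℤ × List Row × List α => BitCost.elimCols c.1 c.2.1 c.2.2 from
    h.comp (hm.prodMk (hr.prodMk ht))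
  unfold BitCost.elimCols
  refine PF.foldl (γ := ℤ × List Row × List α) (l := fun c => c.2.2) (init := fun c => c.2.1)
    (step := fun c s x => (BitCost.elimCol c.1 s).2) (by fun_prop) (by fun_prop)
    (by fun_prop) (fun c k s => RsB (sz c) (sz c) s) (fun c => ?_)
    (fun c k s x hx _ hs => (RsB.elimCol ?_ hs).2)
    ⟨fun c => 1 + sz c * (1 + rbd (sz c)), ?_, fun c k s _ hs => hs.sz_le⟩
  · exact .of_sz_le (by rw [sz_pair, sz_pair]; omega)
  · rw [sz_pair]; omega
  · have h := PolyBdd.refl (sz : ℤ × List Row × List α → ℕ)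
    exact (PolyBdd.const 1 _).add (h.mul ((PolyBdd.const 1 _).add h.rbd))

@[fun_prop]
theorem PF.lincomb {m : γ → ℤ} {v : γ → List ℤ} {C : γ → List (List ℤ)} (hm : PF m)
    (hv : PF v) (hC : PF C) : PF fun c => lincomb (m c) (v c) (C c) := by
  suffices h : PF fun c : ℤ × List ℤ × List (List ℤ) => BitCost.lincomb c.1 c.2.1 c.2.2 from
    h.comp (hm.prodMk (hv.prodMk hC))
  unfold BitCost.lincomb
  refine PF.foldl (γ := ℤ × List ℤ × List (List ℤ))
    (l := fun c => BitCost.zipPad Prod.mk (Prod.mk 0) [] c.2.1 c.2.2) (init := fun _ => [])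
    (step := fun c s p => BitCost.comb c.1 (-p.1) s p.2)
    (PF.zipPad (f := fun _ => Prod.mk) (g := fun _ => Prod.mk 0) (by fun_prop) (by fun_prop)
      (by fun_prop) (by fun_prop)) (by fun_prop)
    (by fun_prop) (fun c k s => VB (sz c) s) (fun c => .nil)
    (fun c k s p hp _ hs => ?_)
    ⟨fun c => vbd (sz c), (PolyBdd.refl _).vbd, fun c k s _ hs => hs.sz_le⟩
  have h : ∀ p ∈ BitCost.zipPad Prod.mk (Prod.mk (0 : ℤ)) [] c.2.1 c.2.2, p.2.length ≤ sz c := by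
    have : ∀ w ∈ c.2.2, w.length ≤ sz c := fun w hw => by
      have := length_lt_sz w
      have := sz_lt_of_mem hw
      rw [sz_pair, sz_pair]
      omega
    refine forall_mem_zipPad (fun a _ b hb => ?_) this
    rcases List.mem_cons.1 hb with rfl | hb
    · simp
    · exact this b hb
  exact .comb (by rw [sz_pair, sz_int]; omega) _ hs.1 (h p hp)

end

end BitCost

namespace BitCost

/-! ### Further functions on lists -/

/-- The inner product of two vectors. -/
def dot (u v : List ℤ) : ℤ :=
  (zipPad Prod.mk (Prod.mk 0) 0 u v).foldl (fun s p => s + p.1 * p.2) 0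

/-- The length of a list, as an integer. -/
def len {α : Type*} (l : List α) : ℤ := l.foldl (fun s _ => s + 1) 0

/-- The entry at position `k` of a list. -/
def nth {α : Type*} (l : List α) (k : ℤ) (d : α) : α :=
  (l.foldl (fun s a => (s.1 - 1, if s.1 = 0 then a else s.2)) (k, d)).2

/-- The first unit vectors, as many as the list `tmpl` is long, without trailing zeros. -/
def units {α : Type*} (tmpl : List α) : List (List ℤ) :=
  (tmpl.foldl (fun s _ => (0 :: s.1, s.1 :: s.2)) (([1] : List ℤ), ([] : List (List ℤ)))).2.reverse

/-- Make a vector as long as the list `tmpl`. -/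
def fit {α : Type*} (tmpl : List α) (g : List ℤ) : List ℤ :=
  (tmpl.foldl (fun s _ => (s.1.tail, s.1.headD 0 :: s.2)) (g, ([] : List ℤ))).2.reverse

/-- The product of the numbers `1 + |z|`. -/
def prodBound (l : List ℤ) : ℤ := l.foldl (fun s z => s * (1 + |z|)) 1

section

variable {γ α β : Type*} [Enc γ] [Enc α] [Enc β]

@[fun_prop]
theorem PF.dot {u v : γ → List ℤ} (hu : PF u) (hv : PF v) : PF fun c => dot (u c) (v c) := by
  suffices h : PF fun c : List ℤ × List ℤ => BitCost.dot c.1 c.2 from h.comp (hu.prodMk hv)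
  unfold BitCost.dot
  refine PF.foldl (γ := List ℤ × List ℤ)
    (l := fun c => BitCost.zipPad Prod.mk (Prod.mk 0) 0 c.1 c.2) (init := fun _ => 0)
    (step := fun _ s p => s + p.1 * p.2) (PF.zipPad (f := fun _ => Prod.mk)
      (g := fun _ => Prod.mk 0) (by fun_prop) (by fun_prop) (by fun_prop) (by fun_prop))
    (by fun_prop) (by fun_prop)
    -- With `S = sz c`, all entries are at most `2 ^ S` in absolute value, so a product adds at most
    -- `2 ^ S * 2 ^ S`; since `k < 2 ^ S`, the sum has at most `3 * S` bits.
    (fun c k s => s.natAbs ≤ k * (2 ^ sz c * 2 ^ sz c)) (fun c => by simp)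
    (fun c k s p hp _ hs => ?_) ⟨fun c => 1 + (sz c + sz c + sz c), ?_, fun c k s hk hs => ?_⟩
  · have h : ∀ p ∈ BitCost.zipPad Prod.mk (Prod.mk (0 : ℤ)) 0 c.1 c.2,
        p.1.natAbs ≤ 2 ^ sz c ∧ p.2.natAbs ≤ 2 ^ sz c := by
      have h1 : ∀ z : ℤ, sz z ≤ sz c → z.natAbs ≤ 2 ^ sz c := fun z hz =>
        (Nat.lt_size_self _).le.trans
          (Nat.pow_le_pow_right (by norm_num) (by rw [sz_int] at hz; omega))
      have h2 : ∀ z ∈ c.1, z.natAbs ≤ 2 ^ sz c := fun z hz => h1 z (by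
        have := sz_lt_of_mem hz; rw [sz_pair c]; omega)
      have h3 : ∀ z ∈ c.2, z.natAbs ≤ 2 ^ sz c := fun z hz => h1 z (by
        have := sz_lt_of_mem hz; rw [sz_pair c]; omega)
      refine forall_mem_zipPad (fun a ha b hb => ⟨h2 a ha, ?_⟩) fun b hb => ⟨by simp, h3 b hb⟩
      rcases List.mem_cons.1 hb with rfl | hb
      · simp
      · exact h3 b hb
    have h1 := Int.natAbs_add_le s (p.1 * p.2)
    have h2 := Nat.mul_le_mul (h p hp).1 (h p hp).2
    rw [Int.natAbs_mul] at h1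
    rw [add_mul, one_mul]
    omega
  · have h := PolyBdd.refl (sz : List ℤ × List ℤ → ℕ)
    exact (PolyBdd.const 1 _).add ((h.add h).add h)
  · rw [sz_int]
    refine add_le_add_right (Nat.size_le.2 (hs.trans_lt ?_)) 1
    have hk' : k < 2 ^ sz c := by
      rw [length_zipPad] at hk
      have h1 := length_lt_sz c.1
      have h2 := length_lt_sz c.2
      have h3 := Nat.lt_two_pow_self (n := sz c)
      rw [sz_pair c] at *
      omega
    rw [pow_add, pow_add, mul_comm]
    gcongr

@[fun_prop]
theorem PF.len {l : γ → List α} (hl : PF l) : PF fun c => len (l c) := by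
  unfold BitCost.len
  refine PF.foldl (step := fun _ s _ => s + 1) hl (by fun_prop) (by fun_prop)
    (fun c k s => s = k) (fun c => by simp) (fun c k s a _ _ hs => by simp [hs])
    ⟨fun c => 1 + sz (l c), (PolyBdd.const 1 _).add hl.polyBdd_sz, fun c k s hk hs => ?_⟩
  have := length_lt_sz (l c)
  rw [hs, sz_int]
  refine add_le_add_right (Nat.size_le.2 ?_) 1
  simp only [Int.natAbs_natCast]
  exact (by omega : k < sz (l c)).trans Nat.lt_two_pow_self

@[fun_prop]
theorem PF.nth {l : γ → List α} {k : γ → ℤ} {d : γ → α} (hl : PF l) (hk : PF k) (hd : PF d) :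
    PF fun c => nth (l c) (k c) (d c) := by
  suffices h : PF fun c : List α × ℤ × α => BitCost.nth c.1 c.2.1 c.2.2 from
    h.comp (hl.prodMk (hk.prodMk hd))
  unfold BitCost.nth
  refine PF.snd.comp (PF.foldl (γ := List α × ℤ × α) (l := fun c => c.1) (init := fun c => c.2)
    (step := fun c s a => (s.1 - 1, if s.1 = 0 then a else s.2)) (by fun_prop) (by fun_prop)
    (PF.prodMk (by fun_prop) (.ite (.eq (by fun_prop) (by fun_prop)) (by fun_prop) (by fun_prop)))
    (fun c k s => s.1 = c.2.1 - k ∧ sz s.2 ≤ sz c) (fun c => ?_) (fun c k s a ha _ hs => ?_)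
    ⟨fun c => 4 + (sz c + sz c + sz c), ?_, fun c k s hk hs => ?_⟩)
  · exact ⟨by simp, by rw [sz_pair c, sz_pair c.2]; omega⟩
  · refine ⟨by simp [hs.1, sub_sub], ?_⟩
    dsimp only
    split_ifs
    · have := sz_lt_of_mem ha
      rw [sz_pair c]; omega
    · exact hs.2
  · have h := PolyBdd.refl (sz : List α × ℤ × α → ℕ)
    exact (PolyBdd.const 4 _).add ((h.add h).add h)
  · have h1 := length_lt_sz c.1
    have h2 := size_natAbs_add_le c.2.1 (-k)
    have h3 : Nat.size k ≤ k := Nat.size_le.2 Nat.lt_two_pow_self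
    have h4 : Nat.size c.2.1.natAbs ≤ sz c := by rw [sz_pair c, sz_pair c.2, sz_int]; omega
    have h5 : k ≤ sz c := by rw [sz_pair c]; omega
    rw [← sub_eq_add_neg, ← hs.1, Int.natAbs_neg, Int.natAbs_natCast] at h2
    have := hs.2
    rw [sz_pair, sz_int]
    dsimp only
    omega

@[fun_prop]
theorem PF.units {tmpl : γ → List α} (ht : PF tmpl) : PF fun c => units (tmpl c) := by
  unfold BitCost.units
  refine PF.reverse (PF.snd.comp (PF.foldl (γ := γ) (l := tmpl)
    (init := fun _ => (([1] : List ℤ), ([] : List (List ℤ))))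
    (step := fun c s a => (0 :: s.1, s.1 :: s.2)) ht (by fun_prop) (by fun_prop)
    -- The vector `[1]` has size `4`, and each zero put before it adds `2`.
    (fun c k s => sz s.1 = 4 + 2 * k ∧ sz s.2 ≤ 1 + k * (5 + 2 * sz (tmpl c)))
    (fun c => by simp [sz_nil, sz_cons, sz_int]) (fun c k s a ha hk hs => ?_)
    ⟨fun c => 6 + 2 * sz (tmpl c) + sz (tmpl c) * (5 + 2 * sz (tmpl c)), ?_,
      fun c k s hk hs => ?_⟩))
  · have := length_lt_sz (tmpl c)
    simp only [sz_cons, sz_int]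
    rw [hs.1, add_mul]
    simp only [Int.natAbs_zero, Nat.size_zero]
    omega
  · have h := ht.polyBdd_sz
    have h2 := (PolyBdd.const 2 _).mul h
    exact ((PolyBdd.const 6 _).add h2).add (h.mul ((PolyBdd.const 5 _).add h2))
  · have := length_lt_sz (tmpl c)
    have h3 : k * (5 + 2 * sz (tmpl c)) ≤ sz (tmpl c) * (5 + 2 * sz (tmpl c)) := by
      gcongr; omega
    rw [sz_pair, hs.1]
    have := hs.2
    dsimp only
    omega

@[fun_prop]
theorem PF.fit {tmpl : γ → List α} {g : γ → List ℤ} (ht : PF tmpl) (hg : PF g) :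
    PF fun c => fit (tmpl c) (g c) := by
  unfold BitCost.fit
  refine PF.reverse (PF.snd.comp (PF.foldl (γ := γ) (l := tmpl)
    (init := fun c => (g c, ([] : List ℤ)))
    (step := fun c s a => (s.1.tail, s.1.headD 0 :: s.2)) ht (by fun_prop) (by fun_prop)
    (fun c k s => sz s.1 ≤ sz (g c) ∧ sz s.2 ≤ 1 + k * (2 + sz (g c)))
    (fun c => by simp [sz_nil]) (fun c k s a ha hk hs => ⟨(sz_tail_le _).trans hs.1, ?_⟩)
    ⟨fun c => 2 + sz (g c) + sz (tmpl c) * (2 + sz (g c)), ?_,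
      fun c k s hk hs => ?_⟩))
  · have h1 := sz_headD_le s.1 0
    have h2 : sz (0 : ℤ) = 1 := by simp [sz_int]
    have := hs.1
    have := hs.2
    simp only [sz_cons]
    rw [add_mul]
    omega
  · have h := ht.polyBdd_sz
    have h2 := (PolyBdd.const 2 _).add hg.polyBdd_sz
    exact h2.add (h.mul h2)
  · have := length_lt_sz (tmpl c)
    have h3 : k * (2 + sz (g c)) ≤ sz (tmpl c) * (2 + sz (g c)) := by
      gcongr; omega
    rw [sz_pair]
    have := hs.1
    have := hs.2
    dsimp only
    omega

theorem sz_append_le (l t : List α) : sz (l ++ t) ≤ sz l + sz t := by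
  induction l with
  | nil => simp
  | cons a l ih => rw [List.cons_append, sz_cons, sz_cons]; omega

@[fun_prop]
theorem PF.flatten {l : γ → List (List α)} (hl : PF l) : PF fun c => (l c).flatten := by
  have key := PF.foldl (γ := γ) (l := l) (init := fun _ => ([] : List α))
    (step := fun _ s a => s ++ a) hl (by fun_prop) (by fun_prop)
    (fun c k s => sz s ≤ 1 + k * sz (l c)) (fun c => by simp [sz_nil])
    (fun c k s a ha hk hs => by
      have := sz_append_le s a
      have := sz_lt_of_mem ha
      rw [add_mul]
      omega)
    ⟨fun c => 1 + sz (l c) * sz (l c), (PolyBdd.const 1 _).add (hl.polyBdd_sz.mul hl.polyBdd_sz),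
      fun c k s hk hs => hs.trans (by
        have := length_lt_sz (l c)
        dsimp only
        gcongr
        omega)⟩
  have e : ∀ (l : List (List α)) (s : List α), l.foldl (fun s a => s ++ a) s = s ++ l.flatten := by
    intro l
    induction l with
    | nil => simp
    | cons a l ih => intro s; simp [ih]
  simpa [e] using key

@[fun_prop]
theorem PF.prodBound {l : γ → List ℤ} (hl : PF l) : PF fun c => prodBound (l c) := by
  unfold BitCost.prodBound
  refine PF.foldl (γ := γ) (l := l) (init := fun _ => 1) (step := fun _ s z => s * (1 + |z|)) hl
    (by fun_prop) (by fun_prop) (fun c k s => Nat.size s.natAbs ≤ 1 + k * (2 + sz (l c)))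
    (fun c => by simp) (fun c k s z hz _ hs => ?_)
    ⟨fun c => 2 + sz (l c) * (2 + sz (l c)), ?_, fun c k s hk hs => ?_⟩
  · have h1 := size_natAbs_mul_le s (1 + |z|)
    have h2 := size_natAbs_add_le 1 |z|
    have := sz_lt_of_mem hz
    rw [sz_int] at this
    rw [Int.natAbs_abs, Int.natAbs_one, Nat.size_one] at h2
    rw [add_mul]
    omega
  · have h := hl.polyBdd_sz
    exact (PolyBdd.const 2 _).add (h.mul ((PolyBdd.const 2 _).add h))
  · have := length_lt_sz (l c)
    have h3 : k * (2 + sz (l c)) ≤ sz (l c) * (2 + sz (l c)) := by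
      gcongr; omega
    rw [sz_int]
    dsimp only
    omega

end

/-! ### Determinants -/

/-- Eliminate the first column, with the first row as pivot. -/
def detCol (m : ℤ) (rows : List Row) : Row × List Row :=
  clear m (rowComb m 0 (rows.headD ([], [])) ([], []))
    (rows.tail.map fun x => rowComb m 0 x ([], []))

/-- The determinant modulo `m`, up to sign. -/
def detMod (m : ℤ) (rows : List (List ℤ)) : ℤ :=
  (rows.foldl (fun s _ => (red m (s.1 * (detCol m s.2).1.hd), (detCol m s.2).2))
    ((1 : ℤ), rows.map fun v => ((v, []) : Row))).1

/-- A number that exceeds twice the absolute value of the determinant. -/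
def detBound (rows : List (List ℤ)) : ℤ := 2 * prodBound rows.flatten + 1

/-- The absolute value of the determinant. -/
def absDet (rows : List (List ℤ)) : ℤ :=
  if detBound rows < 2 * detMod (detBound rows) rows then
    detBound rows - detMod (detBound rows) rows
  else detMod (detBound rows) rows

section

variable {γ : Type*} [Enc γ]

theorem RsB.detCol {S : ℕ} {m : ℤ} (hm : Nat.size m.natAbs ≤ S) {k : ℕ} {rows : List Row}
    (hr : RsB S k rows) : RsB S k (detCol m rows).2 := by
  have h0 : RB S ([], []) := ⟨.nil, .nil⟩
  refine (RsB.clear hm (.rowComb hm _ ?_ h0) ⟨?_, ?_⟩).2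
  · cases rows with
    | nil => exact h0
    | cons x _ => exact hr.2 x (by simp)
  · have := hr.1
    simp only [List.length_map, List.length_tail]
    omega
  · intro x hx
    obtain ⟨y, hy, rfl⟩ := List.mem_map.1 hx
    exact .rowComb hm _ (hr.2 y (List.mem_of_mem_tail hy)) h0

@[fun_prop]
theorem PF.detCol {m : γ → ℤ} {rows : γ → List Row} (hm : PF m) (hr : PF rows) :
    PF fun c => detCol (m c) (rows c) :=
  .clear hm (by fun_prop) (.map (by fun_prop) (by fun_prop))

@[fun_prop]
theorem PF.detMod {m : γ → ℤ} {rows : γ → List (List ℤ)} (hm : PF m) (hr : PF rows) :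
    PF fun c => detMod (m c) (rows c) := by
  suffices h : PF fun c : ℤ × List (List ℤ) => BitCost.detMod c.1 c.2 from h.comp (hm.prodMk hr)
  unfold BitCost.detMod
  refine PF.fst.comp (PF.foldl (γ := ℤ × List (List ℤ)) (l := fun c => c.2)
    (init := fun c => ((1 : ℤ), c.2.map fun v => ((v, []) : Row)))
    (step := fun c s _ => (BitCost.red c.1 (s.1 * (BitCost.detCol c.1 s.2).1.hd),
      (BitCost.detCol c.1 s.2).2)) (by fun_prop)
    (PF.prodMk (by fun_prop) (.map (by fun_prop) (by fun_prop))) (by fun_prop)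
    (fun c k s => Nat.size s.1.natAbs ≤ sz c ∧ RsB (sz c) (sz c) s.2) (fun c => ?_)
    (fun c k s x hx _ hs => ?_)
    ⟨fun c => 2 + sz c + (1 + sz c * (1 + rbd (sz c))), ?_, fun c k s _ hs => ?_⟩)
  · refine ⟨by simpa using one_le_sz c, ?_, ?_⟩
    · have := length_lt_sz c.2
      rw [List.length_map, sz_pair]; omega
    · intro x hx
      obtain ⟨y, hy, rfl⟩ := List.mem_map.1 hx
      exact ⟨.of_sz_le (by have := sz_lt_of_mem hy; rw [sz_pair c]; dsimp only; omega), .nil⟩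
  · have hm : Nat.size c.1.natAbs ≤ sz c := by rw [sz_pair c, sz_int]; omega
    exact ⟨size_red_le hm _, RsB.detCol hm hs.2⟩
  · have h := PolyBdd.refl (sz : ℤ × List (List ℤ) → ℕ)
    exact ((PolyBdd.const 2 _).add h).add ((PolyBdd.const 1 _).add
      (h.mul ((PolyBdd.const 1 _).add h.rbd)))
  · have h1 := hs.2.sz_le
    have h2 := hs.1
    rw [sz_pair, sz_int]
    dsimp only
    omega

@[fun_prop]
theorem PF.detBound {rows : γ → List (List ℤ)} (hr : PF rows) :
    PF fun c => detBound (rows c) := by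
  unfold BitCost.detBound
  fun_prop

@[fun_prop]
theorem PF.absDet {rows : γ → List (List ℤ)} (hr : PF rows) : PF fun c => absDet (rows c) :=
  .ite (.lt (by fun_prop) (by fun_prop)) (by fun_prop) (by fun_prop)

end

/-! ### Generators of cyclic modules -/

/-- The columns of the matrix with rows `A`, if `E` is the list of unit vectors. -/
def cols (E A : List (List ℤ)) : List (List ℤ) := E.map fun e => A.map fun row => dot row e

/-- Generators for the module of those combinations modulo `m` of the matrices `gens` (lists of
columns) that map `y` to a combination of the vectors in `O`. -/
def kerStep {α : Type*} (m : ℤ) (tmpl : List α) (O : List (List ℤ)) (gens : List (List (List ℤ)))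
    (y : List ℤ) : List (List (List ℤ)) :=
  (elimCols m ((gens.map fun a => ((lincomb m y a, a) : Row)) ++ O.map fun o => ((o, []) : Row))
    tmpl).map Prod.snd

/-- Generators for the module of those combinations modulo `m` of the matrices `As` that map all
unit vectors into the submodule that is generated by the images of `x` under `As`. -/
def idealGens {α : Type*} (m : ℤ) (tmpl : List α) (E : List (List ℤ)) (As : List (List (List ℤ)))
    (x : List ℤ) : List (List (List ℤ)) :=
  E.foldl (fun gens y => kerStep m tmpl (As.map fun A => lincomb m x A) gens y) As

/-- The square of a matrix. -/
def sqr (m : ℤ) (C : List (List ℤ)) : List (List ℤ) := C.map fun c => lincomb m c C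

/-- A high power of a matrix. -/
def highPow {α : Type*} (m : ℤ) (tmpl : List α) (a : List (List ℤ)) : List (List ℤ) :=
  tmpl.foldl (fun C _ => (fuel m).foldl (fun C _ => sqr m C) C) a

/-- The vector `B w`, where `B ^ 2 w + B v = 0` modulo `m`. -/
def solve {α : Type*} (m : ℤ) (tmpl : List α) (B : List (List ℤ)) (v : List ℤ) : List ℤ :=
  (elimCol m ((elimCols m (((lincomb m v B, [[1], []]) : Row) ::
    B.map fun c => ((lincomb m c B, [[], c]) : Row)) tmpl).map fun p =>
      ((p.2.headD [], [p.2.tail.headD []]) : Row))).1.2.headD []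

/-- Change `g` into `x` at the places where `a` is invertible. -/
def update {α : Type*} (m : ℤ) (tmpl : List α) (x g : List ℤ) (a : List (List ℤ)) : List ℤ :=
  comb m 1 g (solve m tmpl (highPow m tmpl a) (comb m 1 x g))

/-- Change `g` into `x` at the places where `x` is a generator. -/
def improve {α : Type*} (m : ℤ) (tmpl : List α) (E : List (List ℤ)) (As : List (List (List ℤ)))
    (g x : List ℤ) : List ℤ :=
  (idealGens m tmpl E As x).foldl (fun g a => update m tmpl x g a) g

/-- A generator modulo `m`, if there is one. -/
def generator {α : Type*} (m : ℤ) (tmpl : List α) (E : List (List ℤ))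
    (As : List (List (List ℤ))) : List ℤ :=
  E.foldl (fun g x => improve m tmpl E As g x) []

/-- `1` if the rows generate all vectors modulo `m`, and `0` otherwise. -/
def spans {α : Type*} (m : ℤ) (tmpl : List α) (rows : List Row) : ℤ :=
  (tmpl.foldl (fun s _ => (if (elimCol m s.2).1.hd = 1 then s.1 else 0, (elimCol m s.2).2))
    ((1 : ℤ), rows)).1

section

variable {γ α : Type*} [Enc γ] [Enc α]

@[fun_prop]
theorem PF.cols {E A : γ → List (List ℤ)} (hE : PF E) (hA : PF A) :
    PF fun c => cols (E c) (A c) :=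
  .map hE (.map (by fun_prop) (by fun_prop))

@[fun_prop]
theorem PF.kerStep {m : γ → ℤ} {tmpl : γ → List α} {O : γ → List (List ℤ)}
    {gens : γ → List (List (List ℤ))} {y : γ → List ℤ} (hm : PF m) (ht : PF tmpl) (hO : PF O)
    (hg : PF gens) (hy : PF y) :
    PF fun c => kerStep (m c) (tmpl c) (O c) (gens c) (y c) := by
  have h1 : PF fun c => (gens c).map fun a => ((BitCost.lincomb (m c) (y c) a, a) : Row) :=
    .map hg (by fun_prop)
  have h2 : PF fun c => (O c).map fun o => ((o, []) : Row) := .map hO (by fun_prop)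
  exact .map (by fun_prop) (by fun_prop)

/-- A list of at most `k` matrices that are bounded by `S`. -/
def MsB (S k : ℕ) (gens : List (List (List ℤ))) : Prop :=
  gens.length ≤ k ∧ ∀ a ∈ gens, MB S a

theorem MsB.sz_le {S k : ℕ} {gens : List (List (List ℤ))} (h : MsB S k gens) :
    sz gens ≤ 1 + k * (1 + mbd S) := by
  refine (sz_list_le (B := mbd S) fun z hz => (h.2 z hz).sz_le).trans ?_
  gcongr
  exact h.1

theorem MsB.of_sz_le {S : ℕ} {gens : List (List (List ℤ))} (h : sz gens ≤ S) : MsB S S gens :=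
  ⟨(length_lt_sz gens).le.trans h, fun _ hx => .of_sz_le ((sz_lt_of_mem hx).le.trans h)⟩

theorem MsB.kerStep {δ : Type*} {S k l : ℕ} {m : ℤ} (hm : sz m ≤ S) (tmpl : List δ)
    {O : List (List ℤ)} {gens : List (List (List ℤ))} (y : List ℤ) (hO : O.length ≤ l ∧ ∀ v ∈ O, VB S v)
    (hg : MsB S k gens) : MsB S (k + l) (kerStep m tmpl O gens y) := by
  have hm' : Nat.size m.natAbs ≤ S := by rw [sz_int] at hm; omega
  have h := RsB.elimCols (k := k + l) (rows := (gens.map fun a => ((lincomb m y a, a) : Row)) ++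
    O.map fun o => ((o, []) : Row)) hm ⟨?_, ?_⟩ tmpl
  · refine ⟨by simpa [BitCost.kerStep] using h.1, fun a ha => ?_⟩
    obtain ⟨r, hr, rfl⟩ := List.mem_map.1 ha
    exact (h.2 r hr).2
  · simpa using add_le_add hg.1 hO.1
  · intro x hx
    rcases List.mem_append.1 hx with hx | hx
    · obtain ⟨a, ha, rfl⟩ := List.mem_map.1 hx
      exact ⟨.lincomb hm' _ fun w hw => ((hg.2 a ha).2 w hw).1, hg.2 a ha⟩
    · obtain ⟨o, ho, rfl⟩ := List.mem_map.1 hx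
      exact ⟨hO.2 o ho, .nil⟩

theorem MsB.orbit {S k : ℕ} {m : ℤ} (hm : sz m ≤ S) {As : List (List (List ℤ))}
    (hA : MsB S k As) (x : List ℤ) : (As.map fun A => lincomb m x A).length ≤ k ∧
      ∀ v ∈ As.map fun A => lincomb m x A, VB S v := by
  have hm' : Nat.size m.natAbs ≤ S := by rw [sz_int] at hm; omega
  refine ⟨by simpa using hA.1, fun v hv => ?_⟩
  obtain ⟨a, ha, rfl⟩ := List.mem_map.1 hv
  exact .lincomb hm' _ fun w hw => ((hA.2 a ha).2 w hw).1

theorem MsB.idealGens {δ : Type*} {S k : ℕ} {m : ℤ} (hm : sz m ≤ S) (tmpl : List δ) (E : List (List ℤ))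
    {As : List (List (List ℤ))} (hA : MsB S k As) (x : List ℤ) :
    ∀ a ∈ idealGens m tmpl E As x, MB S a :=
  foldl_induction (Q := fun gens => ∀ a ∈ gens, MB S a) hA.2 fun _ _ _ h =>
    (MsB.kerStep hm tmpl _ (hA.orbit hm x) ⟨le_rfl, h⟩).2

@[fun_prop]
theorem PF.idealGens {m : γ → ℤ} {tmpl : γ → List α} {E : γ → List (List ℤ)}
    {As : γ → List (List (List ℤ))} {x : γ → List ℤ} (hm : PF m) (ht : PF tmpl) (hE : PF E)
    (hA : PF As) (hx : PF x) :
    PF fun c => idealGens (m c) (tmpl c) (E c) (As c) (x c) := by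
  have hO : PF fun c => (As c).map fun A => BitCost.lincomb (m c) (x c) A :=
    .map hA (by fun_prop)
  unfold BitCost.idealGens
  refine PF.foldl (γ := γ) (l := E) (init := As) (step := fun c gens y => BitCost.kerStep (m c)
    (tmpl c) ((As c).map fun A => BitCost.lincomb (m c) (x c) A) gens y) hE hA
    (PF.kerStep (by fun_prop) (by fun_prop)
      (hO.comp (f := fun p : γ × List (List (List ℤ)) × List ℤ => p.1) (by fun_prop))
      (by fun_prop) (by fun_prop))
    -- The number of generators grows only linearly with the steps: each step adds one row for every
    -- matrix in `As`, namely for its vector in the orbit of `x`.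
    (fun c k s => MsB (sz (m c) + sz (As c))
      (sz (m c) + sz (As c) + k * (sz (m c) + sz (As c))) s)
    (fun c => by simpa using MsB.of_sz_le (Nat.le_add_left _ _)) (fun c k s y _ _ hs => ?_)
    ⟨fun c => 1 + (sz (m c) + sz (As c) + sz (E c) * (sz (m c) + sz (As c))) *
      (1 + mbd (sz (m c) + sz (As c))), ?_, fun c k s hk hs => hs.sz_le.trans ?_⟩
  · rw [add_mul, one_mul, ← add_assoc]
    exact hs.kerStep (Nat.le_add_right _ _) _ _
      (MsB.orbit (Nat.le_add_right _ _) (.of_sz_le (Nat.le_add_left _ _)) _)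
  · have h := hm.polyBdd_sz.add hA.polyBdd_sz
    exact (PolyBdd.const 1 _).add ((h.add (hE.polyBdd_sz.mul h)).mul
      ((PolyBdd.const 1 _).add h.mbd))
  · have := length_lt_sz (E c)
    dsimp only
    gcongr
    omega

@[fun_prop]
theorem PF.sqr {m : γ → ℤ} {C : γ → List (List ℤ)} (hm : PF m) (hC : PF C) :
    PF fun c => sqr (m c) (C c) :=
  .map hC (by fun_prop)

theorem MB.sqr {S : ℕ} {m : ℤ} (hm : sz m ≤ S) {C : List (List ℤ)} (hC : MB S C) :
    MB S (sqr m C) := by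
  refine ⟨by simpa [BitCost.sqr] using hC.1, fun v hv => ?_⟩
  obtain ⟨a, ha, rfl⟩ := List.mem_map.1 hv
  exact .lincomb (by rw [sz_int] at hm; omega) _ fun w hw => (hC.2 w hw).1

theorem MB.sqrs {S : ℕ} {m : ℤ} (hm : sz m ≤ S) {C : List (List ℤ)} (hC : MB S C)
    (l : List ℤ) : MB S (l.foldl (fun C _ => BitCost.sqr m C) C) :=
  foldl_induction (Q := MB S) hC fun _ _ _ h => h.sqr hm

theorem MB.highPow {δ : Type*} {S : ℕ} {m : ℤ} (hm : sz m ≤ S) (tmpl : List δ)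
    {a : List (List ℤ)} (ha : MB S a) : MB S (highPow m tmpl a) :=
  foldl_induction (Q := MB S) ha fun _ _ _ h => h.sqrs hm _

@[fun_prop]
theorem PF.highPow {m : γ → ℤ} {tmpl : γ → List α} {a : γ → List (List ℤ)} (hm : PF m)
    (ht : PF tmpl) (ha : PF a) : PF fun c => highPow (m c) (tmpl c) (a c) := by
  have h1 : PF fun p : ℤ × List (List ℤ) =>
      (BitCost.fuel p.1).foldl (fun C _ => BitCost.sqr p.1 C) p.2 := by
    refine PF.foldl (γ := ℤ × List (List ℤ)) (l := fun p => BitCost.fuel p.1)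
      (init := fun p => p.2) (step := fun p C _ => BitCost.sqr p.1 C) (by fun_prop) (by fun_prop)
      (by fun_prop) (fun p _ C => MB (sz p.1 + sz p.2) C)
      (fun p => .of_sz_le (Nat.le_add_left _ _))
      (fun p k C _ _ _ h => h.sqr (Nat.le_add_right _ _))
      ⟨fun p => mbd (sz p.1 + sz p.2), ?_, fun p k C _ h => h.sz_le⟩
    exact (PF.fst.polyBdd_sz.add PF.snd.polyBdd_sz).mbd
  unfold BitCost.highPow
  refine PF.foldl (γ := γ) (l := tmpl) (init := a) (step := fun c C _ => (BitCost.fuel (m c)).foldl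
    (fun C _ => BitCost.sqr (m c) C) C) ht ha
    (h1.comp (f := fun p : γ × List (List ℤ) × α => (m p.1, p.2.1)) (by fun_prop))
    (fun c _ C => MB (sz (m c) + sz (a c)) C) (fun c => .of_sz_le (Nat.le_add_left _ _))
    (fun c k C _ _ _ h => h.sqrs (Nat.le_add_right _ _) _)
    ⟨fun c => mbd (sz (m c) + sz (a c)), (hm.polyBdd_sz.add ha.polyBdd_sz).mbd,
      fun p k C _ h => h.sz_le⟩

@[fun_prop]
theorem PF.solve {m : γ → ℤ} {tmpl : γ → List α} {B : γ → List (List ℤ)} {v : γ → List ℤ}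
    (hm : PF m) (ht : PF tmpl) (hB : PF B) (hv : PF v) :
    PF fun c => solve (m c) (tmpl c) (B c) (v c) := by
  have h1 : PF fun c => (B c).map fun a => ((BitCost.lincomb (m c) a (B c), [[], a]) : Row) :=
    .map hB (by fun_prop)
  have h2 : PF fun c => (BitCost.elimCols (m c)
      (((BitCost.lincomb (m c) (v c) (B c), [[1], []]) : Row) :: (B c).map fun a =>
        ((BitCost.lincomb (m c) a (B c), [[], a]) : Row)) (tmpl c)).map fun p =>
      ((p.2.headD [], [p.2.tail.headD []]) : Row) :=
    .map (by fun_prop) (by fun_prop)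
  unfold BitCost.solve
  fun_prop

theorem VB.solve {δ : Type*} {S : ℕ} (hS : 2 ≤ S) {m : ℤ} (hm : sz m ≤ S) (tmpl : List δ)
    {B : List (List ℤ)} (v : List ℤ) (hB : MB S B) : VB S (solve m tmpl B v) := by
  have hm' : Nat.size m.natAbs ≤ S := by rw [sz_int] at hm; omega
  have hl : ∀ w, VB S (BitCost.lincomb m w B) := fun w => .lincomb hm' _ fun w hw => (hB.2 w hw).1
  have hD : ∀ P, MB S P → VB S (P.headD []) := fun P hP => by
    cases P with
    | nil => exact .nil
    | cons a P => exact hP.2 a (by simp)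
  have hT : ∀ P, MB S P → MB S P.tail := fun P hP =>
    ⟨by have := hP.1; simp only [List.length_tail]; omega,
      fun v hv => hP.2 v (List.mem_of_mem_tail hv)⟩
  have h1 := RsB.elimCols (k := B.length + 1) (rows := ((BitCost.lincomb m v B, [[1], []]) : Row) ::
    B.map fun c => ((BitCost.lincomb m c B, [[], c]) : Row)) hm ⟨by simp, ?_⟩ tmpl
  · have h2 := RsB.elimCol (k := B.length + 1) (rows := (BitCost.elimCols m
      (((BitCost.lincomb m v B, [[1], []]) : Row) :: B.map fun c =>
        ((BitCost.lincomb m c B, [[], c]) : Row)) tmpl).map fun p =>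
      ((p.2.headD [], [p.2.tail.headD []]) : Row)) hm ⟨by simpa using h1.1, ?_⟩
    · exact hD _ h2.1.2
    · intro x hx
      obtain ⟨y, hy, rfl⟩ := List.mem_map.1 hx
      have := (h1.2 y hy).2
      exact ⟨hD _ this, by simp; omega, by simpa using hD _ (hT _ this)⟩
  · intro x hx
    rcases List.mem_cons.1 hx with rfl | hx
    · exact ⟨hl v, by simpa using hS, by simp [VB]; omega⟩
    · obtain ⟨c, hc, rfl⟩ := List.mem_map.1 hx
      exact ⟨hl c, by simpa using hS, by simpa [VB] using hB.2 c hc⟩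

@[fun_prop]
theorem PF.update {m : γ → ℤ} {tmpl : γ → List α} {x g : γ → List ℤ} {a : γ → List (List ℤ)}
    (hm : PF m) (ht : PF tmpl) (hx : PF x) (hg : PF g) (ha : PF a) :
    PF fun c => update (m c) (tmpl c) (x c) (g c) (a c) := by
  unfold BitCost.update
  fun_prop

theorem VB.update {δ : Type*} {S : ℕ} (hS : 2 ≤ S) {m : ℤ} (hm : sz m ≤ S) (tmpl : List δ) (x : List ℤ)
    {g : List ℤ} (hg : VB S g) {a : List (List ℤ)} (ha : MB S a) :
    VB S (update m tmpl x g a) :=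
  .comb (by rw [sz_int] at hm; omega) _ hg.1 (VB.solve hS hm tmpl _ (ha.highPow hm tmpl)).1

theorem VB.improve {δ : Type*} {S : ℕ} (hS : 2 ≤ S) {m : ℤ} (hm : sz m ≤ S) (tmpl : List δ)
    (E : List (List ℤ)) {As : List (List (List ℤ))} (hA : sz As ≤ S) {g : List ℤ}
    (hg : VB S g) (x : List ℤ) : VB S (improve m tmpl E As g x) :=
  foldl_induction (Q := VB S) hg fun _ a ha h =>
    h.update hS hm tmpl x (MsB.idealGens hm tmpl E (.of_sz_le hA) x a ha)

@[fun_prop]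
theorem PF.improve {m : γ → ℤ} {tmpl : γ → List α} {E : γ → List (List ℤ)}
    {As : γ → List (List (List ℤ))} {g x : γ → List ℤ} (hm : PF m) (ht : PF tmpl) (hE : PF E)
    (hA : PF As) (hg : PF g) (hx : PF x) :
    PF fun c => improve (m c) (tmpl c) (E c) (As c) (g c) (x c) := by
  unfold BitCost.improve
  refine PF.foldl (γ := γ)
    (l := fun c => BitCost.idealGens (m c) (tmpl c) (E c) (As c) (x c)) (init := g)
    (step := fun c g a => BitCost.update (m c) (tmpl c) (x c) g a) (by fun_prop) hg (by fun_prop)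
    (fun c _ g' => VB (sz (m c) + sz (As c) + sz (g c)) g')
    (fun c => .of_sz_le (Nat.le_add_left _ _)) (fun c k g' a ha _ h => ?_)
    ⟨fun c => vbd (sz (m c) + sz (As c) + sz (g c)),
      ((hm.polyBdd_sz.add hA.polyBdd_sz).add hg.polyBdd_sz).vbd, fun c k s _ h => h.sz_le⟩
  have h1 := one_le_sz (m c)
  have h2 := one_le_sz (As c)
  exact h.update (by omega) (by omega) _ _
    (MsB.idealGens (by omega) _ _ (.of_sz_le (by omega)) _ a ha)

@[fun_prop]
theorem PF.generator {m : γ → ℤ} {tmpl : γ → List α} {E : γ → List (List ℤ)}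
    {As : γ → List (List (List ℤ))} (hm : PF m) (ht : PF tmpl) (hE : PF E) (hA : PF As) :
    PF fun c => generator (m c) (tmpl c) (E c) (As c) := by
  unfold BitCost.generator
  refine PF.foldl (γ := γ) (l := E) (init := fun _ => [])
    (step := fun c g x => BitCost.improve (m c) (tmpl c) (E c) (As c) g x) hE (by fun_prop)
    (by fun_prop) (fun c _ g => VB (sz (m c) + sz (As c)) g) (fun c => .nil)
    (fun c k g x _ _ h => ?_) ⟨fun c => vbd (sz (m c) + sz (As c)),
      (hm.polyBdd_sz.add hA.polyBdd_sz).vbd, fun c k s _ h => h.sz_le⟩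
  have h1 := one_le_sz (m c)
  have h2 := one_le_sz (As c)
  exact h.improve (by omega) (by omega) _ _ (by omega) _

@[fun_prop]
theorem PF.spans {m : γ → ℤ} {tmpl : γ → List α} {rows : γ → List Row} (hm : PF m)
    (ht : PF tmpl) (hr : PF rows) : PF fun c => spans (m c) (tmpl c) (rows c) := by
  unfold BitCost.spans
  refine PF.fst.comp (PF.foldl (γ := γ) (l := tmpl) (init := fun c => ((1 : ℤ), rows c))
    (step := fun c s _ => (if (BitCost.elimCol (m c) s.2).1.hd = 1 then s.1 else 0,
      (BitCost.elimCol (m c) s.2).2)) ht (by fun_prop)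
    (PF.prodMk (.ite (.eq (by fun_prop) (by fun_prop)) (by fun_prop) (by fun_prop)) (by fun_prop))
    (fun c _ s => sz s.1 ≤ 2 ∧
      RsB (sz (m c) + sz (rows c)) (sz (m c) + sz (rows c)) s.2)
    (fun c => ⟨by simp [sz_int], .of_sz_le (Nat.le_add_left _ _)⟩) (fun c k s a _ _ h => ⟨?_, ?_⟩)
    ⟨fun c => 4 + (sz (m c) + sz (rows c)) * (1 + rbd (sz (m c) + sz (rows c))), ?_,
      fun c k s _ h => ?_⟩)
  · dsimp only
    split_ifs
    · exact h.1
    · simp [sz_int]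
  · exact (RsB.elimCol (Nat.le_add_right _ _) h.2).2
  · have h := hm.polyBdd_sz.add hr.polyBdd_sz
    exact (PolyBdd.const 4 _).add (h.mul ((PolyBdd.const 1 _).add h.rbd))
  · have h1 := h.1
    have h2 := h.2.sz_le
    rw [sz_pair]
    dsimp only
    omega

end

/-! ### The subroutines -/

/-- The encoded inputs: the multiplication table, the position of `u`, the Gram matrix and the
matrices of the action. -/
abbrev RawInput := List (List ℤ) × ℤ × List (List ℤ) × List (List (List ℤ)) × ℤ

/-- Compare the rank with half of the group order. -/
def rankFun (I : RawInput) : ℤ := if len I.2.2.1 = len I.1 / 2 then 1 else 0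

/-- The matrices of the action, as lists of columns. -/
def actCols (I : RawInput) : List (List (List ℤ)) := I.2.2.2.1.map (cols (units I.2.2.1))

/-- A list with a generator modulo `m`, and the empty list if there is none. -/
def cyclicFun (I : RawInput × ℤ) : List (List ℤ) :=
  if spans I.2 I.1.2.2.1 ((actCols I.1).map fun A => ((lincomb I.2
      (generator I.2 I.1.2.2.1 (units I.1.2.2.1) (actCols I.1)) A, []) : Row)) = 1 then
    [fit I.1.2.2.1 (generator I.2 I.1.2.2.1 (units I.1.2.2.1) (actCols I.1))]
  else []

/-- Translates of `e` under one element from each pair `{σ, u σ}`. -/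
def halfOrbit (I : RawInput × List ℤ) : List (List ℤ) :=
  ((zipPad Prod.mk (Prod.mk []) 0 I.1.2.2.2.1 (nth I.1.1 I.1.2.1 [])).foldl
    (fun s p => (s.1 + 1, if s.1 < p.2 then (p.1.map fun row => dot row I.2) :: s.2 else s.2))
    ((0 : ℤ), ([] : List (List ℤ)))).2

theorem PF.rankFun : PF rankFun :=
  .ite (.eq (by fun_prop) (by fun_prop)) (by fun_prop) (by fun_prop)

@[fun_prop]
theorem PF.actCols : PF actCols := .map (by fun_prop) (by fun_prop)

theorem PF.cyclicFun : PF cyclicFun := by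
  have h : PF fun I : RawInput × ℤ => (BitCost.actCols I.1).map fun A => ((BitCost.lincomb I.2
      (BitCost.generator I.2 I.1.2.2.1 (BitCost.units I.1.2.2.1) (BitCost.actCols I.1)) A,
        []) : Row) := .map (by fun_prop) (by fun_prop)
  exact .ite (.eq (by fun_prop) (by fun_prop)) (by fun_prop) (by fun_prop)

@[fun_prop]
theorem PF.halfOrbit : PF halfOrbit := by
  have h1 : PF fun q : (RawInput × List ℤ) × List (List ℤ) =>
      q.2.map fun row => BitCost.dot row q.1.2 := .map (by fun_prop) (by fun_prop)
  obtain ⟨P, hP⟩ := h1.polyBdd_sz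
  have hz : PF fun I : RawInput × List ℤ =>
      BitCost.zipPad Prod.mk (Prod.mk []) 0 I.1.2.2.2.1 (BitCost.nth I.1.1 I.1.2.1 []) :=
    PF.zipPad (f := fun _ => Prod.mk) (g := fun _ => Prod.mk []) (by fun_prop) (by fun_prop)
      (by fun_prop) (by fun_prop)
  have hB := hz.polyBdd_sz
  unfold BitCost.halfOrbit
  refine PF.snd.comp (PF.foldl (γ := RawInput × List ℤ) (l := fun I => BitCost.zipPad Prod.mk
    (Prod.mk []) 0 I.1.2.2.2.1 (BitCost.nth I.1.1 I.1.2.1 []))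
    (init := fun _ => ((0 : ℤ), ([] : List (List ℤ))))
    (step := fun I s p => (s.1 + 1,
      if s.1 < p.2 then (p.1.map fun row => BitCost.dot row I.2) :: s.2 else s.2)) hz (by fun_prop)
    (PF.prodMk (by fun_prop) (.ite (.lt (by fun_prop) (by fun_prop)) (.cons
      (h1.comp (f := fun q : (RawInput × List ℤ) × (ℤ × List (List ℤ)) × List (List ℤ) × ℤ =>
        (q.1, q.2.2.1)) (by fun_prop)) (by fun_prop)) (by fun_prop)))
    (fun I k s => s.1 = k ∧ sz s.2 ≤ 1 + k * (1 + P.eval (1 + sz I + sz (BitCost.zipPad Prod.mk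
      (Prod.mk []) 0 I.1.2.2.2.1 (BitCost.nth I.1.1 I.1.2.1 [])))))
    (fun I => by simp [sz_nil]) (fun I k s p hp _ hs => ⟨by simp [hs.1], ?_⟩)
    ⟨fun I => 3 + sz (BitCost.zipPad Prod.mk (Prod.mk []) 0 I.1.2.2.2.1
      (BitCost.nth I.1.1 I.1.2.1 [])) + sz (BitCost.zipPad Prod.mk (Prod.mk []) 0 I.1.2.2.2.1
      (BitCost.nth I.1.1 I.1.2.1 [])) * (1 + P.eval (1 + sz I + sz (BitCost.zipPad Prod.mk
      (Prod.mk []) 0 I.1.2.2.2.1 (BitCost.nth I.1.1 I.1.2.1 [])))), ?_, fun I k s hk hs => ?_⟩)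
  · have h2 := hs.2
    have h3 := hP (I, p.1)
    dsimp only at h3 ⊢
    split_ifs
    · rw [sz_cons, add_mul]
      have h4 := h3.trans (polynomial_eval_mono P (b := 1 + sz I + sz (BitCost.zipPad Prod.mk
        (Prod.mk []) 0 I.1.2.2.2.1 (BitCost.nth I.1.1 I.1.2.1 []))) (by
          have := sz_lt_of_mem hp
          rw [sz_pair] at this
          rw [sz_pair]
          dsimp only
          omega))
      omega
    · refine h2.trans ?_
      gcongr
      omega
  · exact ((PolyBdd.const 3 _).add hB).add (hB.mul ((PolyBdd.const 1 _).add
      (.eval P (((PolyBdd.const 1 _).add (.refl _)).add hB))))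
  · dsimp only at hk ⊢
    generalize hL : BitCost.zipPad Prod.mk (Prod.mk []) 0 I.1.2.2.2.1
      (BitCost.nth I.1.1 I.1.2.1 []) = L at *
    have h1 := length_lt_sz L
    have h3 : k * (1 + P.eval (1 + sz I + sz L)) ≤ sz L * (1 + P.eval (1 + sz I + sz L)) := by
      gcongr; omega
    have h4 : Nat.size k ≤ k := Nat.size_le.2 Nat.lt_two_pow_self
    have h5 := hs.2
    rw [sz_pair, hs.1, sz_int, Int.natAbs_natCast]
    omega

end BitCost

namespace BitCost

/-! ### Elimination and submodules -/

/-- A list of integers as a sequence that is continued by zeros. -/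
def ev (v : List ℤ) (i : ℕ) : ℤ := v.getD i 0

/-- A list of vectors as a double sequence that is continued by zeros. -/
def ev2 (P : List (List ℤ)) (i : ℕ) : ℕ → ℤ := ev (P.getD i [])

/-- The module of sequences and double sequences, to which rows belong. -/
abbrev RowSpace := (ℕ → ℤ) × (ℕ → ℕ → ℤ)

/-- The element of `RowSpace` that is given by a row. -/
def rv (p : Row) : RowSpace := (ev p.1, ev2 p.2)

/-- The two hypotheses express that padding is consistent: `g` is `f` at the default of the first
list, and two defaults give a default. Entries can then be computed position by position, whatever
the lengths of the lists. -/
theorem getD_zipPad {α β δ : Type*} {f : α → β → δ} {g : β → δ} {d : β} {d₁ : α} {e : δ}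
    (hg : ∀ b, g b = f d₁ b) (he : f d₁ d = e) (l : List α) (ys : List β) (i : ℕ) :
    (zipPad f g d l ys).getD i e = f (l.getD i d₁) (ys.getD i d) := by
  induction l generalizing ys i with
  | nil =>
    rw [zipPad, ← he, ← hg, List.getD_map, hg]
    simp
  | cons a l ih =>
    cases i with
    | zero => cases ys <;> simp [zipPad]
    | succ i =>
      rw [zipPad, List.getD_cons_succ, ih]
      cases ys <;> simp

theorem red_of_pos {m : ℤ} (hm : 0 < m) (z : ℤ) : red m z = z % m := if_pos hm

@[simp]
theorem red_zero_right (m : ℤ) : red m 0 = 0 := by simp [red]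

theorem comb_nil_nil (m q : ℤ) : comb m q [] [] = [] := rfl

theorem ev_comb (m q : ℤ) (p x : List ℤ) (i : ℕ) :
    ev (comb m q p x) i = red m (ev p i - q * ev x i) :=
  getD_zipPad (f := fun a b => red m (a - q * b)) (fun b => by simp) (by simp) p x i

theorem ev2_combM (m q : ℤ) (p x : List (List ℤ)) (i j : ℕ) :
    ev2 (combM m q p x) i j = red m (ev2 p i j - q * ev2 x i j) := by
  unfold ev2 combM
  rw [getD_zipPad (f := comb m q) (d₁ := []) (fun _ => rfl) (comb_nil_nil m q), ev_comb]

theorem hd_eq (p : Row) : p.hd = (rv p).1 0 := by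
  unfold Row.hd rv ev
  cases p.1 <;> rfl

/-- The multiples of `m`. -/
def multiples (m : ℤ) (V : Type*) [AddCommGroup V] : Submodule ℤ V :=
  LinearMap.range (m • (LinearMap.id : V →ₗ[ℤ] V))

theorem smul_mem_multiples (m : ℤ) {V : Type*} [AddCommGroup V] (v : V) :
    m • v ∈ multiples m V := ⟨v, rfl⟩

/-- Put a zero before a sequence. -/
def cons0 : RowSpace →ₗ[ℤ] RowSpace where
  toFun v := (fun i => Nat.casesOn i 0 v.1, v.2)
  map_add' v w := by
    ext i
    · cases i <;> simp
    · rfl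
  map_smul' c v := by
    ext i
    · cases i <;> simp
    · rfl

@[simp]
theorem cons0_fst_zero (v : RowSpace) : (cons0 v).1 0 = 0 := rfl

@[simp]
theorem cons0_fst_succ (v : RowSpace) (i : ℕ) : (cons0 v).1 (i + 1) = v.1 i := rfl

@[simp]
theorem cons0_snd (v : RowSpace) : (cons0 v).2 = v.2 := rfl

theorem cons0_injective : Function.Injective cons0 := fun v w h => by
  refine Prod.ext (funext fun i => ?_) (congrArg Prod.snd h :)
  simpa using congrFun (congrArg Prod.fst h) (i + 1)

theorem exists_cons0 {v : RowSpace} (h : v.1 0 = 0) : ∃ w, cons0 w = v := by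
  refine ⟨(fun i => v.1 (i + 1), v.2), Prod.ext (funext fun i => ?_) rfl⟩
  cases i
  · exact h.symm
  · rfl

theorem cons0_rv_dropHd {p : Row} (h : p.hd = 0) : cons0 (rv p.dropHd) = rv p := by
  refine Prod.ext (funext fun i => ?_) rfl
  cases i with
  | zero => rw [cons0_fst_zero, ← hd_eq, h]
  | succ i =>
    rw [cons0_fst_succ]
    unfold Row.dropHd rv ev
    cases p.1 <;> simp

/-! ### The Euclidean algorithm on rows and the submodules that it preserves. -/

section

variable {m : ℤ}

theorem exists_rv_rowComb (hm : 0 < m) (q : ℤ) (p x : Row) :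
    ∃ w, rv (rowComb m q p x) = rv p - q • rv x + m • w := by
  refine ⟨(fun i => -((ev p.1 i - q * ev x.1 i) / m),
    fun i j => -((ev2 p.2 i j - q * ev2 x.2 i j) / m)), ?_⟩
  ext i
  · simp only [rv, rowComb, ev_comb, red_of_pos hm, Int.emod_def]
    simp [sub_eq_add_neg]
  · simp only [rv, rowComb, ev2_combM, red_of_pos hm, Int.emod_def]
    simp [sub_eq_add_neg]

theorem hd_rowComb (hm : 0 < m) (q : ℤ) (p x : Row) :
    (rowComb m q p x).hd = (p.hd - q * x.hd) % m := by
  simp only [hd_eq, rv, rowComb, ev_comb, red_of_pos hm]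

theorem hd_rowComb_div {p x : Row} (hx : 0 < x.hd) (hxm : x.hd ≤ m) :
    (rowComb m (p.hd / x.hd) p x).hd = p.hd % x.hd := by
  have h1 := Int.emod_nonneg p.hd hx.ne'
  have h2 := Int.emod_lt_of_pos p.hd hx
  have h3 : p.hd - p.hd / x.hd * x.hd = p.hd % x.hd := by rw [Int.emod_def, mul_comm]
  rw [hd_rowComb (hx.trans_le hxm), h3, Int.emod_eq_of_lt h1 (h2.trans_le hxm)]

theorem euclid_eq_iterate (s : Row × Row) :
    euclid m s = (eucStep m)^[Nat.size (2 * m * m).natAbs] s := by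
  rw [euclid, List.foldl_const, fuel, List.length_replicate]

/-- If `a ≥ b > 0` are the leading coefficients and `c` is the remainder, then `a ≥ b + c` and `c <
b` give `2bc ≤ ab`. So each step at least halves the product of the leading coefficients, and once
the product is below `1` the smaller one is zero. -/
theorem iterate_eucStep_hd {k : ℕ} {s : Row × Row} (h0 : 0 ≤ s.2.hd) (h1 : s.2.hd ≤ s.1.hd)
    (hm : s.2.hd ≤ m) (hk : s.1.hd * s.2.hd < 2 ^ k) : ((eucStep m)^[k] s).2.hd = 0 := by
  induction k generalizing s with
  | zero =>
    rw [Function.iterate_zero, id]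
    by_contra h
    have h2 : 0 < s.2.hd := lt_of_le_of_ne h0 (Ne.symm h)
    nlinarith
  | succ k ih =>
    rw [Function.iterate_succ_apply]
    rcases h0.eq_or_lt with h | h
    · have hs : eucStep m s = s := by simp [eucStep, ← h]
      rw [hs]
      exact ih h0 h1 hm (by rw [← h]; simp)
    · have hs : eucStep m s = (s.2, rowComb m (s.1.hd / s.2.hd) s.1 s.2) := by
        simp [eucStep, h.ne']
      have e := hd_rowComb_div (p := s.1) h hm
      have e1 := Int.emod_nonneg s.1.hd h.ne'
      have e2 := Int.emod_lt_of_pos s.1.hd h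
      rw [hs]
      refine ih (by simpa [e] using e1) (by simpa [e] using e2.le) (by simp only [e]; omega) ?_
      simp only [e]
      have h3 : 1 ≤ s.1.hd / s.2.hd := (Int.le_ediv_iff_mul_le h).2 (by simpa using h1)
      have h4 := Int.emod_add_mul_ediv s.1.hd s.2.hd
      have h5 : s.2.hd + s.1.hd % s.2.hd ≤ s.1.hd := by nlinarith
      rw [pow_succ] at hk
      nlinarith

/-- What one division step preserves survives the whole algorithm. This is applied to generated
submodules in `span_pair_euclid` and to exterior products in `ι_mul_ι_euclid`. -/
theorem euclid_induction {Q : Row → Row → Prop} {p x : Row} (hp : 0 ≤ p.hd) (hpm : p.hd ≤ m)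
    (hx : 0 ≤ x.hd) (hxm : x.hd < m)
    (hstep : ∀ p x : Row, 0 ≤ p.hd → p.hd ≤ m → 0 < x.hd → x.hd < m → Q p x →
      Q x (rowComb m (p.hd / x.hd) p x)) (h : Q p x) :
    Q (euclid m (p, x)).1 (euclid m (p, x)).2 ∧ (euclid m (p, x)).2.hd = 0 ∧
      0 ≤ (euclid m (p, x)).1.hd ∧ (euclid m (p, x)).1.hd ≤ m := by
  let I : Row × Row → Prop := fun s => Q s.1 s.2 ∧ 0 ≤ s.1.hd ∧ s.1.hd ≤ m ∧ 0 ≤ s.2.hd ∧ s.2.hd < m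
  have hI : ∀ s, I s → I (eucStep m s) := by
    rintro s ⟨h1, h2, h3, h4, h5⟩
    unfold eucStep
    split_ifs with h0
    · exact ⟨h1, h2, h3, h4, h5⟩
    · have h6 := lt_of_le_of_ne h4 (Ne.symm h0)
      have e := hd_rowComb_div (p := s.1) h6 h5.le
      have e1 := Int.emod_nonneg s.1.hd h6.ne'
      have e2 := Int.emod_lt_of_pos s.1.hd h6
      exact ⟨hstep _ _ h2 h3 h6 h5 h1, h4, h5.le, by simpa only [e], by
        simp only [e]; omega⟩
  have hit : ∀ n, I ((eucStep m)^[n] (p, x)) := by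
    intro n
    induction n with
    | zero => exact ⟨h, hp, hpm, hx, hxm⟩
    | succ n ih => rw [Function.iterate_succ_apply']; exact hI _ ih
  rw [euclid_eq_iterate]
  obtain ⟨h1, h2, h3, h4, h5⟩ := hit (Nat.size (2 * m * m).natAbs)
  refine ⟨h1, ?_, h2, h3⟩
  have hm : 0 < m := by omega
  -- One step is set aside to make the first leading coefficient at least as large as the second;
  -- the other `k` steps suffice because `m * m < 2 ^ k`.
  obtain ⟨k, hk⟩ : ∃ k, Nat.size (2 * m * m).natAbs = k + 1 :=
    ⟨_, (Nat.succ_pred_eq_of_pos (Nat.size_pos.2 (by positivity))).symm⟩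
  have hlt : m * m < 2 ^ k := by
    have := Nat.lt_size_self (2 * m * m).natAbs
    rw [hk] at this
    have h6 : ((2 * m * m).natAbs : ℤ) = 2 * m * m := Int.natAbs_of_nonneg (by positivity)
    have h7 : 2 * m * m < 2 ^ (k + 1) := by rw [← h6]; exact_mod_cast this
    rw [pow_succ] at h7
    linarith
  rw [hk, Function.iterate_succ_apply]
  obtain ⟨-, g2, g3, g4, g5⟩ := hI (p, x) ⟨h, hp, hpm, hx, hxm⟩
  refine iterate_eucStep_hd g4 ?_ g5.le ?_
  · unfold eucStep
    split_ifs with h0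
    · simp only at h0 ⊢; omega
    · have h6 : 0 < x.hd := lt_of_le_of_ne hx (Ne.symm h0)
      simp only [hd_rowComb_div (p := p) h6 hxm.le]
      exact (Int.emod_lt_of_pos p.hd h6).le
  · refine (mul_le_mul g3 g5.le g4 hm.le).trans_lt hlt

/-- The submodule generated by rows. -/
def rowSpan (rows : List Row) : Submodule ℤ RowSpace := Submodule.span ℤ {v | ∃ x ∈ rows, rv x = v}

theorem rowSpan_cons (x : Row) (rows : List Row) :
    rowSpan (x :: rows) = Submodule.span ℤ {rv x} ⊔ rowSpan rows := by
  rw [rowSpan, rowSpan, ← Submodule.span_union]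
  congr 1
  ext v
  simp [eq_comm]

theorem rowSpan_nil : rowSpan [] = ⊥ := by simp [rowSpan]

/-- The submodule generated by rows and the multiples of `m`. -/
def rowMod (m : ℤ) (rows : List Row) : Submodule ℤ RowSpace := rowSpan rows ⊔ multiples m RowSpace

theorem rowMod_cons (x : Row) (rows : List Row) :
    rowMod m (x :: rows) = Submodule.span ℤ {rv x} ⊔ rowMod m rows := by
  rw [rowMod, rowSpan_cons, sup_assoc, rowMod]

/-- The multiples of `m` with leading coefficient zero. -/
def multiples0 (m : ℤ) : Submodule ℤ RowSpace := (multiples m RowSpace).map cons0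

theorem smul_mem_multiples0 {v : RowSpace} (h : m * v.1 0 = 0) : m • v ∈ multiples0 m := by
  obtain ⟨w, hw⟩ := exists_cons0 (v := m • v) (by simpa using h)
  by_cases hm : m = 0
  · subst hm; simp
  have h0 : v.1 0 = 0 := by simpa [hm] using h
  obtain ⟨w, rfl⟩ := exists_cons0 h0
  exact ⟨m • w, smul_mem_multiples m w, map_smul _ _ _⟩

/-- The new leading coefficient is a remainder below `m`, so reduction modulo `m` leaves it alone
and changes the row by an element of `multiples0 m` only. Working modulo this smaller module, rather
than modulo all multiples of `m`, keeps track of the leading coefficients as integers. -/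
theorem span_pair_rowComb (hm : 0 < m) {p x : Row} (hx : 0 < x.hd) (hxm : x.hd < m) :
    Submodule.span ℤ {rv x} ⊔ Submodule.span ℤ {rv (rowComb m (p.hd / x.hd) p x)} ⊔ multiples0 m =
      Submodule.span ℤ {rv p} ⊔ Submodule.span ℤ {rv x} ⊔ multiples0 m := by
  obtain ⟨w, hw⟩ := exists_rv_rowComb hm (p.hd / x.hd) p x
  have hmw : m • w ∈ multiples0 m := by
    refine smul_mem_multiples0 ?_
    have h1 := hd_rowComb_div (p := p) hx hxm.le
    have h2 := congrArg (fun v : RowSpace => v.1 0) hw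
    simp only [← hd_eq, h1, Prod.fst_add, Prod.fst_sub, Prod.smul_fst, Pi.add_apply, Pi.sub_apply,
      Pi.smul_apply, smul_eq_mul, Int.emod_def] at h2
    linarith [mul_comm (p.hd / x.hd) x.hd]
  apply le_antisymm
  · refine sup_le (sup_le (le_sup_of_le_left le_sup_right) ?_) le_sup_right
    rw [Submodule.span_singleton_le_iff_mem, hw]
    refine add_mem (sub_mem ?_ (Submodule.smul_mem _ _ ?_)) ?_
    · exact Submodule.mem_sup_left (Submodule.mem_sup_left (Submodule.mem_span_singleton_self _))
    · exact Submodule.mem_sup_left (Submodule.mem_sup_right (Submodule.mem_span_singleton_self _))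
    · exact Submodule.mem_sup_right hmw
  · refine sup_le (sup_le ?_ (le_sup_of_le_left le_sup_left)) le_sup_right
    rw [Submodule.span_singleton_le_iff_mem]
    have e : rv p = rv (rowComb m (p.hd / x.hd) p x) + (p.hd / x.hd) • rv x - m • w := by
      rw [hw]; abel
    rw [e]
    refine sub_mem (add_mem ?_ (Submodule.smul_mem _ _ ?_)) ?_
    · exact Submodule.mem_sup_left (Submodule.mem_sup_right (Submodule.mem_span_singleton_self _))
    · exact Submodule.mem_sup_left (Submodule.mem_sup_left (Submodule.mem_span_singleton_self _))
    · exact Submodule.mem_sup_right hmw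

theorem span_pair_euclid {p x : Row} (hp : 0 < p.hd) (hpm : p.hd ≤ m) (hx : 0 ≤ x.hd)
    (hxm : x.hd < m) :
    Submodule.span ℤ {rv (euclid m (p, x)).1} ⊔ Submodule.span ℤ {rv (euclid m (p, x)).2} ⊔
        multiples0 m =
      Submodule.span ℤ {rv p} ⊔ Submodule.span ℤ {rv x} ⊔ multiples0 m ∧
    (euclid m (p, x)).2.hd = 0 ∧ 0 < (euclid m (p, x)).1.hd ∧ (euclid m (p, x)).1.hd ≤ m := by
  obtain ⟨⟨h1, h1'⟩, h2, h3, h4⟩ := euclid_induction (Q := fun p' x' =>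
    Submodule.span ℤ {rv p'} ⊔ Submodule.span ℤ {rv x'} ⊔ multiples0 m =
      Submodule.span ℤ {rv p} ⊔ Submodule.span ℤ {rv x} ⊔ multiples0 m ∧ 0 < p'.hd)
    hp.le hpm hx hxm (fun p' x' _ _ h3 h4 h => ⟨(span_pair_rowComb (by omega) h3 h4).trans h.1, h3⟩)
    ⟨rfl, hp⟩
  exact ⟨h1, h2, h1', h4⟩

/-- The invariant of the fold: the pivot, the finished rows with a zero put back in front, and the
rows still to come generate the same module throughout. A finished row has leading coefficient zero,
so `cons0` restores what `dropHd` removed. -/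
theorem clear_aux {rows : List Row} (hr : ∀ x ∈ rows, 0 ≤ x.hd ∧ x.hd < m) :
    ∀ {p : Row} {out : List Row}, 0 < p.hd → p.hd ≤ m →
    let s := rows.foldl (fun s x => ((euclid m (s.1, x)).1,
      (euclid m (s.1, x)).2.dropHd :: s.2)) (p, out)
    Submodule.span ℤ {rv s.1} ⊔ (rowMod m s.2).map cons0 =
      Submodule.span ℤ {rv p} ⊔ (rowMod m out).map cons0 ⊔ rowSpan rows ∧
    0 < s.1.hd ∧ s.1.hd ≤ m := by
  induction rows with
  | nil => intro p out h1 h2; simp [rowSpan_nil, h1, h2]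
  | cons x rows ih =>
    intro p out h1 h2
    obtain ⟨h3, h4⟩ := hr x (by simp)
    obtain ⟨g1, g2, g3, g4⟩ := span_pair_euclid h1 h2 h3 h4
    have hle : ∀ rows, multiples0 m ≤ (rowMod m rows).map cons0 :=
      fun rows => Submodule.map_mono le_sup_right
    obtain ⟨k1, k2⟩ := ih (fun y hy => hr y (by simp [hy])) (p := (euclid m (p, x)).1)
      (out := (euclid m (p, x)).2.dropHd :: out) g3 g4
    refine ⟨k1.trans ?_, k2⟩
    rw [rowMod_cons, Submodule.map_sup, Submodule.map_span, Set.image_singleton,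
      cons0_rv_dropHd g2, rowSpan_cons, ← sup_assoc, ← sup_assoc]
    congr 1
    have e : ∀ A : Submodule ℤ RowSpace, A ⊔ (rowMod m out).map cons0 =
        A ⊔ multiples0 m ⊔ (rowMod m out).map cons0 := fun A => by
      rw [sup_assoc, sup_eq_right.2 (hle out)]
    rw [e, g1, ← e, sup_right_comm]

theorem rowMod_map_rowComb (hm : 0 < m) (rows : List Row) :
    rowMod m (rows.map fun x => rowComb m 0 x ([], [])) = rowMod m rows := by
  induction rows with
  | nil => rfl
  | cons x rows ih =>
    rw [List.map_cons, rowMod_cons, rowMod_cons, ih]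
    obtain ⟨w, hw⟩ := exists_rv_rowComb hm 0 x ([], [])
    rw [zero_smul, sub_zero] at hw
    have hmw : ∀ A, m • w ∈ A ⊔ rowMod m rows := fun A =>
      Submodule.mem_sup_right (Submodule.mem_sup_right (smul_mem_multiples m w))
    apply le_antisymm <;> refine sup_le ?_ le_sup_right <;>
      rw [Submodule.span_singleton_le_iff_mem]
    · rw [hw]
      exact add_mem (Submodule.mem_sup_left (Submodule.mem_span_singleton_self _)) (hmw _)
    · rw [eq_sub_of_add_eq hw.symm]
      exact sub_mem (Submodule.mem_sup_left (Submodule.mem_span_singleton_self _)) (hmw _)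

/-- The module of the rows is the sum of the multiples of the pivot row and of the module of the
remaining rows, shifted by `cons0`. Hence the leading coefficient of the pivot divides all others;
and as it is not zero, an element with leading coefficient zero comes from the remaining rows alone.
-/
theorem elimCol_spec (hm : 0 < m) (rows : List Row) :
    rowMod m (elimCol m rows).2 = (rowMod m rows).comap cons0 ∧
    rv (elimCol m rows).1 ∈ rowMod m rows ∧ 0 < (elimCol m rows).1.hd ∧
    ∀ v ∈ rowMod m rows, (elimCol m rows).1.hd ∣ v.1 0 := by
  obtain ⟨h1, h2, h3⟩ := clear_aux (m := m) (rows := rows.map fun x => rowComb m 0 x ([], []))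
    (fun x hx => by
      obtain ⟨y, -, rfl⟩ := List.mem_map.1 hx
      rw [hd_rowComb hm]
      exact ⟨Int.emod_nonneg _ hm.ne', Int.emod_lt_of_pos _ hm⟩) (p := ([m], [])) (out := [])
    (by simpa [Row.hd] using hm) (by simp [Row.hd])
  -- The initial pivot `[m]` supplies the multiples of `m` with nonzero leading coefficient; the
  -- shifted multiples supply those with leading coefficient zero.
  have e : Submodule.span ℤ {rv ([m], [])} ⊔ (rowMod m []).map cons0 = multiples m RowSpace := by
    have e0 : rv ([m], []) = m • ((fun i => if i = 0 then 1 else 0, 0) : RowSpace) := by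
      refine Prod.ext (funext fun i => ?_) (funext fun i => funext fun j => ?_)
      · cases i <;> simp [rv, ev]
      · simp [rv, ev2, ev]
    rw [rowMod, rowSpan_nil, bot_sup_eq]
    apply le_antisymm
    · refine sup_le ?_ ?_
      · rw [Submodule.span_singleton_le_iff_mem, e0]
        exact smul_mem_multiples _ _
      · rintro _ ⟨_, ⟨w, rfl⟩, rfl⟩
        exact ⟨cons0 w, (map_smul cons0 m w).symm⟩
    · rintro _ ⟨w, rfl⟩
      have : (m • LinearMap.id : RowSpace →ₗ[ℤ] RowSpace) w = w.1 0 • rv ([m], []) +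
          m • (w - w.1 0 • ((fun i => if i = 0 then 1 else 0, 0) : RowSpace)) := by
        rw [e0, smul_sub, smul_comm m (w.1 0)]
        simp
      rw [this]
      refine add_mem (Submodule.mem_sup_left (Submodule.smul_mem _ _
        (Submodule.mem_span_singleton_self _))) (Submodule.mem_sup_right
          (smul_mem_multiples0 (by simp)))
  rw [e, sup_comm, sup_comm (multiples m RowSpace), ← rowMod, rowMod_map_rowComb hm] at h1
  change (rowMod m (elimCol m rows).2).map cons0 ⊔ Submodule.span ℤ {rv (elimCol m rows).1} =
    rowMod m rows at h1
  change 0 < (elimCol m rows).1.hd at h2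
  have hmem : ∀ v ∈ rowMod m rows, ∃ w ∈ rowMod m (elimCol m rows).2, ∃ c : ℤ,
      v = cons0 w + c • rv (elimCol m rows).1 := by
    intro v hv
    rw [← h1] at hv
    obtain ⟨_, ⟨w, hw, rfl⟩, _, hz, rfl⟩ := Submodule.mem_sup.1 hv
    obtain ⟨c, rfl⟩ := Submodule.mem_span_singleton.1 hz
    exact ⟨w, hw, c, rfl⟩
  refine ⟨le_antisymm ?_ ?_, ?_, h2, ?_⟩
  · intro w hw
    rw [Submodule.mem_comap, ← h1]
    exact Submodule.mem_sup_left ⟨w, hw, rfl⟩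
  · intro w hw
    obtain ⟨w', hw', c, hc⟩ := hmem _ hw
    have := congrArg (fun v : RowSpace => v.1 0) hc
    simp only [cons0_fst_zero, Prod.fst_add, Pi.add_apply, Prod.smul_fst, Pi.smul_apply,
      smul_eq_mul, ← hd_eq, zero_add] at this
    have hc0 : c = 0 := by
      rcases mul_eq_zero.1 this.symm with h | h
      · exact h
      · omega
    rw [hc0, zero_smul, add_zero] at hc
    rw [cons0_injective hc]
    exact hw'
  · rw [← h1]
    exact Submodule.mem_sup_right (Submodule.mem_span_singleton_self _)
  · intro v hv
    obtain ⟨w', hw', c, rfl⟩ := hmem _ hv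
    refine ⟨c, ?_⟩
    simp [← hd_eq, mul_comm]

theorem elimCols_spec {α : Type*} (hm : 0 < m) (tmpl : List α) (rows : List Row) :
    rowMod m (elimCols m rows tmpl) = (rowMod m rows).comap (cons0 ^ tmpl.length) := by
  induction tmpl generalizing rows with
  | nil => rfl
  | cons a tmpl ih =>
    change rowMod m (elimCols m (elimCol m rows).2 tmpl) = _
    rw [ih, (elimCol_spec hm rows).1, List.length_cons, pow_succ', Module.End.mul_eq_comp,
      Submodule.comap_comp]

theorem cons0_pow_fst_lt {l i : ℕ} (h : i < l) (v : RowSpace) : ((cons0 ^ l) v).1 i = 0 := by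
  induction l generalizing i with
  | zero => omega
  | succ l ih =>
    rw [pow_succ', Module.End.mul_apply]
    cases i with
    | zero => rfl
    | succ i => rw [cons0_fst_succ, ih (by omega)]

theorem cons0_pow_snd (l : ℕ) (v : RowSpace) : ((cons0 ^ l) v).2 = v.2 := by
  induction l with
  | zero => rfl
  | succ l ih => rw [pow_succ', Module.End.mul_apply, cons0_snd, ih]

theorem exists_cons0_pow {l : ℕ} {v : RowSpace} (h : ∀ i < l, v.1 i = 0) :
    ∃ w, (cons0 ^ l) w = v := by
  induction l generalizing v with
  | zero => exact ⟨v, rfl⟩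
  | succ l ih =>
    obtain ⟨w, rfl⟩ := exists_cons0 (h 0 (by omega))
    obtain ⟨w', rfl⟩ := ih (v := w) fun i hi => by simpa using h (i + 1) (by omega)
    exact ⟨w', by rw [pow_succ', Module.End.mul_apply]⟩

/-- A matrix occurs next to zero entries in the submodule generated by the rows if and only if it
occurs in the submodule generated by the rows that remain after elimination. -/
theorem exists_mem_elimCols {α : Type*} (hm : 0 < m) (tmpl : List α) (rows : List Row)
    (P : ℕ → ℕ → ℤ) : (∃ v ∈ rowMod m (elimCols m rows tmpl), v.2 = P) ↔
      ∃ v ∈ rowMod m rows, (∀ i < tmpl.length, v.1 i = 0) ∧ v.2 = P := by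
  rw [elimCols_spec hm]
  constructor
  · rintro ⟨v, hv, rfl⟩
    exact ⟨_, hv, fun i hi => cons0_pow_fst_lt hi v, cons0_pow_snd _ _⟩
  · rintro ⟨v, hv, h, rfl⟩
    obtain ⟨w, rfl⟩ := exists_cons0_pow h
    exact ⟨w, hv, (cons0_pow_snd _ _).symm⟩

/-- The pivot generates the ideal of leading coefficients, so it is `1` exactly when the first
coordinate can be prescribed. The pivot row then fixes that coordinate, and the other coordinates
are left to the remaining rows. -/
theorem spans_eq_one_iff {α : Type*} (hm : 0 < m) (tmpl : List α) (rows : List Row) :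
    spans m tmpl rows = 1 ↔
      ∀ f : ℕ → ℤ, ∃ v ∈ rowMod m rows, ∀ i < tmpl.length, v.1 i = f i := by
  have key : ∀ (tmpl : List α) (rows : List Row) (z : ℤ),
      (tmpl.foldl (fun s _ => (if (elimCol m s.2).1.hd = 1 then s.1 else 0, (elimCol m s.2).2))
        (z, rows)).1 = 1 ↔ z = 1 ∧
      ∀ f : ℕ → ℤ, ∃ v ∈ rowMod m rows, ∀ i < tmpl.length, v.1 i = f i := by
    intro tmpl
    induction tmpl with
    | nil => intro rows z; exact ⟨fun h => ⟨h, fun _ => ⟨0, zero_mem _, by simp⟩⟩, fun h => h.1⟩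
    | cons a tmpl ih =>
      intro rows z
      obtain ⟨h1, h2, h3, h4⟩ := elimCol_spec hm rows
      rw [List.foldl_cons, ih, h1]
      constructor
      · rintro ⟨hz, h⟩
        have h5 : (elimCol m rows).1.hd = 1 := by
          by_contra h5
          simp [h5] at hz
        rw [if_pos h5] at hz
        refine ⟨hz, fun f => ?_⟩
        obtain ⟨w, hw, hwf⟩ := h fun i => f (i + 1) - f 0 * (rv (elimCol m rows).1).1 (i + 1)
        refine ⟨f 0 • rv (elimCol m rows).1 + cons0 w, add_mem (Submodule.smul_mem _ _ h2) hw,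
          fun i hi => ?_⟩
        cases i with
        | zero => simp [← hd_eq, h5]
        | succ i =>
          have := hwf i (by simpa using hi)
          simp [this]
      · rintro ⟨hz, h⟩
        have h5 : (elimCol m rows).1.hd = 1 := by
          obtain ⟨v, hv, hvf⟩ := h fun _ => 1
          have := h4 v hv
          rw [hvf 0 (by simp)] at this
          exact Int.eq_one_of_dvd_one h3.le this
        refine ⟨by simp [h5, hz], fun f => ?_⟩
        obtain ⟨v, hv, hvf⟩ := h fun i => Nat.casesOn i 0 f
        obtain ⟨w, rfl⟩ := exists_cons0 (hvf 0 (by simp))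
        exact ⟨w, hv, fun i hi => by simpa using hvf (i + 1) (by simpa using hi)⟩
  rw [spans, key]
  simp only [true_and]

end

end BitCost

namespace BitCost

/-! ### Elimination and determinants -/

section

variable {R : Type*} [CommRing R]

/-- The determinants of the leading square submatrices, as a functional on the exterior algebra
of the module of sequences. -/
noncomputable def detFunctional (R : Type*) [CommRing R] :
    ExteriorAlgebra R (ℕ → R) →ₗ[R] R :=
  ExteriorAlgebra.liftAlternating fun l =>
    (Matrix.detRowAlternating (R := R) (n := Fin l)).compLinearMap
      (LinearMap.funLeft R R (fun j : Fin l => (j : ℕ)))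

/-- The product in the exterior algebra of a list of sequences. -/
noncomputable def wedge (L : List (ℕ → R)) : ExteriorAlgebra R (ℕ → R) :=
  (L.map (ExteriorAlgebra.ι R)).prod

theorem detFunctional_wedge_ofFn {l : ℕ} (w : Fin l → ℕ → R) :
    detFunctional R (wedge (List.ofFn w)) = (Matrix.of fun i j : Fin l => w i j).det := by
  have h : wedge (List.ofFn w) = ExteriorAlgebra.ιMulti R l w := by
    rw [wedge, List.map_ofFn, ExteriorAlgebra.ιMulti_apply]
    rfl
  rw [h, detFunctional, ExteriorAlgebra.liftAlternating_apply_ιMulti]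
  rfl

/-- Put a zero before a sequence. -/
def seqCons0 (w : ℕ → R) : ℕ → R := fun i => Nat.casesOn i 0 w

/-- Expansion along the first column, in which only `p` has a nonzero entry. One functional serves
lists of all lengths, so elimination can be followed without matrices that change their size. -/
theorem detFunctional_cons (p : ℕ → R) (L : List (ℕ → R)) :
    detFunctional R (wedge (p :: L.map seqCons0)) = p 0 * detFunctional R (wedge L) := by
  obtain ⟨l, w, rfl⟩ : ∃ (l : ℕ) (w : Fin l → ℕ → R), List.ofFn w = L :=
    ⟨L.length, L.get, List.ofFn_get L⟩
  have h : p :: (List.ofFn w).map seqCons0 =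
      List.ofFn (Fin.cons p fun i => seqCons0 (w i) : Fin (l + 1) → ℕ → R) := by
    rw [List.ofFn_succ, List.map_ofFn]
    simp [Function.comp_def]
  rw [h, detFunctional_wedge_ofFn, detFunctional_wedge_ofFn, Matrix.det_succ_column_zero,
    Fin.sum_univ_succ]
  simp only [Matrix.of_apply, Fin.cons_zero, Fin.cons_succ, Fin.val_zero]
  rw [Finset.sum_eq_zero]
  · simp only [pow_zero, one_mul, add_zero]
    congr 1
  · intro i _
    simp [seqCons0]

/-- Equality up to sign. -/
def SignEq {A : Type*} [Ring A] (a b : A) : Prop := a = b ∨ a = -b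

theorem SignEq.refl {A : Type*} [Ring A] (a : A) : SignEq a a := Or.inl rfl

theorem SignEq.symm {A : Type*} [Ring A] {a b : A} (h : SignEq a b) : SignEq b a := by
  rcases h with h | h
  · exact Or.inl h.symm
  · exact Or.inr (by rw [h, neg_neg])

theorem SignEq.trans {A : Type*} [Ring A] {a b c : A} (h : SignEq a b) (h' : SignEq b c) :
    SignEq a c := by
  rcases h with rfl | rfl <;> rcases h' with rfl | rfl
  · exact Or.inl rfl
  · exact Or.inr rfl
  · exact Or.inr rfl
  · exact Or.inl (neg_neg _)

theorem SignEq.mul_left {A : Type*} [Ring A] {a b : A} (c : A) (h : SignEq a b) :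
    SignEq (c * a) (c * b) := by
  rcases h with rfl | rfl
  · exact Or.inl rfl
  · exact Or.inr (by simp)

theorem SignEq.mul_right {A : Type*} [Ring A] {a b : A} (c : A) (h : SignEq a b) :
    SignEq (a * c) (b * c) := by
  rcases h with rfl | rfl
  · exact Or.inl rfl
  · exact Or.inr (by simp)

theorem SignEq.map {A B F : Type*} [Ring A] [Ring B] [FunLike F A B] [AddMonoidHomClass F A B]
    (f : F) {a b : A} (h : SignEq a b) : SignEq (f a) (f b) := by
  rcases h with rfl | rfl
  · exact Or.inl rfl
  · exact Or.inr (by simp)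

theorem ι_mul_ι_signEq (x y : ℕ → R) : SignEq (ExteriorAlgebra.ι R x * ExteriorAlgebra.ι R y)
    (ExteriorAlgebra.ι R y * ExteriorAlgebra.ι R x) :=
  Or.inr (eq_neg_of_add_eq_zero_left (ExteriorAlgebra.ι_add_mul_swap x y))

theorem ι_mul_wedge_signEq (x : ℕ → R) (L : List (ℕ → R)) :
    SignEq (ExteriorAlgebra.ι R x * wedge L) (wedge L * ExteriorAlgebra.ι R x) := by
  induction L with
  | nil => simp [wedge, SignEq]
  | cons y L ih =>
    have e : wedge (y :: L) = ExteriorAlgebra.ι R y * wedge L := by simp [wedge]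
    rw [e, ← mul_assoc]
    refine ((ι_mul_ι_signEq x y).mul_right _).trans ?_
    rw [mul_assoc, mul_assoc]
    exact ih.mul_left _

theorem wedge_cons (y : ℕ → R) (L : List (ℕ → R)) :
    wedge (y :: L) = ExteriorAlgebra.ι R y * wedge L := by simp [wedge]

end

/-! ### Elimination modulo `n` computes determinants up to sign. -/

section

variable {n : ℕ}

/-- The vector of a row, as a sequence modulo `n`. -/
def er (n : ℕ) (p : Row) : ℕ → ZMod n := fun i => (ev p.1 i : ZMod n)

theorem red_cast (hn : 0 < n) (z : ℤ) : ((red n z : ℤ) : ZMod n) = z := by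
  rw [red_of_pos (by exact_mod_cast hn), ZMod.intCast_mod]

theorem er_rowComb (hn : 0 < n) (q : ℤ) (p x : Row) :
    er n (rowComb n q p x) = er n p - (q : ZMod n) • er n x := by
  ext i
  simp only [er, rowComb, ev_comb, red_cast hn]
  simp [er]

theorem seqCons0_er_dropHd {p : Row} (h : p.hd = 0) : seqCons0 (er n p.dropHd) = er n p := by
  have h1 := cons0_rv_dropHd h
  ext i
  have h2 := congrFun (congrArg Prod.fst h1) i
  cases i with
  | zero => simpa [seqCons0, er, rv] using congrArg (Int.cast : ℤ → ZMod n) h2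
  | succ i => simpa [seqCons0, er, rv] using congrArg (Int.cast : ℤ → ZMod n) h2

open ExteriorAlgebra in
-- A division step replaces `p ∧ x` by `x ∧ (p - qx) = x ∧ p`, which is its negative. Signs are not
-- tracked, because only absolute values of determinants will be needed.
theorem ι_mul_ι_euclid {p x : Row} (hp : 0 ≤ p.hd) (hpm : p.hd ≤ n) (hx : 0 ≤ x.hd)
    (hxm : x.hd < n) :
    SignEq (ι (ZMod n) (er n (euclid n (p, x)).1) * ι (ZMod n) (er n (euclid n (p, x)).2))
      (ι (ZMod n) (er n p) * ι (ZMod n) (er n x)) ∧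
    (euclid n (p, x)).2.hd = 0 ∧ 0 ≤ (euclid n (p, x)).1.hd ∧ (euclid n (p, x)).1.hd ≤ n := by
  refine euclid_induction (Q := fun p' x' => SignEq (ι (ZMod n) (er n p') * ι (ZMod n) (er n x'))
      (ι (ZMod n) (er n p) * ι (ZMod n) (er n x))) hp hpm hx hxm
    (fun p' x' _ _ h3 h4 h => SignEq.trans ?_ h) (SignEq.refl _)
  have e : ι (ZMod n) (er n x') * ι (ZMod n) (er n (rowComb n (p'.hd / x'.hd) p' x')) =
      ι (ZMod n) (er n x') * ι (ZMod n) (er n p') := by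
    rw [er_rowComb (by omega), map_sub, map_smul, mul_sub, mul_smul_comm, ι_sq_zero, smul_zero,
      sub_zero]
  rw [e]
  exact ι_mul_ι_signEq _ _

/-- The analogue of `clear_aux`: up to sign, the product of the pivot, the finished rows and the
rows still to come does not change. -/
theorem clear_wedge {rows : List Row} (hr : ∀ x ∈ rows, 0 ≤ x.hd ∧ x.hd < n) :
    ∀ {p : Row} {out : List Row}, 0 ≤ p.hd → p.hd ≤ n →
    let s := rows.foldl (fun s x => ((euclid n (s.1, x)).1,
      (euclid n (s.1, x)).2.dropHd :: s.2)) (p, out)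
    SignEq (wedge (er n s.1 :: (s.2.map (er n)).map seqCons0))
      (wedge (er n p :: (out.map (er n)).map seqCons0) * wedge (rows.map (er n))) ∧
    s.2.length = out.length + rows.length := by
  induction rows with
  | nil => intro p out _ _; simp [wedge, SignEq]
  | cons x rows ih =>
    intro p out h1 h2
    obtain ⟨h3, h4⟩ := hr x (by simp)
    obtain ⟨g1, g2, g3, g4⟩ := ι_mul_ι_euclid h1 h2 h3 h4
    obtain ⟨k1, k2⟩ := ih (fun y hy => hr y (by simp [hy])) (p := (euclid n (p, x)).1)
      (out := (euclid n (p, x)).2.dropHd :: out) g3 g4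
    refine ⟨k1.trans ?_, by rw [List.foldl_cons, k2, List.length_cons, List.length_cons]; omega⟩
    rw [List.map_cons, List.map_cons, seqCons0_er_dropHd g2, List.map_cons, wedge_cons,
      wedge_cons, wedge_cons, wedge_cons, ← mul_assoc, ← mul_assoc]
    refine SignEq.mul_right _ ((g1.mul_right _).trans ?_)
    rw [mul_assoc, mul_assoc]
    -- The vector of `x` has to be moved past the finished rows, which costs at most a sign.
    exact (ι_mul_wedge_signEq _ _).mul_left _

theorem detCol_spec (hn : 0 < n) {rows : List Row} (hr : rows ≠ []) :
    SignEq (detFunctional (ZMod n) (wedge (rows.map (er n))))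
      (((detCol n rows).1.hd : ZMod n) *
        detFunctional (ZMod n) (wedge ((detCol n rows).2.map (er n)))) ∧
    (detCol n rows).2.length = rows.length - 1 := by
  obtain ⟨x, rows, rfl⟩ := List.exists_cons_of_ne_nil hr
  have hn' : (0 : ℤ) < n := by exact_mod_cast hn
  have hred : ∀ x : Row, 0 ≤ (rowComb n 0 x ([], [])).hd ∧ (rowComb n 0 x ([], [])).hd < n := by
    intro x
    rw [hd_rowComb hn']
    exact ⟨Int.emod_nonneg _ hn'.ne', Int.emod_lt_of_pos _ hn'⟩
  have her : ∀ x : Row, er n (rowComb n 0 x ([], [])) = er n x := fun x => by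
    rw [er_rowComb hn]; simp
  obtain ⟨h1, h2⟩ := clear_wedge (n := n) (rows := rows.map fun x => rowComb n 0 x ([], []))
    (fun y hy => by
      obtain ⟨z, -, rfl⟩ := List.mem_map.1 hy
      exact hred z) (p := rowComb n 0 x ([], [])) (out := []) (hred x).1 (hred x).2.le
  refine ⟨?_, by simpa [detCol, clear] using h2⟩
  have e : (rows.map fun x => rowComb n 0 x ([], [])).map (er n) = rows.map (er n) := by
    rw [List.map_map]
    exact List.map_congr_left fun x _ => her x
  rw [e, her, List.map_nil, List.map_nil] at h1
  have h3 := (h1.map (detFunctional (ZMod n))).symm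
  rw [detFunctional_cons] at h3
  have h4 : wedge ([] : List (ℕ → ZMod n)) = 1 := rfl
  rw [wedge_cons, h4, mul_one, ← wedge_cons, ← List.map_cons] at h3
  have h5 : ((detCol n (x :: rows)).1.hd : ZMod n) = er n (detCol n (x :: rows)).1 0 := by
    rw [hd_eq]; rfl
  rw [h5]
  exact h3

theorem detMod_spec (hn : 1 < n) (rows : List (List ℤ)) :
    SignEq ((detMod n rows : ℤ) : ZMod n)
      (detFunctional (ZMod n) (wedge (rows.map fun v => er n (v, [])))) ∧
    0 ≤ detMod n rows ∧ detMod n rows < n := by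
  have hn' : (0 : ℤ) < n := by omega
  have key : ∀ (T : List (List ℤ)) (z : ℤ) (rs : List Row), T.length = rs.length →
      0 ≤ z → z < n →
      let s := T.foldl (fun s _ => (red n (s.1 * (detCol n s.2).1.hd), (detCol n s.2).2)) (z, rs)
      SignEq ((s.1 : ℤ) : ZMod n) ((z : ZMod n) * detFunctional (ZMod n) (wedge (rs.map (er n)))) ∧
        0 ≤ s.1 ∧ s.1 < n := by
    intro T
    induction T with
    | nil =>
      intro z rs h h0 h1
      rw [List.length_nil, eq_comm, List.length_eq_zero_iff] at h
      subst h
      have e : detFunctional (ZMod n) (wedge []) = 1 := by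
        simpa using detFunctional_wedge_ofFn (R := ZMod n) (l := 0) Fin.elim0
      exact ⟨by simp [e, SignEq], h0, h1⟩
    | cons t T ih =>
      intro z rs h h0 h1
      have hrs : rs ≠ [] := by rintro rfl; simp at h
      obtain ⟨g1, g2⟩ := detCol_spec (by omega : 0 < n) hrs
      obtain ⟨k1, k2⟩ := ih (red n (z * (detCol n rs).1.hd)) (detCol n rs).2
        (by rw [g2, ← h]; simp)
        (by rw [red_of_pos hn']; exact Int.emod_nonneg _ hn'.ne')
        (by rw [red_of_pos hn']; exact Int.emod_lt_of_pos _ hn')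
      refine ⟨k1.trans ?_, k2⟩
      rw [red_cast (by omega), Int.cast_mul, mul_assoc]
      exact (g1.mul_left _).symm
  have := key rows 1 (rows.map fun v => ((v, []) : Row)) (by simp) (by norm_num) (by omega)
  simpa [Function.comp_def, detMod] using this

/-- Expanding the product of the row sums gives one term for every map from `Fin k` to itself; the
Leibniz formula involves only those of the permutations. The bound is crude, but its length is
polynomial in that of the matrix. -/
theorem abs_det_le_prod {k : ℕ} (A : Matrix (Fin k) (Fin k) ℤ) :
    |A.det| ≤ ∏ i, ∑ j, |A i j| := by
  rw [← Matrix.det_transpose, Matrix.det_apply]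
  refine (Finset.abs_sum_le_sum_abs _ _).trans ?_
  rw [Finset.prod_univ_sum, Fintype.piFinset_univ]
  have h : ∀ σ : Equiv.Perm (Fin k), |Equiv.Perm.sign σ • ∏ i, A.transpose (σ i) i| =
      ∏ i, |A i (σ i)| := by
    intro σ
    rw [← Finset.abs_prod, Units.smul_def, smul_eq_mul, abs_mul]
    simp
  rw [Finset.sum_congr rfl fun σ _ => h σ]
  have e : ∑ σ : Equiv.Perm (Fin k), ∏ i, |A i (σ i)| = ∑ f ∈ Finset.univ.map
      ⟨fun σ : Equiv.Perm (Fin k) => (σ : Fin k → Fin k), DFunLike.coe_injective⟩,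
      ∏ i, |A i (f i)| := by
    rw [Finset.sum_map]
    rfl
  rw [e]
  exact Finset.sum_le_sum_of_subset_of_nonneg (Finset.subset_univ _) fun f _ _ =>
    Finset.prod_nonneg fun i _ => abs_nonneg _

theorem prodBound_eq (l : List ℤ) : prodBound l = (l.map fun z => 1 + |z|).prod := by
  have : ∀ s, l.foldl (fun s z => s * (1 + |z|)) s = s * (l.map fun z => 1 + |z|).prod := by
    induction l with
    | nil => simp
    | cons a l ih => intro s; simp [ih, mul_assoc]
  rw [prodBound, this, one_mul]

theorem one_add_sum_le_prod {k : ℕ} (f : Fin k → ℤ) (hf : ∀ i, 0 ≤ f i) :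
    1 + ∑ i, f i ≤ ∏ i, (1 + f i) := by
  induction k with
  | zero => simp
  | succ k ih =>
    rw [Fin.sum_univ_succ, Fin.prod_univ_succ]
    have h1 := ih (fun i => f i.succ) fun i => hf _
    have h2 : 0 ≤ ∑ i : Fin k, f i.succ := Finset.sum_nonneg fun i _ => hf _
    nlinarith [hf 0]

theorem one_le_prodBound (l : List ℤ) : 1 ≤ prodBound l := by
  rw [prodBound_eq]
  induction l with
  | nil => simp
  | cons a l ih =>
    rw [List.map_cons, List.prod_cons]
    nlinarith [abs_nonneg a]

theorem abs_det_le_prodBound {k : ℕ} (A : Matrix (Fin k) (Fin k) ℤ) :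
    |A.det| ≤ prodBound (List.ofFn fun i => List.ofFn (A i)).flatten := by
  refine (abs_det_le_prod A).trans ?_
  have h : prodBound (List.ofFn fun i => List.ofFn (A i)).flatten =
      ∏ i, ∏ j, (1 + |A i j|) := by
    rw [prodBound_eq, List.map_flatten, List.prod_flatten, List.map_ofFn, List.map_ofFn,
      List.prod_ofFn]
    simp [Function.comp_def, List.map_ofFn, List.prod_ofFn]
  rw [h]
  refine Finset.prod_le_prod (fun i _ => Finset.sum_nonneg fun j _ => abs_nonneg _) fun i _ => ?_
  have := one_add_sum_le_prod (fun j => |A i j|) fun j => abs_nonneg _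
  linarith

/-- The modulus is `n = 2B + 1` with `|det A| ≤ B`. The residue `d` belongs to `det A` or to `-det
A`, and in either case the smaller of `d` and `n - d` is `|det A|`; so the lost sign does no harm.
-/
theorem absDet_ofFn {k : ℕ} (A : Matrix (Fin k) (Fin k) ℤ) :
    absDet (List.ofFn fun i => List.ofFn (A i)) = |A.det| := by
  set rows := List.ofFn fun i => List.ofFn (A i) with hrows
  have hb := abs_det_le_prodBound A
  rw [← hrows] at hb
  have hpos := one_le_prodBound rows.flatten
  obtain ⟨n, hn⟩ : ∃ n : ℕ, detBound rows = n :=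
    ⟨(detBound rows).toNat, (Int.toNat_of_nonneg (by unfold detBound; omega)).symm⟩
  have hnb : (n : ℤ) = 2 * prodBound rows.flatten + 1 := by rw [← hn, detBound]
  obtain ⟨h1, h2, h3⟩ := detMod_spec (n := n) (by omega) rows
  have e : rows.map (fun v => er n (v, [])) =
      List.ofFn fun (i : Fin k) (j : ℕ) => ((ev (List.ofFn (A i)) j : ℤ) : ZMod n) := by
    rw [hrows, List.map_ofFn]
    rfl
  have e2 : (Matrix.of fun i j : Fin k => ((ev (List.ofFn (A i)) j : ℤ) : ZMod n)).det =
      ((A.det : ℤ) : ZMod n) := by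
    rw [Int.cast_det]
    congr 1
    ext i j
    simp [ev]
  rw [e, detFunctional_wedge_ofFn, e2] at h1
  have h4 : (n : ℤ) ∣ detMod n rows - A.det ∨ (n : ℤ) ∣ detMod n rows + A.det := by
    rcases h1 with h | h
    · left
      rw [← ZMod.intCast_zmod_eq_zero_iff_dvd, Int.cast_sub, h, sub_self]
    · right
      rw [← ZMod.intCast_zmod_eq_zero_iff_dvd, Int.cast_add, h, neg_add_cancel]
  have h5 := abs_le.1 hb
  have h6 : ∀ d : ℤ, -prodBound rows.flatten ≤ d → d ≤ prodBound rows.flatten →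
      (n : ℤ) ∣ detMod n rows - d →
      (if (n : ℤ) < 2 * detMod n rows then n - detMod n rows else detMod n rows) = |d| := by
    rintro d hd1 hd2 ⟨c, hc⟩
    have hc0 : c = 0 ∨ c = 1 := by
      have h7 : -1 < c := by
        by_contra h
        have : (n : ℤ) * c ≤ n * (-1) := mul_le_mul_of_nonneg_left (by omega) (by omega)
        omega
      have h8 : c < 2 := by
        by_contra h
        have : (n : ℤ) * 2 ≤ n * c := mul_le_mul_of_nonneg_left (by omega) (by omega)
        omega
      omega
    rcases hc0 with rfl | rfl
    · rw [if_neg (by omega), abs_of_nonneg (by omega)]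
      omega
    · rw [if_pos (by omega), abs_of_nonpos (by omega)]
      omega
  rw [absDet, hn]
  rcases h4 with h | h
  · exact h6 _ h5.1 h5.2 h
  · rw [← abs_neg]
    exact h6 _ (by omega) (by omega) (by rwa [sub_neg_eq_add])

end

end BitCost

namespace BitCost

/-! ### Vectors and matrices as elements and endomorphisms of a lattice -/

theorem ev_nil : ev [] = 0 := by ext i; simp [ev]

theorem ev2_nil : ev2 [] = 0 := by ext i j; simp [ev2, ev]

theorem ev_cons_zero (a : ℤ) (v : List ℤ) : ev (a :: v) 0 = a := rfl

theorem ev_cons_succ (a : ℤ) (v : List ℤ) (i : ℕ) : ev (a :: v) (i + 1) = ev v i := rfl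

theorem ev_ofFn {k : ℕ} (f : Fin k → ℤ) (i : Fin k) : ev (List.ofFn f) i = f i := by
  simp [ev]

theorem dot_eq_sum (u v : List ℤ) {n : ℕ} (hn : u.length ≤ n) :
    dot u v = ∑ i ∈ Finset.range n, ev u i * ev v i := by
  have h : ∀ (L : List (ℤ × ℤ)) (s : ℤ), L.foldl (fun s p => s + p.1 * p.2) s =
      s + (L.map fun p => p.1 * p.2).sum := by
    intro L
    induction L with
    | nil => simp
    | cons p L ih => intro s; simp [ih, add_assoc]
  rw [dot, h, zero_add]
  induction u generalizing v n with
  | nil => simp [zipPad, ev_nil, Function.comp_def]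
  | cons a u ih =>
    obtain ⟨n, rfl⟩ : ∃ k, n = k + 1 := ⟨n - 1, by simp at hn; omega⟩
    rw [zipPad, List.map_cons, List.sum_cons, ih v.tail (by simpa using hn),
      Finset.sum_range_succ', add_comm]
    congr 1
    · refine Finset.sum_congr rfl fun i _ => ?_
      cases v <;> simp [ev]
    · cases v <;> simp [ev]

theorem dvd_ev_lincomb {m : ℤ} (hm : 0 < m) (v : List ℤ) (C : List (List ℤ)) {n : ℕ}
    (hv : v.length ≤ n) (i : ℕ) :
    m ∣ ev (lincomb m v C) i - ∑ j ∈ Finset.range n, ev v j * ev2 C j i := by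
  have h : ∀ (L : List (ℤ × List ℤ)) (s : List ℤ),
      m ∣ ev (L.foldl (fun s p => comb m (-p.1) s p.2) s) i -
        (ev s i + (L.map fun p => p.1 * ev p.2 i).sum) := by
    intro L
    induction L with
    | nil => simp
    | cons p L ih =>
      intro s
      have h1 := ih (comb m (-p.1) s p.2)
      have h2 : m ∣ ev (comb m (-p.1) s p.2) i - (ev s i + p.1 * ev p.2 i) := by
        rw [ev_comb, red_of_pos hm]
        rw [Int.emod_def]
        exact ⟨-((ev s i - -p.1 * ev p.2 i) / m), by ring⟩
      rw [List.foldl_cons, List.map_cons, List.sum_cons]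
      rw [show ∀ A B C D E : ℤ, A - (B + (D + E)) = A - (C + E) + (C - (B + D)) from
        fun A B C D E => by ring]
      exact dvd_add h1 h2
  have h1 := h (zipPad Prod.mk (Prod.mk 0) [] v C) []
  rw [ev_nil, Pi.zero_apply, zero_add] at h1
  rw [lincomb]
  convert h1 using 2
  clear h1 h
  induction v generalizing C n with
  | nil => simp [zipPad, ev_nil, Function.comp_def]
  | cons a v ih =>
    obtain ⟨n, rfl⟩ : ∃ k, n = k + 1 := ⟨n - 1, by simp at hv; omega⟩
    rw [zipPad, List.map_cons, List.sum_cons, ← ih C.tail (by simpa using hv),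
      Finset.sum_range_succ', add_comm]
    congr 1
    · cases C <;> simp [ev, ev2]
    · refine Finset.sum_congr rfl fun i _ => ?_
      cases C <;> simp [ev, ev2]

/-- The unit vector at position `i`, without trailing zeros. -/
def unitVec (i : ℕ) : List ℤ := List.replicate i 0 ++ [1]

theorem ev_unitVec (i : ℕ) : ev (unitVec i) = Pi.single i 1 := by
  induction i with
  | zero =>
    ext j
    cases j <;> simp [unitVec, ev]
  | succ i ih =>
    ext j
    have e : unitVec (i + 1) = 0 :: unitVec i := rfl
    rw [e]
    cases j with
    | zero => simp [ev_cons_zero]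
    | succ j => rw [ev_cons_succ, ih]; simp [Pi.single_apply]

theorem units_eq {α : Type*} (tmpl : List α) :
    units tmpl = (List.range tmpl.length).map unitVec := by
  have h : ∀ (tmpl : List α) (i : ℕ) (acc : List (List ℤ)),
      (tmpl.foldl (fun s _ => (0 :: s.1, s.1 :: s.2)) (unitVec i, acc)).2.reverse =
        acc.reverse ++ (List.range' i tmpl.length).map unitVec := by
    intro tmpl
    induction tmpl with
    | nil => simp
    | cons a tmpl ih =>
      intro i acc
      rw [List.foldl_cons]
      have := ih (i + 1) (unitVec i :: acc)
      rw [List.length_cons, List.range'_succ, List.map_cons]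
      simpa [unitVec, List.replicate_succ] using this
  have := h tmpl 0 []
  rw [List.range_eq_range']
  simpa [units, unitVec] using this

theorem dvd_ev_lincomb_unitVec {m : ℤ} (hm : 0 < m) (i : ℕ) (C : List (List ℤ)) (j : ℕ) :
    m ∣ ev (lincomb m (unitVec i) C) j - ev2 C i j := by
  have := dvd_ev_lincomb hm (unitVec i) C (n := i + 1) (by simp [unitVec]) j
  rwa [ev_unitVec, Finset.sum_eq_single i (by intro k _ hk; simp [hk]) (by simp),
    Pi.single_eq_same, one_mul] at this

theorem fit_eq {α : Type*} (tmpl : List α) (g : List ℤ) :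
    fit tmpl g = List.ofFn fun i : Fin tmpl.length => ev g i := by
  have h : ∀ (tmpl : List α) (g acc : List ℤ),
      (tmpl.foldl (fun s _ => (s.1.tail, s.1.headD 0 :: s.2)) (g, acc)).2.reverse =
        acc.reverse ++ List.ofFn fun i : Fin tmpl.length => ev g i := by
    intro tmpl
    induction tmpl with
    | nil => simp
    | cons a tmpl ih =>
      intro g acc
      rw [List.foldl_cons, ih]
      cases g <;> simp [List.ofFn_succ, ev]
  simpa [fit] using h tmpl g []

section

variable {L : Type*} [AddCommGroup L] {r : ℕ} (b : Module.Basis (Fin r) ℤ L) {m : ℤ}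

/-- The lattice element with given coefficients. -/
noncomputable def vecL : (ℕ → ℤ) →ₗ[ℤ] L :=
  (Fintype.linearCombination ℤ b).comp (LinearMap.funLeft ℤ ℤ (fun i : Fin r => (i : ℕ)))

theorem vecL_apply (f : ℕ → ℤ) : vecL b f = ∑ i : Fin r, f i • b i := rfl

theorem repr_vecL (f : ℕ → ℤ) (i : Fin r) : b.repr (vecL b f) i = f i := by
  rw [vecL_apply, Module.Basis.repr_sum_self b fun i : Fin r => f i]

theorem vecL_single (i : Fin r) : vecL b (Pi.single (i : ℕ) 1) = b i := by
  rw [vecL_apply, Finset.sum_eq_single i (by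
    intro j _ hj
    rw [Pi.single_eq_of_ne (by simpa [Fin.ext_iff] using hj), zero_smul]) (by simp)]
  simp

theorem exists_vecL (x : L) : ∃ f, vecL b f = x := by
  refine ⟨fun i => if h : i < r then b.repr x ⟨i, h⟩ else 0, ?_⟩
  rw [vecL_apply]
  simp

theorem vecL_mem_multiples_iff (f : ℕ → ℤ) :
    vecL b f ∈ multiples m L ↔ ∀ i < r, m ∣ f i := by
  constructor
  · rintro ⟨w, hw⟩ i hi
    rw [← repr_vecL b f ⟨i, hi⟩, ← hw]
    simp
  · intro h
    choose! g hg using h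
    refine ⟨vecL b g, ?_⟩
    rw [vecL_apply, vecL_apply]
    simp only [LinearMap.smul_apply, LinearMap.id_apply, Finset.smul_sum]
    exact Finset.sum_congr rfl fun i _ => by rw [hg i i.2, mul_smul]

theorem vecL_sub_mem {f g : ℕ → ℤ} (h : ∀ i, m ∣ f i - g i) :
    vecL b f - vecL b g ∈ multiples m L := by
  rw [← map_sub]
  exact (vecL_mem_multiples_iff b _).2 fun i _ => h i

theorem map_mem_multiples {V W : Type*} [AddCommGroup V] [AddCommGroup W] (φ : V →ₗ[ℤ] W) {v : V}
    (h : v ∈ multiples m V) : φ v ∈ multiples m W := by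
  obtain ⟨w, rfl⟩ := h
  exact ⟨φ w, (map_smul φ m w).symm⟩

/-- The list of columns `C` represents the endomorphism `φ` modulo `m`. -/
structure Rep (m : ℤ) (C : List (List ℤ)) (φ : L →ₗ[ℤ] L) : Prop where
  col : ∀ i : Fin r, vecL b (ev2 C i) - φ (b i) ∈ multiples m L
  dvd : ∀ i, r ≤ i → ∀ j, m ∣ ev2 C i j

variable {b}

/-- Columns beyond the rank are divisible by `m`, so entries of `v` at positions from `r` on have no
influence. This is why vectors need not have length `r`. -/
theorem Rep.lincomb (hm : 0 < m) {C : List (List ℤ)} {φ : L →ₗ[ℤ] L} (h : Rep b m C φ)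
    (v : List ℤ) : vecL b (ev (lincomb m v C)) - φ (vecL b (ev v)) ∈ multiples m L := by
  have h1 : vecL b (ev (BitCost.lincomb m v C)) -
      vecL b (∑ j ∈ Finset.range (r + v.length), ev v j • ev2 C j) ∈ multiples m L := by
    refine vecL_sub_mem b fun i => ?_
    have := dvd_ev_lincomb hm v C (n := r + v.length) (by omega) i
    simpa using this
  have h2 : vecL b (∑ j ∈ Finset.range (r + v.length), ev v j • ev2 C j) -
      φ (vecL b (ev v)) ∈ multiples m L := by
    have h3 : φ (vecL b (ev v)) = ∑ i : Fin r, φ (ev v i • b i) := by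
      rw [vecL_apply b (ev v), map_sum]
    rw [Finset.sum_range_add, map_add, Finset.sum_range, map_sum, h3, add_sub_right_comm,
      ← Finset.sum_sub_distrib]
    refine add_mem (sum_mem fun i _ => ?_) ?_
    · rw [map_smul, map_smul, ← smul_sub]
      exact Submodule.smul_mem _ _ (h.col i)
    · rw [map_sum]
      refine sum_mem fun i _ => ?_
      rw [map_smul]
      exact Submodule.smul_mem _ _ ((vecL_mem_multiples_iff b _).2
        fun j _ => h.dvd _ (Nat.le_add_right _ _) j)
  simpa using add_mem h1 h2

theorem ev2_map_of_lt {C : List (List ℤ)} {i : ℕ} (hi : i < C.length) (f : List ℤ → List ℤ) :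
    ev2 (C.map f) i = ev (f (C.getD i [])) := by
  simp [ev2, hi]

theorem ev2_of_le {C : List (List ℤ)} {i : ℕ} (hi : C.length ≤ i) : ev2 C i = 0 := by
  rw [ev2, List.getD_eq_default _ _ hi, ev_nil]

theorem Rep.sqr (hm : 0 < m) {C : List (List ℤ)} {φ : L →ₗ[ℤ] L} (h : Rep b m C φ) :
    Rep b m (sqr m C) (φ ^ 2) := by
  constructor
  · intro i
    rw [sq, Module.End.mul_apply]
    rcases lt_or_ge (i : ℕ) C.length with hi | hi
    · rw [BitCost.sqr, ev2_map_of_lt hi]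
      have h1 := h.lincomb hm (C.getD i [])
      have h2 := map_mem_multiples φ (h.col i)
      rw [map_sub] at h2
      simpa [ev2] using add_mem h1 h2
    · rw [ev2_of_le (by simpa [BitCost.sqr] using hi), map_zero, zero_sub]
      have h2 := map_mem_multiples φ (h.col i)
      rw [ev2_of_le hi, map_zero, zero_sub, map_neg] at h2
      exact h2
  · intro i hi j
    rcases lt_or_ge i C.length with hl | hl
    · rw [BitCost.sqr, ev2_map_of_lt hl]
      have h1 := dvd_ev_lincomb hm (C.getD i []) C (n := (C.getD i []).length) le_rfl j
      have h2 : m ∣ ∑ k ∈ Finset.range (C.getD i []).length, ev (C.getD i []) k * ev2 C k j :=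
        Finset.dvd_sum fun k _ => Dvd.dvd.mul_right (h.dvd i hi k) _
      simpa using dvd_add h1 h2
    · rw [ev2_of_le (by simpa [BitCost.sqr] using hl)]
      simp

/-- For a template of length `r` the exponent is at least `|m| ^ r`, hence at least the order of
`L/mL`, while the number of squarings stays polynomial. -/
theorem Rep.highPow {α : Type*} (hm : 0 < m) {C : List (List ℤ)} {φ : L →ₗ[ℤ] L}
    (h : Rep b m C φ) (tmpl : List α) :
    Rep b m (highPow m tmpl C) (φ ^ 2 ^ (tmpl.length * Nat.size m.natAbs)) := by
  have key : ∀ (n : ℕ) {C : List (List ℤ)} {φ : L →ₗ[ℤ] L}, Rep b m C φ →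
      Rep b m ((BitCost.sqr m)^[n] C) (φ ^ 2 ^ n) := by
    intro n
    induction n with
    | zero => intro C φ h; simpa using h
    | succ n ih =>
      intro C φ h
      rw [Function.iterate_succ_apply, pow_succ', pow_mul]
      exact ih (h.sqr hm)
  have e : BitCost.highPow m tmpl C =
      (BitCost.sqr m)^[tmpl.length * Nat.size m.natAbs] C := by
    rw [BitCost.highPow, List.foldl_const, mul_comm, Function.iterate_mul]
    congr 1
    ext1 C
    rw [List.foldl_const, fuel, List.length_replicate]
  rw [e]
  exact key _ h

/-! ### Submodules of matrices cut out by linear conditions. -/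

/-- The submodule generated by matrices and the multiples of `m`. -/
def matMod (m : ℤ) (gens : List (List (List ℤ))) : Submodule ℤ (ℕ → ℕ → ℤ) :=
  Submodule.span ℤ {P | ∃ a ∈ gens, ev2 a = P} ⊔ multiples m _

theorem map_multiples_snd :
    (multiples m RowSpace).map (LinearMap.snd ℤ (ℕ → ℤ) (ℕ → ℕ → ℤ)) = multiples m _ := by
  apply le_antisymm
  · rintro _ ⟨_, ⟨w, rfl⟩, rfl⟩
    exact ⟨w.2, rfl⟩
  · rintro _ ⟨w, rfl⟩
    exact ⟨m • ((0, w) : RowSpace), ⟨_, rfl⟩, rfl⟩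

theorem matMod_map_snd (rows : List Row) :
    matMod m (rows.map Prod.snd) =
      (rowMod m rows).map (LinearMap.snd ℤ (ℕ → ℤ) (ℕ → ℕ → ℤ)) := by
  rw [rowMod, Submodule.map_sup, map_multiples_snd, rowSpan, Submodule.map_span, matMod]
  congr 2
  ext P
  constructor
  · rintro ⟨a, ha, rfl⟩
    obtain ⟨p, hp, rfl⟩ := List.mem_map.1 ha
    exact ⟨rv p, ⟨p, hp, rfl⟩, rfl⟩
  · rintro ⟨_, ⟨p, hp, rfl⟩, rfl⟩
    exact ⟨p.2, List.mem_map_of_mem hp, rfl⟩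

/-- The submodule of `L` that is generated by vectors and the multiples of `m`. -/
def vecMod (b : Module.Basis (Fin r) ℤ L) (m : ℤ) (O : List (List ℤ)) : Submodule ℤ L :=
  Submodule.span ℤ {x | ∃ o ∈ O, vecL b (ev o) = x} ⊔ multiples m L

theorem exists_sub_smul {f : ℕ → ℤ} (h : vecL b f ∈ multiples m L) :
    ∃ t : ℕ → ℤ, ∀ i < r, f i - m * t i = 0 := by
  rw [vecL_mem_multiples_iff] at h
  choose! t ht using h
  exact ⟨t, fun i hi => by rw [← ht i hi, sub_self]⟩

/-- Each matrix enters together with its column `i`, and each vector of `O` together with the zero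
matrix. A combination with vanishing vector part is a matrix whose column `i` is cancelled modulo
`m` by vectors of `O`, and elimination finds all such combinations. -/
theorem mem_matMod_kerStep {α : Type*} (hm : 0 < m) {tmpl : List α} (ht : tmpl.length = r)
    (O : List (List ℤ)) (gens : List (List (List ℤ))) (i : ℕ) (P : ℕ → ℕ → ℤ) :
    P ∈ matMod m (kerStep m tmpl O gens (unitVec i)) ↔
      P ∈ matMod m gens ∧ vecL b (P i) ∈ vecMod b m O := by
  set rows : List Row := (gens.map fun a => ((lincomb m (unitVec i) a, a) : Row)) ++
    O.map fun o => ((o, []) : Row) with hrows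
  have h1 : P ∈ matMod m (kerStep m tmpl O gens (unitVec i)) ↔
      ∃ v ∈ rowMod m rows, (∀ i < tmpl.length, v.1 i = 0) ∧ v.2 = P := by
    rw [← exists_mem_elimCols hm, kerStep, matMod_map_snd]
    rfl
  -- `θ` compares the vector carried by a row with column `i` of its matrix: it is a multiple of `m`
  -- on the rows from `gens`, and it takes the value `o` on the row of `o`.
  let θ : RowSpace →ₗ[ℤ] L := (vecL b).comp (LinearMap.fst ℤ _ _) -
    ((vecL b).comp (LinearMap.proj i)).comp (LinearMap.snd ℤ _ _)
  have hθ : ∀ v : RowSpace, θ v = vecL b v.1 - vecL b (v.2 i) := fun v => rfl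
  have h2 : ∀ v ∈ rowMod m rows, θ v ∈ vecMod b m O := by
    intro v hv
    suffices hle : rowMod m rows ≤ (vecMod b m O).comap θ from hle hv
    refine sup_le (Submodule.span_le.2 ?_) ?_
    · rintro _ ⟨x, hx, rfl⟩
      rw [hrows, List.mem_append, List.mem_map, List.mem_map] at hx
      rcases hx with ⟨a, -, rfl⟩ | ⟨o, ho, rfl⟩
      · exact Submodule.mem_sup_right
          (vecL_sub_mem b fun j => dvd_ev_lincomb_unitVec hm i a j)
      · refine Submodule.mem_sup_left (Submodule.subset_span ⟨o, ho, ?_⟩)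
        simp [hθ, rv, ev2_nil]
    · intro v hv
      exact Submodule.mem_sup_right (map_mem_multiples θ hv)
  rw [h1]
  constructor
  · rintro ⟨v, hv, hv0, rfl⟩
    refine ⟨?_, ?_⟩
    · suffices hle : rowMod m rows ≤ (matMod m gens).comap (LinearMap.snd ℤ _ _) from hle hv
      refine sup_le (Submodule.span_le.2 ?_) ?_
      · rintro _ ⟨x, hx, rfl⟩
        rw [hrows, List.mem_append, List.mem_map, List.mem_map] at hx
        rcases hx with ⟨a, ha, rfl⟩ | ⟨o, ho, rfl⟩
        · exact Submodule.mem_sup_left (Submodule.subset_span ⟨a, ha, rfl⟩)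
        · simp [rv, ev2_nil]
      · intro v hv
        exact Submodule.mem_sup_right (map_mem_multiples (LinearMap.snd ℤ _ _) hv)
    · have h3 := h2 v hv
      have h4 : vecL b v.1 = 0 := by
        rw [vecL_apply]
        exact Finset.sum_eq_zero fun j _ => by rw [hv0 j (by rw [ht]; exact j.2), zero_smul]
      rw [hθ, h4, zero_sub] at h3
      exact neg_mem_iff.1 h3
  · rintro ⟨hP, hD⟩
    obtain ⟨v, hv, hvP⟩ : ∃ v ∈ rowMod m rows, v.2 = P := by
      have e : gens = (gens.map fun a => ((lincomb m (unitVec i) a, a) : Row)).map Prod.snd := by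
        simp [Function.comp_def]
      rw [e, matMod_map_snd] at hP
      obtain ⟨v, hv, hvP⟩ := hP
      refine ⟨v, ?_, hvP⟩
      have hle : rowMod m (gens.map fun a => ((lincomb m (unitVec i) a, a) : Row)) ≤
          rowMod m rows := by
        refine sup_le_sup_right (Submodule.span_mono ?_) _
        rintro _ ⟨x, hx, rfl⟩
        exact ⟨x, List.mem_append_left _ hx, rfl⟩
      exact hle hv
    have h5 : vecL b v.1 ∈ vecMod b m O := by
      have := add_mem (h2 v hv) hD
      rwa [hθ, hvP, sub_add_cancel] at this
    have h6 : ∀ d ∈ Submodule.span ℤ {x | ∃ o ∈ O, vecL b (ev o) = x},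
        ∃ v ∈ rowMod m rows, v.2 = 0 ∧ vecL b v.1 = d := by
      intro d hd
      induction hd using Submodule.span_induction with
      | mem x hx =>
        obtain ⟨o, ho, rfl⟩ := hx
        exact ⟨rv (o, []), Submodule.mem_sup_left (Submodule.subset_span
          ⟨_, List.mem_append_right _ (List.mem_map_of_mem ho), rfl⟩), ev2_nil, rfl⟩
      | zero => exact ⟨0, zero_mem _, rfl, map_zero _⟩
      | add x y _ _ hx hy =>
        obtain ⟨v, hv, hv2, rfl⟩ := hx
        obtain ⟨w, hw, hw2, rfl⟩ := hy
        exact ⟨v + w, add_mem hv hw, by rw [Prod.snd_add, hv2, hw2, add_zero], map_add _ _ _⟩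
      | smul c x _ hx =>
        obtain ⟨v, hv, hv2, rfl⟩ := hx
        exact ⟨c • v, Submodule.smul_mem _ _ hv, by rw [Prod.smul_snd, hv2, smul_zero],
          by rw [Prod.smul_fst, map_smul]⟩
    obtain ⟨d, hd, z, hz, hdz⟩ := Submodule.mem_sup.1 h5
    obtain ⟨w, hw, hw2, hwd⟩ := h6 d hd
    have h7 : vecL b (v.1 - w.1) ∈ multiples m L := by
      rw [map_sub, hwd, ← hdz, add_sub_cancel_left]
      exact hz
    -- The vector part must vanish exactly and not only modulo `m`; an element of `multiples m
    -- RowSpace` with zero matrix corrects it.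
    obtain ⟨t, ht0⟩ := exists_sub_smul h7
    refine ⟨v - w - m • ((t, 0) : RowSpace), sub_mem (sub_mem hv hw)
      (Submodule.mem_sup_right (smul_mem_multiples _ _)), fun j hj => ?_, ?_⟩
    · have := ht0 j (by omega)
      simpa using this
    · simp [hw2, hvP]

theorem mem_matMod_idealGens {α : Type*} (hm : 0 < m) {tmpl : List α} (ht : tmpl.length = r)
    (As : List (List (List ℤ))) (x : List ℤ) (P : ℕ → ℕ → ℤ) :
    P ∈ matMod m (idealGens m tmpl (units tmpl) As x) ↔
      P ∈ matMod m As ∧ ∀ i < r, vecL b (P i) ∈ vecMod b m (As.map fun A => lincomb m x A) := by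
  have key : ∀ (l : List ℕ) (gens : List (List (List ℤ))),
      P ∈ matMod m ((l.map unitVec).foldl (fun gens y =>
        kerStep m tmpl (As.map fun A => lincomb m x A) gens y) gens) ↔
      P ∈ matMod m gens ∧
        ∀ i ∈ l, vecL b (P i) ∈ vecMod b m (As.map fun A => lincomb m x A) := by
    intro l
    induction l with
    | nil => simp
    | cons i l ih =>
      intro gens
      rw [List.map_cons, List.foldl_cons, ih, mem_matMod_kerStep (b := b) hm ht]
      simp [and_assoc]
  rw [idealGens, units_eq, key, ht]
  simp

/-! ### Stable images of powers, and a linear equation for them. -/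

theorem mem_range_iterate {Q : Type*} [Finite Q] (f : Q → Q) {k : ℕ} (hk : Nat.card Q ≤ k)
    (v : Q) : ∃ w, f^[k] (f^[k] w) = f^[k] v := by
  have hanti : ∀ i, Set.range f^[i + 1] ⊆ Set.range f^[i] := by
    rintro i _ ⟨w, rfl⟩
    exact ⟨f w, by rw [← Function.iterate_succ_apply]⟩
  have hstep : ∀ i, Set.range f^[i] = Set.range f^[i + 1] →
      Set.range f^[i + 1] = Set.range f^[i + 2] := by
    intro i h
    have e : ∀ j, Set.range f^[j + 1] = f '' Set.range f^[j] := fun j => by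
      rw [Function.iterate_succ', Set.range_comp]
    rw [e i, e (i + 1), h]
  -- The images decrease, and two equal neighbours force all later ones to be equal. Each strict
  -- inclusion loses an element, so stability is reached after at most `Nat.card Q` steps, and then
  -- `f^[k] v` lies in the image of `f^[k + k]`.
  have hcard : ∀ i, Set.range f^[i] = Set.range f^[i + 1] ∨
      (Set.range f^[i + 1]).ncard + i + 1 ≤ Nat.card Q := by
    intro i
    induction i with
    | zero =>
      by_cases h : Set.range f^[0] = Set.range f^[0 + 1]
      · exact Or.inl h
      · right
        have := Set.ncard_lt_ncard (lt_of_le_of_ne (hanti 0) (Ne.symm h)) (Set.toFinite _)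
        have := Set.ncard_le_card (Set.range f^[0])
        omega
    | succ i ih =>
      rcases ih with ih | ih
      · exact Or.inl (hstep i ih)
      · by_cases h : Set.range f^[i + 1] = Set.range f^[i + 1 + 1]
        · exact Or.inl h
        · right
          have := Set.ncard_lt_ncard (lt_of_le_of_ne (hanti (i + 1)) (Ne.symm h)) (Set.toFinite _)
          omega
  have hk' : Set.range f^[k] = Set.range f^[k + 1] := (hcard k).resolve_right (by omega)
  have hstable : ∀ j, Set.range f^[k + j] = Set.range f^[k] := by
    intro j
    have : ∀ j, Set.range f^[k + j] = Set.range f^[k] ∧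
        Set.range f^[k + j] = Set.range f^[k + j + 1] := by
      intro j
      induction j with
      | zero => exact ⟨rfl, hk'⟩
      | succ j ih => exact ⟨ih.2.symm.trans ih.1, hstep _ ih.2⟩
    exact (this j).1
  have hv : f^[k] v ∈ Set.range f^[k + k] := by
    rw [hstable k]
    exact ⟨v, rfl⟩
  obtain ⟨w, hw⟩ := hv
  exact ⟨w, by rw [← hw, Function.iterate_add_apply]⟩

theorem card_quotient_multiples_le (b : Module.Basis (Fin r) ℤ L) (hm : 0 < m) :
    Finite (L ⧸ multiples m L) ∧ Nat.card (L ⧸ multiples m L) ≤ m.natAbs ^ r := by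
  let F : (Fin r → Fin m.natAbs) → L ⧸ multiples m L := fun c =>
    Submodule.Quotient.mk (∑ i, ((c i : ℕ) : ℤ) • b i)
  have hF : Function.Surjective F := by
    intro q
    obtain ⟨x, rfl⟩ := Submodule.Quotient.mk_surjective _ q
    have h0 : ∀ z : ℤ, 0 ≤ z % m ∧ z % m < m := fun z =>
      ⟨Int.emod_nonneg _ hm.ne', Int.emod_lt_of_pos _ hm⟩
    refine ⟨fun i => ⟨(b.repr x i % m).toNat, by have := h0 (b.repr x i); omega⟩, ?_⟩
    rw [Submodule.Quotient.eq]
    generalize hc : (fun i => (⟨(b.repr x i % m).toNat, by have := h0 (b.repr x i); omega⟩ :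
      Fin m.natAbs)) = c
    have hc' : ∀ i, ((c i : ℕ) : ℤ) = b.repr x i % m := fun i => by
      rw [← hc]
      exact Int.toNat_of_nonneg (h0 _).1
    conv => enter [2, 2]; rw [← b.sum_repr x]
    rw [← Finset.sum_sub_distrib]
    refine sum_mem fun i _ => ?_
    rw [hc', ← sub_smul, Int.emod_def,
      show b.repr x i - m * (b.repr x i / m) - b.repr x i = m * -(b.repr x i / m) by ring,
      mul_smul]
    exact smul_mem_multiples _ _
  refine ⟨Finite.of_surjective F hF, ?_⟩
  simpa using Nat.card_le_card_of_surjective F hF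

/-- On the finite group `L/mL` the maps `φ ^ k` and `φ ^ (2 * k)` have the same image. Stability is
applied to `-v`, to match the sign in the equation that `solve` treats. -/
theorem exists_fitting (b : Module.Basis (Fin r) ℤ L) (hm : 0 < m) (φ : L →ₗ[ℤ] L) {k : ℕ}
    (hk : m.natAbs ^ r ≤ k) (v : L) :
    ∃ w, (φ ^ k) ((φ ^ k) w) + (φ ^ k) v ∈ multiples m L := by
  obtain ⟨hfin, hcard⟩ := card_quotient_multiples_le b hm
  have hφ : multiples m L ≤ (multiples m L).comap φ := fun x hx => map_mem_multiples φ hx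
  have hit : ∀ (n : ℕ) (x : L), ((multiples m L).mapQ _ φ hφ)^[n] (Submodule.Quotient.mk x) =
      Submodule.Quotient.mk ((φ ^ n) x) := by
    intro n x
    induction n with
    | zero => rfl
    | succ n ih =>
      rw [Function.iterate_succ_apply', ih, pow_succ', Module.End.mul_apply]
      rfl
  obtain ⟨q, hq⟩ := mem_range_iterate ((multiples m L).mapQ _ φ hφ) (hcard.trans hk)
    (Submodule.Quotient.mk (-v))
  obtain ⟨w, rfl⟩ := Submodule.Quotient.mk_surjective _ q
  rw [hit, hit, hit, Submodule.Quotient.eq, map_neg, sub_neg_eq_add] at hq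
  exact ⟨w, hq⟩

/-- The row of `v` carries the marker `[1]`, and the row of a column of `B` carries that column. So
a combination with vanishing vector part displays an integer `t` and a vector `B w` such that `B² w
+ t B v` vanishes modulo `m`. A second elimination, on `t` alone, reaches `t = 1` modulo `m`,
because the assumed solution shows that `1` occurs among the values of `t`. -/
theorem solve_spec {α : Type*} (hm : 0 < m) {tmpl : List α} (ht : tmpl.length = r)
    {B : List (List ℤ)} {φ : L →ₗ[ℤ] L} (hB : Rep b m B φ) (v : List ℤ)
    (hw : ∃ w, φ (φ w) + φ (vecL b (ev v)) ∈ multiples m L) :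
    ∃ w, vecL b (ev (solve m tmpl B v)) - φ w ∈ multiples m L ∧
      φ (φ w) + φ (vecL b (ev v)) ∈ multiples m L := by
  set rows : List Row := ((lincomb m v B, [[1], []]) : Row) ::
    B.map fun c => ((lincomb m c B, [[], c]) : Row) with hrows
  set rows1 := elimCols m rows tmpl with hrows1
  set rows2 : List Row := rows1.map fun p => ((p.2.headD [], [p.2.tail.headD []]) : Row)
    with hrows2
  -- `τ` makes the marker the leading coefficient and keeps the vector `B w` as companion.
  let τ : RowSpace →ₗ[ℤ] RowSpace :=
    { toFun := fun v => (v.2 0, fun i => if i = 0 then v.2 1 else 0)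
      map_add' := fun v w => by
        ext i
        · rfl
        · by_cases h : i = 0 <;> simp [h]
      map_smul' := fun c v => by
        ext i
        · rfl
        · by_cases h : i = 0 <;> simp [h] }
  have hτ : rowSpan rows2 = (rowSpan rows1).map τ := by
    rw [rowSpan, rowSpan, Submodule.map_span]
    congr 1
    ext u
    have hrv : ∀ p : Row, rv (p.2.headD [], [p.2.tail.headD []]) = τ (rv p) := by
      rintro ⟨h, P⟩
      refine Prod.ext ?_ (funext fun i => ?_)
      · cases P <;> rfl
      · cases i with
        | zero =>
          rcases P with _ | ⟨a, _ | ⟨c, P⟩⟩ <;> rfl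
        | succ i => simp [rv, ev2, ev_nil, τ]
    constructor
    · rintro ⟨q, hq, rfl⟩
      obtain ⟨p, hp, rfl⟩ := List.mem_map.1 hq
      exact ⟨rv p, ⟨p, hp, rfl⟩, (hrv p).symm⟩
    · rintro ⟨_, ⟨p, hp, rfl⟩, rfl⟩
      exact ⟨_, List.mem_map_of_mem hp, hrv p⟩
  -- every element of the module of rows comes from a linear equation
  have hsound : ∀ u ∈ rowMod m rows, ∃ w, vecL b (u.2 1) - φ w ∈ multiples m L ∧
      vecL b u.1 - (φ (φ w) + u.2 0 0 • φ (vecL b (ev v))) ∈ multiples m L := by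
    intro u hu
    obtain ⟨s, hs, z, hz, rfl⟩ := Submodule.mem_sup.1 hu
    have hz' : ∃ w, vecL b (z.2 1) - φ w ∈ multiples m L ∧
        vecL b z.1 - (φ (φ w) + z.2 0 0 • φ (vecL b (ev v))) ∈ multiples m L := by
      obtain ⟨z, rfl⟩ := hz
      refine ⟨0, ?_, ?_⟩
      · rw [map_zero, sub_zero]
        exact map_mem_multiples ((vecL b).comp ((LinearMap.proj 1).comp (LinearMap.snd ℤ _ _)))
          (smul_mem_multiples m z)
      · rw [map_zero, map_zero, zero_add]
        refine sub_mem (map_mem_multiples ((vecL b).comp (LinearMap.fst ℤ _ _))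
          (smul_mem_multiples m z)) ?_
        simp only [LinearMap.smul_apply, LinearMap.id_apply, Prod.smul_snd, Pi.smul_apply,
          smul_assoc]
        exact smul_mem_multiples _ _
    have hadd : ∀ x y : RowSpace, (∃ w, vecL b (x.2 1) - φ w ∈ multiples m L ∧
        vecL b x.1 - (φ (φ w) + x.2 0 0 • φ (vecL b (ev v))) ∈ multiples m L) →
        (∃ w, vecL b (y.2 1) - φ w ∈ multiples m L ∧
        vecL b y.1 - (φ (φ w) + y.2 0 0 • φ (vecL b (ev v))) ∈ multiples m L) →
        ∃ w, vecL b ((x + y).2 1) - φ w ∈ multiples m L ∧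
        vecL b (x + y).1 - (φ (φ w) + (x + y).2 0 0 • φ (vecL b (ev v))) ∈ multiples m L := by
      rintro x y ⟨w, hw1, hw2⟩ ⟨w', hw1', hw2'⟩
      refine ⟨w + w', ?_, ?_⟩
      · convert add_mem hw1 hw1' using 1
        simp only [Prod.snd_add, Pi.add_apply, map_add]
        abel
      · convert add_mem hw2 hw2' using 1
        simp only [Prod.snd_add, Prod.fst_add, Pi.add_apply, map_add, add_smul]
        abel
    refine hadd s z ?_ hz'
    clear hz hz' hu z
    induction hs using Submodule.span_induction with
    | mem x hx =>
      obtain ⟨p, hp, rfl⟩ := hx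
      rcases List.mem_cons.1 hp with rfl | hp
      · refine ⟨0, ?_, ?_⟩
        · simp [rv, ev2, ev_nil]
        · simpa [rv, ev2, ev] using hB.lincomb hm v
      · obtain ⟨c, hc, rfl⟩ := List.mem_map.1 hp
        obtain ⟨i, hi, rfl⟩ := List.mem_iff_getElem.1 hc
        have e1 : ev B[i] = ev2 B i := by simp [ev2, hi]
        have h1 := hB.lincomb hm B[i]
        have e2 : ∀ P, (rv (lincomb m B[i] B, [[], P])).2 0 0 = 0 := fun P => by
          simp [rv, ev2, ev]
        have e3 : (rv (lincomb m B[i] B, [[], B[i]])).2 1 = ev B[i] := rfl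
        rcases lt_or_ge i r with hir | hir
        · refine ⟨b ⟨i, hir⟩, ?_, ?_⟩
          · rw [e3, e1]
            exact hB.col ⟨i, hir⟩
          · rw [e2, zero_smul, add_zero]
            have h2 := map_mem_multiples φ (hB.col ⟨i, hir⟩)
            rw [map_sub] at h2
            rw [e1] at h1
            simpa [rv] using add_mem h1 h2
        · have h3 : vecL b (ev B[i]) ∈ multiples m L :=
            (vecL_mem_multiples_iff b _).2 fun j _ => by rw [e1]; exact hB.dvd i hir j
          refine ⟨0, ?_, ?_⟩
          · rw [e3]
            simpa using h3
          · rw [e2, zero_smul, map_zero, map_zero, add_zero, sub_zero]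
            simpa [rv] using add_mem h1 (map_mem_multiples φ h3)
    | zero => exact ⟨0, by simp, by simp⟩
    | add x y _ _ hx hy => exact hadd x y hx hy
    | smul c x _ hx =>
      obtain ⟨w, hw1, hw2⟩ := hx
      refine ⟨c • w, ?_, ?_⟩
      · convert Submodule.smul_mem _ c hw1 using 1
        simp only [Prod.smul_snd, Pi.smul_apply, map_smul, smul_sub]
      · convert Submodule.smul_mem _ c hw2 using 1
        simp only [Prod.smul_snd, Prod.smul_fst, Pi.smul_apply, map_smul, smul_sub, smul_add,
          smul_eq_mul, mul_smul]
  -- the linear equation has a solution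
  have hcomplete : ∃ u ∈ rowMod m rows2, u.1 0 = 1 := by
    obtain ⟨w, hw⟩ := hw
    have hcol : ∀ i : Fin r, ∃ u ∈ rowMod m rows, u.2 0 0 = 0 ∧
        vecL b u.1 - φ (φ (b i)) ∈ multiples m L := by
      intro i
      have h2 := map_mem_multiples φ (hB.col i)
      rw [map_sub] at h2
      rcases lt_or_ge (i : ℕ) B.length with hi | hi
      · refine ⟨rv (lincomb m B[(i : ℕ)] B, [[], B[(i : ℕ)]]), Submodule.mem_sup_left
          (Submodule.subset_span ⟨_, List.mem_cons_of_mem _ (List.mem_map.2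
            ⟨B[(i : ℕ)], List.getElem_mem hi, rfl⟩), rfl⟩), by simp [rv, ev2, ev], ?_⟩
        have e1 : ev B[(i : ℕ)] = ev2 B i := by simp [ev2, hi]
        have h1 := hB.lincomb hm B[(i : ℕ)]
        rw [e1] at h1
        simpa [rv] using add_mem h1 h2
      · refine ⟨0, zero_mem _, rfl, ?_⟩
        rw [ev2_of_le hi, map_zero, map_zero] at h2
        simpa using h2
    choose u hu hu0 huv using hcol
    set y : RowSpace := rv (lincomb m v B, [[1], []]) + ∑ i, b.repr w i • u i with hy
    have hymem : y ∈ rowMod m rows := by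
      refine add_mem (Submodule.mem_sup_left (Submodule.subset_span ⟨_, List.mem_cons_self, rfl⟩))
        (sum_mem fun i _ => Submodule.smul_mem _ _ (hu i))
    have hy0 : y.2 0 0 = 1 := by
      have : (rv (lincomb m v B, [[1], []])).2 0 0 = 1 := rfl
      simp [hy, Prod.snd_sum, hu0, this]
    have hyv : vecL b y.1 ∈ multiples m L := by
      have e1 : vecL b y.1 - (φ (vecL b (ev v)) + φ (φ w)) ∈ multiples m L := by
        have e2 : φ (φ w) = ∑ i, b.repr w i • φ (φ (b i)) := by
          conv_lhs => rw [← b.sum_repr w]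
          simp only [map_sum, map_smul]
        have e3 : y.1 = ev (lincomb m v B) + ∑ i, b.repr w i • (u i).1 := by
          simp [hy, Prod.fst_sum, rv]
        rw [e2, e3, map_add, map_sum, add_sub_add_comm, ← Finset.sum_sub_distrib]
        refine add_mem (hB.lincomb hm v) (sum_mem fun i _ => ?_)
        rw [map_smul, ← smul_sub]
        exact Submodule.smul_mem _ _ (huv i)
      have := add_mem e1 hw
      rwa [add_comm (φ (vecL b (ev v))), sub_add_cancel] at this
    obtain ⟨t, ht0⟩ := exists_sub_smul hyv
    obtain ⟨x, hx, hx2⟩ := (exists_mem_elimCols hm tmpl rows y.2).2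
      ⟨y - m • ((t, 0) : RowSpace), sub_mem hymem
        (Submodule.mem_sup_right (smul_mem_multiples _ _)),
        fun j hj => by simpa using ht0 j (by omega), by simp⟩
    refine ⟨τ x, ?_, by simp [τ, hx2, hy0]⟩
    obtain ⟨s, hs, z, hz, rfl⟩ := Submodule.mem_sup.1 hx
    rw [map_add]
    refine add_mem (Submodule.mem_sup_left ?_) (Submodule.mem_sup_right (map_mem_multiples τ hz))
    rw [hτ]
    exact ⟨s, hs, rfl⟩
  obtain ⟨-, h2, h3, h4⟩ := elimCol_spec hm rows2
  obtain ⟨u, hu, hu1⟩ := hcomplete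
  have h5 : (elimCol m rows2).1.hd = 1 := by
    have := h4 u hu
    rw [hu1] at this
    exact Int.eq_one_of_dvd_one h3.le this
  have h6 : ev (solve m tmpl B v) = (rv (elimCol m rows2).1).2 0 := by
    change ev ((elimCol m rows2).1.2.headD []) = ev2 (elimCol m rows2).1.2 0
    cases (elimCol m rows2).1.2 <;> rfl
  rw [h6]
  rw [hd_eq] at h5
  obtain ⟨s, hs, z, hz, hsz⟩ := Submodule.mem_sup.1 h2
  rw [hτ] at hs
  obtain ⟨s, hs, rfl⟩ := hs
  obtain ⟨y, hy, hy0, hy2⟩ := (exists_mem_elimCols hm tmpl rows s.2).1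
    ⟨s, Submodule.mem_sup_left hs, rfl⟩
  obtain ⟨w, hw1, hw2⟩ := hsound y hy
  have hyv : vecL b y.1 = 0 := by
    rw [vecL_apply]
    exact Finset.sum_eq_zero fun j _ => by rw [hy0 j (by rw [ht]; exact j.2), zero_smul]
  obtain ⟨z, rfl⟩ := hz
  rw [← hsz] at h5
  have h7 : s.2 0 0 = 1 - m * z.1 0 := by
    have e : s.2 0 0 + m * z.1 0 = 1 := h5
    omega
  refine ⟨w, ?_, ?_⟩
  · have e : (rv (elimCol m rows2).1).2 0 = y.2 1 + m • z.2 0 := by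
      rw [← hsz, hy2]
      rfl
    rw [e, map_add, map_smul, add_sub_right_comm]
    exact add_mem hw1 (smul_mem_multiples _ _)
  · rw [hyv, zero_sub, hy2, h7, sub_smul, one_smul, mul_smul] at hw2
    have := sub_mem (neg_mem hw2) (smul_mem_multiples m (-(z.1 0 • φ (vecL b (ev v)))))
    convert this using 1
    rw [smul_neg]
    abel

end

end BitCost

namespace BitCost

/-! ### Generators of cyclic modules modulo `m` -/

section

variable (R : Type*) {L : Type*} [CommRing R] [AddCommGroup L] [Module R L]

/-- `L / m L` is generated by the class of `e`. -/
def GenMod (m : ℤ) (e : L) : Prop := ∀ v : L, ∃ (ρ : R) (z : L), ρ • e + m • z = v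

variable {R}

theorem zsmul_mem_of_multiples {m : ℤ} {N : Submodule R L} (hN : ∀ z : L, m • z ∈ N) {v : L}
    (hv : v ∈ multiples m L) : v ∈ N := by
  obtain ⟨z, rfl⟩ := hv
  exact hN z

/-- `L/N` is simple and `R` is commutative, so `a` acts on it as zero or injectively. The preimage
of `N` under `a` contains `N`, hence it is `N` or everything. -/
theorem coatom_dichotomy {N : Submodule R L} (hN : IsCoatom N) (a : R) :
    (∀ v, a • v ∈ N) ∨ ∀ v, a • v ∈ N → v ∈ N := by
  have hle : N ≤ N.comap (LinearMap.lsmul R L a) := fun v hv => N.smul_mem a hv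
  rcases hN.le_iff.1 hle with h | h
  · left
    intro v
    have : v ∈ N.comap (LinearMap.lsmul R L a) := h ▸ Submodule.mem_top
    exact this
  · right
    intro v hv
    rw [← h]
    exact hv

/-- By finite generation a proper submodule lies in a maximal one. Maximal submodules occur only in
the proof; the algorithm never computes them, and so it need not factor `m`. -/
theorem genMod_of_forall_coatom [Module.Finite R L] {m : ℤ} {e : L}
    (h : ∀ N : Submodule R L, IsCoatom N → (∀ z : L, m • z ∈ N) → e ∉ N) : GenMod R m e := by
  set M : Submodule R L := Submodule.span R {e} ⊔ LinearMap.range (LinearMap.lsmul R L (m : R))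
    with hM
  have hm : ∀ z : L, m • z ∈ M := fun z =>
    Submodule.mem_sup_right ⟨z, by simp [Int.cast_smul_eq_zsmul]⟩
  rcases eq_top_or_exists_le_coatom M with ht | ⟨N, hN, hle⟩
  · intro v
    have hv : v ∈ M := ht ▸ Submodule.mem_top
    obtain ⟨x, hx, y, ⟨z, rfl⟩, rfl⟩ := Submodule.mem_sup.1 hv
    obtain ⟨ρ, rfl⟩ := Submodule.mem_span_singleton.1 hx
    exact ⟨ρ, z, by simp [Int.cast_smul_eq_zsmul]⟩
  · exact absurd (hle (Submodule.mem_sup_left (Submodule.mem_span_singleton_self e)))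
      (h N hN fun z => hle (hm z))

/-- A property that one list entry establishes and that no entry destroys holds at the end. -/
theorem foldl_of_mem {α σ : Type*} {P : σ → Prop} {step : σ → α → σ} {l : List α} {a : α}
    (ha : a ∈ l) (hstep : ∀ s, ∀ x ∈ l, P s → P (step s x)) (hest : ∀ s, P (step s a)) (s : σ) :
    P (l.foldl step s) := by
  obtain ⟨l₁, l₂, rfl⟩ := List.append_of_mem ha
  rw [List.foldl_append, List.foldl_cons]
  have : ∀ (l : List α) (s : σ), (∀ x ∈ l, ∀ s, P s → P (step s x)) → P s →
      P (l.foldl step s) := by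
    intro l
    induction l with
    | nil => exact fun s _ h => h
    | cons x l ih =>
      exact fun s h hs => ih _ (fun y hy => h y (List.mem_cons_of_mem _ hy))
        (h x List.mem_cons_self s hs)
  exact this _ _ (fun x hx s hs => hstep s x (by simp [hx]) hs) (hest _)

variable {r : ℕ} {b : Module.Basis (Fin r) ℤ L} {m : ℤ}

theorem lsmul_pow_apply (α : R) (k : ℕ) (v : L) :
    ((Algebra.lsmul ℤ ℤ L α) ^ k) v = α ^ k • v := by
  rw [← map_pow]
  rfl

theorem pow_smul_mem {N : Submodule R L} {α : R} (h : ∀ v, α • v ∈ N → v ∈ N) :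
    ∀ (k : ℕ) (v : L), α ^ k • v ∈ N → v ∈ N := by
  intro k
  induction k with
  | zero => intro v hv; simpa using hv
  | succ k ih =>
    intro v hv
    rw [pow_succ, mul_smul] at hv
    exact h _ (ih _ hv)

theorem vecL_ev_comb (hm : 0 < m) (q : ℤ) (p x : List ℤ) :
    vecL b (ev (comb m q p x)) - (vecL b (ev p) - q • vecL b (ev x)) ∈ multiples m L := by
  rw [← map_smul, ← map_sub]
  refine vecL_sub_mem b fun i => ?_
  rw [ev_comb, red_of_pos hm, Int.emod_def]
  exact ⟨-((ev p i - q * ev x i) / m), by simp⟩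

/-- The new vector is `g - p`, where `p` is `ρ ^ k w` modulo `m`. If `ρ` kills `L/N`, then `p ∈ N`
and the class of `g` is kept. Otherwise `ρ` is injective on `L/N`, so `ρ ^ k (ρ ^ k w + (x - g)) ∈
N` yields `p ≡ g - x`, and the new vector is congruent to `x`. In this case `x ∉ N`, for otherwise
`hx` would give `ρ L ⊆ N`. -/
theorem update_spec {α : Type*} (hm : 0 < m) {tmpl : List α} (ht : tmpl.length = r)
    {a : List (List ℤ)} {ρ : R} (ha : Rep b m a (Algebra.lsmul ℤ ℤ L ρ)) {N : Submodule R L}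
    (hN : IsCoatom N) (hmN : ∀ z : L, m • z ∈ N) (x g : List ℤ)
    (hx : ∀ v : L, ∃ c : R, ρ • v - c • vecL b (ev x) ∈ N) :
    (vecL b (ev g) ∉ N → vecL b (ev (update m tmpl x g a)) ∉ N) ∧
      ((∃ v, ρ • v ∉ N) → vecL b (ev (update m tmpl x g a)) ∉ N) := by
  set k := 2 ^ (tmpl.length * Nat.size m.natAbs) with hk
  have hk1 : k ≠ 0 := by positivity
  have hkm : m.natAbs ^ r ≤ k := by
    rw [hk, ht, mul_comm, pow_mul]
    exact Nat.pow_le_pow_left (Nat.lt_size_self _).le _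
  -- Here `comb m 1 x g` is `x - g` modulo `m`, the change that is wanted wherever `ρ` is
  -- invertible.
  obtain ⟨w, hw1, hw2⟩ := solve_spec hm ht (ha.highPow hm tmpl) (comb m 1 x g)
    (exists_fitting b hm _ hkm _)
  rw [← hk] at hw1 hw2
  simp only [lsmul_pow_apply] at hw1 hw2
  set p := solve m tmpl (highPow m tmpl a) (comb m 1 x g) with hp
  have hv := zsmul_mem_of_multiples hmN (vecL_ev_comb (b := b) hm 1 x g)
  have hg := zsmul_mem_of_multiples hmN (vecL_ev_comb (b := b) hm 1 g p)
  have hw1 := zsmul_mem_of_multiples hmN hw1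
  have hw2 := zsmul_mem_of_multiples hmN hw2
  rw [one_smul] at hv hg
  have hu : update m tmpl x g a = comb m 1 g p := rfl
  rw [hu]
  rcases coatom_dichotomy hN ρ with h | h
  · refine ⟨fun hgN hN' => hgN ?_, fun ⟨v, hv⟩ => absurd (h v) hv⟩
    have h1 : ρ ^ k • w ∈ N := by
      obtain ⟨j, hj⟩ := Nat.exists_eq_succ_of_ne_zero hk1
      rw [hj, pow_succ', mul_smul]
      exact h _
    have h2 := N.add_mem hw1 h1
    rw [sub_add_cancel] at h2
    have h3 := N.add_mem (N.sub_mem hN' hg) h2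
    convert h3 using 1
    abel
  · have h0 : vecL b (ev x) ∉ N := by
      intro hxN
      refine hN.1 (eq_top_iff.2 fun v _ => h v ?_)
      obtain ⟨c, hc⟩ := hx v
      have := N.add_mem hc (N.smul_mem c hxN)
      rwa [sub_add_cancel] at this
    have h1 : vecL b (ev (comb m 1 g p)) ∉ N := by
      intro hN'
      apply h0
      rw [← smul_add] at hw2
      have h2 := pow_smul_mem h k _ hw2
      have h3 := N.sub_mem (N.sub_mem (N.add_mem (N.add_mem h2 hw1) hN') hg) hv
      convert h3 using 1
      abel
    exact ⟨fun _ => h1, fun _ => h1⟩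

variable (R) in
/-- The elements of `R` that are represented by matrices. -/
def repMod (b : Module.Basis (Fin r) ℤ L) (m : ℤ) : Submodule ℤ (ℕ → ℕ → ℤ) where
  carrier := {P | ∃ ρ : R, (∀ i : Fin r, vecL b (P i) - ρ • b i ∈ multiples m L) ∧
    ∀ i, r ≤ i → ∀ j, m ∣ P i j}
  zero_mem' := ⟨0, by simp, by simp⟩
  add_mem' := by
    rintro P Q ⟨ρ, h1, h2⟩ ⟨τ, h3, h4⟩
    refine ⟨ρ + τ, fun i => ?_, fun i hi j => dvd_add (h2 i hi j) (h4 i hi j)⟩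
    have := add_mem (h1 i) (h3 i)
    rwa [← add_sub_add_comm, ← add_smul, ← map_add] at this
  smul_mem' := by
    rintro c P ⟨ρ, h1, h2⟩
    refine ⟨c • ρ, fun i => ?_, fun i hi j => Dvd.dvd.mul_left (h2 i hi j) c⟩
    rw [Pi.smul_apply, map_smul, smul_assoc, ← smul_sub]
    exact Submodule.smul_mem _ _ (h1 i)

theorem rep_of_mem_repMod {C : List (List ℤ)} (h : ev2 C ∈ repMod R b m) :
    ∃ ρ : R, Rep b m C (Algebra.lsmul ℤ ℤ L ρ) := by
  obtain ⟨ρ, h1, h2⟩ := h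
  exact ⟨ρ, h1, h2⟩

theorem matMod_le_repMod {As : List (List (List ℤ))}
    (hA : ∀ A ∈ As, ∃ ρ : R, Rep b m A (Algebra.lsmul ℤ ℤ L ρ)) :
    matMod m As ≤ repMod R b m := by
  refine sup_le (Submodule.span_le.2 ?_) ?_
  · rintro _ ⟨A, hAs, rfl⟩
    obtain ⟨ρ, h⟩ := hA A hAs
    exact ⟨ρ, h.col, h.dvd⟩
  · rintro _ ⟨P, rfl⟩
    refine ⟨0, fun i => ?_, fun i _ j => ⟨P i j, rfl⟩⟩
    rw [zero_smul, sub_zero]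
    exact map_mem_multiples ((vecL b).comp (LinearMap.proj (i : ℕ))) (smul_mem_multiples m P)

theorem exists_mem_matMod {As : List (List (List ℤ))}
    (hspan : Submodule.span ℤ {ρ : R | ∃ A ∈ As, Rep b m A (Algebra.lsmul ℤ ℤ L ρ)} = ⊤) (ρ : R) :
    ∃ P ∈ matMod m As, ∀ i : Fin r, vecL b (P i) - ρ • b i ∈ multiples m L := by
  have hρ : ρ ∈ Submodule.span ℤ {ρ : R | ∃ A ∈ As, Rep b m A (Algebra.lsmul ℤ ℤ L ρ)} :=
    hspan ▸ Submodule.mem_top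
  induction hρ using Submodule.span_induction with
  | mem ρ h =>
    obtain ⟨A, hA, h⟩ := h
    exact ⟨ev2 A, Submodule.mem_sup_left (Submodule.subset_span ⟨A, hA, rfl⟩), h.col⟩
  | zero => exact ⟨0, zero_mem _, by simp⟩
  | add ρ τ _ _ h h' =>
    obtain ⟨P, hP, h1⟩ := h
    obtain ⟨Q, hQ, h2⟩ := h'
    refine ⟨P + Q, add_mem hP hQ, fun i => ?_⟩
    have := add_mem (h1 i) (h2 i)
    rwa [← add_sub_add_comm, ← add_smul, ← map_add] at this
  | smul c ρ _ h =>
    obtain ⟨P, hP, h1⟩ := h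
    refine ⟨c • P, Submodule.smul_mem _ _ hP, fun i => ?_⟩
    rw [Pi.smul_apply, map_smul, smul_assoc, ← smul_sub]
    exact Submodule.smul_mem _ _ (h1 i)

/-- The matrices in `As` represent a spanning set of `R`, so the vectors that they make out of `x`
generate `Rx` modulo `m`. -/
theorem mem_vecMod_orbit {As : List (List (List ℤ))} (hm : 0 < m)
    (hA : ∀ A ∈ As, ∃ ρ : R, Rep b m A (Algebra.lsmul ℤ ℤ L ρ))
    (hspan : Submodule.span ℤ {ρ : R | ∃ A ∈ As, Rep b m A (Algebra.lsmul ℤ ℤ L ρ)} = ⊤)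
    (x : List ℤ) (v : L) :
    v ∈ vecMod b m (As.map fun A => lincomb m x A) ↔
      ∃ (ρ : R) (z : L), ρ • vecL b (ev x) + m • z = v := by
  constructor
  · intro hv
    obtain ⟨s, hs, _, ⟨z, rfl⟩, rfl⟩ := Submodule.mem_sup.1 hv
    suffices h : ∃ (ρ : R) (z : L), ρ • vecL b (ev x) + m • z = s by
      obtain ⟨ρ, z', rfl⟩ := h
      exact ⟨ρ, z' + z, by simp [smul_add, add_assoc]⟩
    clear hv
    induction hs using Submodule.span_induction with
    | mem s hs =>
      obtain ⟨o, ho, rfl⟩ := hs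
      obtain ⟨A, hAs, rfl⟩ := List.mem_map.1 ho
      obtain ⟨ρ, h⟩ := hA A hAs
      obtain ⟨z, hz⟩ := h.lincomb hm x
      exact ⟨ρ, z, by
        have : m • z = vecL b (ev (lincomb m x A)) - ρ • vecL b (ev x) := hz
        rw [this, add_sub_cancel]⟩
    | zero => exact ⟨0, 0, by simp⟩
    | add s t _ _ h h' =>
      obtain ⟨ρ, z, rfl⟩ := h
      obtain ⟨τ, y, rfl⟩ := h'
      exact ⟨ρ + τ, z + y, by rw [add_smul, smul_add]; abel⟩
    | smul c s _ h =>
      obtain ⟨ρ, z, rfl⟩ := h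
      exact ⟨c • ρ, c • z, by rw [smul_add, smul_assoc, smul_comm m c]⟩
  · rintro ⟨ρ, z, rfl⟩
    refine add_mem ?_ (Submodule.mem_sup_right (smul_mem_multiples _ _))
    have hρ : ρ ∈ Submodule.span ℤ {ρ : R | ∃ A ∈ As, Rep b m A (Algebra.lsmul ℤ ℤ L ρ)} :=
      hspan ▸ Submodule.mem_top
    induction hρ using Submodule.span_induction with
    | mem ρ h =>
      obtain ⟨A, hA, h⟩ := h
      have h1 := h.lincomb hm x
      rw [← sub_sub_cancel (vecL b (ev (lincomb m x A))) (ρ • vecL b (ev x))]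
      exact sub_mem (Submodule.mem_sup_left (Submodule.subset_span
        ⟨_, List.mem_map_of_mem hA, rfl⟩)) (Submodule.mem_sup_right h1)
    | zero => rw [zero_smul]; exact zero_mem _
    | add ρ τ _ _ h h' => rw [add_smul]; exact add_mem h h'
    | smul c ρ _ h => rw [smul_assoc]; exact Submodule.smul_mem _ _ h

theorem spans_eq_one_iff_genMod {α : Type*} {tmpl : List α} (ht : tmpl.length = r)
    {As : List (List (List ℤ))} (hm : 0 < m)
    (hA : ∀ A ∈ As, ∃ ρ : R, Rep b m A (Algebra.lsmul ℤ ℤ L ρ))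
    (hspan : Submodule.span ℤ {ρ : R | ∃ A ∈ As, Rep b m A (Algebra.lsmul ℤ ℤ L ρ)} = ⊤)
    (g : List ℤ) :
    spans m tmpl (As.map fun A => ((lincomb m g A, []) : Row)) = 1 ↔
      GenMod R m (vecL b (ev g)) := by
  have e : vecMod b m (As.map fun A => lincomb m g A) =
      (rowMod m (As.map fun A => ((lincomb m g A, []) : Row))).map
        ((vecL b).comp (LinearMap.fst ℤ _ _)) ⊔ multiples m L := by
    rw [rowMod, Submodule.map_sup, rowSpan, Submodule.map_span, sup_assoc, vecMod]
    congr 1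
    · congr 1
      ext v
      constructor
      · rintro ⟨o, ho, rfl⟩
        obtain ⟨A, hA, rfl⟩ := List.mem_map.1 ho
        exact ⟨_, ⟨_, List.mem_map_of_mem hA, rfl⟩, rfl⟩
      · rintro ⟨_, ⟨p, hp, rfl⟩, rfl⟩
        obtain ⟨A, hA, rfl⟩ := List.mem_map.1 hp
        exact ⟨_, List.mem_map_of_mem hA, rfl⟩
    · refine (sup_eq_right.2 ?_).symm
      rintro _ ⟨z, hz, rfl⟩
      exact map_mem_multiples _ hz
  rw [spans_eq_one_iff hm, ht]
  constructor
  · intro h v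
    rw [← mem_vecMod_orbit (As := As) hm hA hspan, e]
    obtain ⟨f, rfl⟩ := exists_vecL b v
    obtain ⟨u, hu, hf⟩ := h f
    refine Submodule.mem_sup_left ⟨u, hu, ?_⟩
    change vecL b u.1 = _
    rw [vecL_apply, vecL_apply]
    exact Finset.sum_congr rfl fun i _ => by rw [hf i i.2]
  · intro h f
    have hf := (mem_vecMod_orbit (As := As) hm hA hspan g (vecL b f)).2 (h _)
    rw [e] at hf
    obtain ⟨_, ⟨u, hu, rfl⟩, _, ⟨z, rfl⟩, hz⟩ := Submodule.mem_sup.1 hf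
    obtain ⟨t, rfl⟩ := exists_vecL b z
    refine ⟨u + m • ((t, 0) : RowSpace),
      add_mem hu (Submodule.mem_sup_right (smul_mem_multiples _ _)), fun i hi => ?_⟩
    have h1 : vecL b (u.1 + m • t) = vecL b f := by
      rw [← hz, map_add, map_smul]
      rfl
    have h2 := congrArg (fun x => b.repr x ⟨i, hi⟩) h1
    simp only [repr_vecL] at h2
    exact h2

/-- Fix a maximal submodule `N` containing `mL`. Some basis vector `b i` lies outside `N`; write `b
i ≡ ρ w` with a generator `w`. For `v ≡ τ w` one has `ρ v ≡ τ (b i)`, so `ρ` belongs to the ideal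
attached to `b i`; and `ρ` does not kill `L/N`, since `ρ w` is outside `N`. Hence some generator of
this ideal does not kill `L/N` either. Its update moves `g` out of `N`, and no later update brings
it back. -/
theorem genMod_generator [Module.Finite R L] {α : Type*} {tmpl : List α} (ht : tmpl.length = r)
    {As : List (List (List ℤ))} (hm : 0 < m)
    (hA : ∀ A ∈ As, ∃ ρ : R, Rep b m A (Algebra.lsmul ℤ ℤ L ρ))
    (hspan : Submodule.span ℤ {ρ : R | ∃ A ∈ As, Rep b m A (Algebra.lsmul ℤ ℤ L ρ)} = ⊤)
    (hex : ∃ w : L, GenMod R m w) :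
    GenMod R m (vecL b (ev (generator m tmpl (units tmpl) As))) := by
  obtain ⟨w, hw⟩ := hex
  refine genMod_of_forall_coatom fun N hN hmN => ?_
  -- properties of the generators of the ideals
  have hgen : ∀ x, ∀ a ∈ idealGens m tmpl (units tmpl) As x,
      ∃ ρ : R, Rep b m a (Algebra.lsmul ℤ ℤ L ρ) ∧
        ∀ v : L, ∃ c : R, ρ • v - c • vecL b (ev x) ∈ N := by
    intro x a ha
    have h1 : ev2 a ∈ matMod m (idealGens m tmpl (units tmpl) As x) :=
      Submodule.mem_sup_left (Submodule.subset_span ⟨a, ha, rfl⟩)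
    rw [mem_matMod_idealGens (b := b) hm ht] at h1
    obtain ⟨ρ, hρ⟩ := rep_of_mem_repMod (matMod_le_repMod hA h1.1)
    refine ⟨ρ, hρ, fun v => ?_⟩
    have h2 : ∀ i, ∃ c : R, ρ • b i - c • vecL b (ev x) ∈ N := by
      intro i
      obtain ⟨c, z, hc⟩ := (mem_vecMod_orbit hm hA hspan x _).1 (h1.2 i i.2)
      refine ⟨c, ?_⟩
      have h3 : vecL b (ev2 a i) - ρ • b i ∈ N := zsmul_mem_of_multiples hmN (hρ.col i)
      have h4 := N.sub_mem (hmN z) h3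
      rw [← hc] at h4
      convert h4 using 1
      abel
    choose c hc using h2
    refine ⟨∑ i, b.repr v i • c i, ?_⟩
    conv => enter [2, 1]; rw [← b.sum_repr v]
    rw [Finset.smul_sum, Finset.sum_smul, ← Finset.sum_sub_distrib]
    refine N.sum_mem fun i _ => ?_
    rw [smul_comm, smul_assoc, ← smul_sub]
    exact N.toAddSubgroup.zsmul_mem (hc i) _
  have hpres : ∀ x g, vecL b (ev g) ∉ N →
      vecL b (ev (improve m tmpl (units tmpl) As g x)) ∉ N := by
    intro x g hg
    refine foldl_induction (Q := fun g => vecL b (ev g) ∉ N) hg fun g a ha hg => ?_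
    obtain ⟨ρ, hρ, hx⟩ := hgen x a ha
    exact (update_spec hm ht hρ hN hmN x g hx).1 hg
  obtain ⟨i, hi⟩ : ∃ i, b i ∉ N := by
    by_contra! h
    refine hN.1 (eq_top_iff.2 fun v _ => ?_)
    rw [← b.sum_repr v]
    exact N.sum_mem fun i _ => N.toAddSubgroup.zsmul_mem (h i) _
  have hx : vecL b (ev (unitVec i)) = b i := by rw [ev_unitVec, vecL_single]
  refine foldl_of_mem (P := fun g => vecL b (ev g) ∉ N) (a := unitVec i) ?_
    (fun g x _ hg => hpres x g hg) (fun g => ?_) []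
  · rw [units_eq, ht]
    exact List.mem_map_of_mem (List.mem_range.2 i.2)
  obtain ⟨ρ, z, hρ⟩ := hw (b i)
  -- some generator of the ideal is invertible at `N`
  obtain ⟨a, ha, hna⟩ : ∃ a ∈ idealGens m tmpl (units tmpl) As (unitVec i),
      ∃ j : Fin r, vecL b (ev2 a j) ∉ N := by
    -- If all columns of all generators were in `N`, the same would hold for every matrix in their
    -- module, in particular for one that represents `ρ`; then `b i ≡ ρ w` would lie in `N`.
    by_contra! hall
    obtain ⟨P, hP, hPρ⟩ := exists_mem_matMod hspan ρ
    have hP' : P ∈ matMod m (idealGens m tmpl (units tmpl) As (unitVec i)) := by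
      rw [mem_matMod_idealGens (b := b) hm ht]
      refine ⟨hP, fun j hj => ?_⟩
      obtain ⟨τ, y, hτ⟩ := hw (b ⟨j, hj⟩)
      obtain ⟨y', hy'⟩ := hPρ ⟨j, hj⟩
      rw [mem_vecMod_orbit hm hA hspan, hx]
      refine ⟨τ, y' + ρ • y - τ • z, ?_⟩
      have hy'' : m • y' = vecL b (P j) - ρ • b ⟨j, hj⟩ := hy'
      rw [smul_sub, smul_add, hy'', ← hρ, ← hτ, smul_add, smul_add, smul_comm ρ m, smul_comm τ m,
        smul_smul, smul_smul, mul_comm]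
      abel
    have hPN : ∀ j : Fin r, vecL b (P j) ∈ N := by
      intro j
      obtain ⟨s, hs, _, ⟨y, rfl⟩, rfl⟩ := Submodule.mem_sup.1 hP'
      have h1 : vecL b (s j) ∈ N := by
        clear hP' hP hPρ
        induction hs using Submodule.span_induction with
        | mem s hs =>
          obtain ⟨a, ha, rfl⟩ := hs
          exact hall a ha j
        | zero => simp
        | add s t _ _ h h' => rw [Pi.add_apply, map_add]; exact N.add_mem h h'
        | smul c s _ h =>
          rw [Pi.smul_apply, map_smul]
          exact N.toAddSubgroup.zsmul_mem h _
      have h2 : vecL b ((s + m • y) j) = vecL b (s j) + m • vecL b (y j) := by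
        rw [Pi.add_apply, map_add, Pi.smul_apply, map_smul]
      exact h2 ▸ N.add_mem h1 (hmN _)
    have hρN : ∀ v : L, ρ • v ∈ N := by
      intro v
      rw [← b.sum_repr v, Finset.smul_sum]
      refine N.sum_mem fun j _ => ?_
      rw [smul_comm]
      refine N.toAddSubgroup.zsmul_mem ?_ _
      have := N.sub_mem (hPN j) (zsmul_mem_of_multiples hmN (hPρ j))
      rwa [sub_sub_cancel] at this
    apply hi
    rw [← hρ]
    exact N.add_mem (hρN w) (hmN z)
  refine foldl_of_mem (P := fun g => vecL b (ev g) ∉ N) ha (fun g a ha hg => ?_) (fun g => ?_) g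
  · obtain ⟨τ, hτ, hxτ⟩ := hgen _ a ha
    exact (update_spec hm ht hτ hN hmN _ g hxτ).1 hg
  · obtain ⟨τ, hτ, hxτ⟩ := hgen _ a ha
    refine (update_spec hm ht hτ hN hmN _ g hxτ).2 ?_
    obtain ⟨j, hj⟩ := hna
    refine ⟨b j, fun h => hj ?_⟩
    have h3 : vecL b (ev2 a j) - τ • b j ∈ N := zsmul_mem_of_multiples hmN (hτ.col j)
    have := N.add_mem h3 h
    rwa [sub_add_cancel] at this

end

end BitCost

namespace BitCost

/-! ### Encoded inputs -/

theorem PF.exists_solves {α β ι : Type*} [Enc α] [Enc β] {f : α → β} (hf : PF f)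
    {inp : ι → Data} {R : ι → Data → Prop} (raw : ι → α) (hraw : ∀ i, inp i = enc (raw i))
    (hR : ∀ i, R i (enc (f (raw i)))) : ∃ p, SolvesInPolyTime p inp R := by
  obtain ⟨p, T, hp, P, hP⟩ := hf
  exact ⟨p, P, fun i => ⟨_, _, hraw i ▸ hp (raw i), hraw i ▸ hP (raw i), hR i⟩⟩

/-- The list of the rows of a matrix. -/
def rowList {k l : ℕ} (M : Matrix (Fin k) (Fin l) ℤ) : List (List ℤ) :=
  List.ofFn fun i => List.ofFn (M i)

theorem enc_ofFn {α : Type*} [Enc α] {k : ℕ} (f : Fin k → α) :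
    enc (List.ofFn f) = Data.list (List.ofFn fun i => enc (f i)) := by
  change Data.list ((List.ofFn f).map enc) = _
  rw [List.map_ofFn]
  rfl

theorem enc_rowList {k l : ℕ} (M : Matrix (Fin k) (Fin l) ℤ) :
    enc (rowList M) = Data.matrix M := by
  rw [rowList, enc_ofFn]
  simp only [enc_ofFn]
  rfl

theorem len_eq {α : Type*} (l : List α) : len l = l.length := by
  have h : ∀ (l : List α) (s : ℤ), l.foldl (fun s _ => s + 1) s = s + l.length := by
    intro l
    induction l with
    | nil => simp
    | cons a l ih =>
      intro s
      rw [List.foldl_cons, ih, List.length_cons]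
      push_cast
      ring
  rw [len, h, zero_add]

variable (I : GLatticeInput.{v, w})

/-- The matrix of the action of an element of the group. -/
noncomputable def actMatrix (σ : I.G) : Matrix (Fin I.r) (Fin I.r) ℤ :=
  LinearMap.toMatrix I.basis I.basis (I.lat.act σ).toLinearMap

/-- The input, as nested lists. -/
noncomputable def raw : RawInput :=
  (rowList (Matrix.of fun i j : Fin I.N => ((I.enum.symm (I.enum i * I.enum j) : ℕ) : ℤ)),
    ((I.enum.symm I.u : ℕ) : ℤ), rowList (I.lat.gram I.basis),
    -- The last component is the integer `0` by which `Data.list` closes the list of the four parts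
    -- of the input.
    List.ofFn fun i => rowList (actMatrix I (I.enum i)), 0)

theorem enc_raw : I.encode = enc (raw I) := by
  simp only [raw, enc_pair, enc_rowList, enc_ofFn]
  rfl

theorem enc_coords (e : I.L) : I.encodeElt e = enc (List.ofFn fun i => I.basis.repr e i) := by
  rw [enc_ofFn]
  rfl

theorem card_eq : Nat.card I.G = I.N := by
  rw [← Nat.card_congr I.enum, Nat.card_fin]

theorem exists_solvesRank : ∃ p, InvertibilityAlgorithm.SolvesRank.{v, w} p := by
  refine PF.rankFun.exists_solves raw enc_raw fun I => ?_
  have h1 : Module.finrank ℤ I.L = I.r := by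
    rw [Module.finrank_eq_card_basis I.basis, Fintype.card_fin]
  have h2 : len (raw I).2.2.1 = I.r := by simp [len_eq, raw, rowList]
  have h3 : len (raw I).1 = I.N := by simp [len_eq, raw, rowList]
  beta_reduce
  rw [rankFun, h1, h2, h3, card_eq]
  by_cases h : I.r = I.N / 2
  · left
    exact ⟨h, by rw [if_pos (by omega)]; rfl⟩
  · right
    exact ⟨h, by rw [if_neg (by omega)]; rfl⟩

/-! ### The determinant of a lattice -/

section

variable {L : Type*} [AddCommGroup L] (Λ : IntegralLattice L) {r : ℕ}
  (b : Module.Basis (Fin r) ℤ L)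

theorem dotProduct_gram (x : Fin r → ℤ) :
    x ⬝ᵥ (Λ.gram b).mulVec x = Λ.inner (∑ i, x i • b i) (∑ i, x i • b i) := by
  simp only [map_sum, map_smul, LinearMap.sum_apply, LinearMap.smul_apply, dotProduct,
    Matrix.mulVec, IntegralLattice.gram, Matrix.of_apply, smul_eq_mul]
  simp only [Finset.mul_sum]
  rw [Finset.sum_comm]
  refine Finset.sum_congr rfl fun i _ => Finset.sum_congr rfl fun j _ => ?_
  rw [Λ.inner_symm]
  ring

theorem inner_self_nonneg' (x : L) : 0 ≤ Λ.inner x x := by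
  rcases eq_or_ne x 0 with rfl | h
  · simp
  · exact (Λ.inner_pos x h).le

/-- A singular integer matrix has a nonzero integral vector in its kernel, and this would give a
nonzero element of length zero. -/
theorem gram_det_ne_zero : (Λ.gram b).det ≠ 0 := by
  intro h
  obtain ⟨v, hv, hv0⟩ := Matrix.exists_mulVec_eq_zero_iff.2 h
  have h1 := dotProduct_gram Λ b v
  rw [hv0, dotProduct_zero] at h1
  have h2 : ∑ i, v i • b i = 0 := by
    by_contra hne
    exact (Λ.inner_pos _ hne).ne h1
  exact hv (funext fun i => Fintype.linearIndependent_iff.1 b.linearIndependent v h2 i)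

/-- Nonnegativity passes from integral to rational vectors by clearing denominators, and from there
to real vectors by density and continuity. -/
theorem gram_map_posSemidef :
    ((Λ.gram b).map (Int.cast : ℤ → ℝ)).PosSemidef := by
  refine Matrix.posSemidef_iff_dotProduct_mulVec.2 ⟨?_, fun x => ?_⟩
  · ext i j
    simp [IntegralLattice.gram, Λ.inner_symm (b i) (b j)]
  simp only [star_trivial]
  set F : (Fin r → ℝ) → ℝ := fun x => x ⬝ᵥ ((Λ.gram b).map (Int.cast : ℤ → ℝ)).mulVec x with hF
  have hcont : Continuous F := by
    refine Continuous.dotProduct continuous_id ?_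
    exact Continuous.matrix_mulVec continuous_const continuous_id
  have hint : ∀ y : Fin r → ℤ, 0 ≤ F fun i => (y i : ℝ) := by
    intro y
    have h := inner_self_nonneg' Λ (∑ i, y i • b i)
    rw [← dotProduct_gram] at h
    have e : F (fun i => (y i : ℝ)) = ((y ⬝ᵥ (Λ.gram b).mulVec y : ℤ) : ℝ) := by
      simp [hF, dotProduct, Matrix.mulVec]
    rw [e]
    exact_mod_cast h
  have hrat : ∀ y : Fin r → ℚ, 0 ≤ F fun i => (y i : ℝ) := by
    intro y
    obtain ⟨c, hc⟩ := IsLocalization.exist_integer_multiples_of_finite (nonZeroDivisors ℤ) y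
    choose z hz using hc
    have hc0 : ((c : ℤ) : ℝ) ≠ 0 := by exact_mod_cast nonZeroDivisors.coe_ne_zero c
    have h1 : (fun i => (z i : ℝ)) = ((c : ℤ) : ℝ) • fun i => (y i : ℝ) := by
      ext i
      have h2 : (z i : ℚ) = (c : ℤ) * y i := by
        have := hz i
        simpa [Submonoid.smul_def] using this
      have h3 : ((z i : ℚ) : ℝ) = (((c : ℤ) : ℚ) * y i : ℚ) := by rw [h2]
      push_cast at h3
      simpa using h3
    have h2 : F (fun i => (z i : ℝ)) = ((c : ℤ) : ℝ) ^ 2 * F fun i => (y i : ℝ) := by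
      rw [h1]
      simp only [hF, Matrix.mulVec_smul, dotProduct_smul, smul_dotProduct, smul_eq_mul]
      ring
    have h3 := hint z
    rw [h2] at h3
    exact nonneg_of_mul_nonneg_right h3 (by positivity)
  have hdense : DenseRange (Pi.map fun (_ : Fin r) (q : ℚ) => (q : ℝ)) :=
    DenseRange.piMap fun _ => Rat.denseRange_cast
  exact hdense.induction_on (p := fun x => 0 ≤ F x) x (isClosed_le continuous_const hcont) hrat

/-- Semidefiniteness over `ℝ` is enough here, because the determinant is already known not to
vanish. -/
theorem gram_det_pos : 0 < (Λ.gram b).det := by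
  refine lt_of_le_of_ne ?_ (gram_det_ne_zero Λ b).symm
  have h := (gram_map_posSemidef Λ b).det_nonneg
  have e : ((Λ.gram b).map (Int.cast : ℤ → ℝ)).det = ((Λ.gram b).det : ℝ) :=
    (RingHom.map_det (Int.castRingHom ℝ) (Λ.gram b)).symm
  rw [e] at h
  exact_mod_cast h

theorem toMatrix_inner : LinearMap.toMatrix b b.dualBasis Λ.inner = (Λ.gram b).transpose := by
  ext i j
  simp [LinearMap.toMatrix_apply, IntegralLattice.gram]

/-- In terms of a basis and its dual basis the map `L → Hom(L, ℤ)` is the transpose of the Gram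
matrix. It is bijective if and only if the determinant is a unit of `ℤ`, and positivity excludes
`-1`. -/
theorem unimodular_iff_gram_det : Λ.Unimodular ↔ (Λ.gram b).det = 1 := by
  constructor
  · intro h
    have := LinearEquiv.isUnit_det (LinearEquiv.ofBijective Λ.inner h) b b.dualBasis
    have e : LinearMap.toMatrix b b.dualBasis (LinearEquiv.ofBijective Λ.inner h : L →ₗ[ℤ] _) =
      (Λ.gram b).transpose := toMatrix_inner Λ b
    rw [e, Matrix.det_transpose] at this
    rcases Int.isUnit_iff.1 this with h | h
    · exact h
    · have := gram_det_pos Λ b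
      omega
  · intro h
    have h1 : IsUnit (LinearMap.toMatrix b b.dualBasis Λ.inner).det := by
      rw [toMatrix_inner, Matrix.det_transpose, h]
      exact isUnit_one
    exact (LinearEquiv.ofIsUnitDet h1).bijective

end

theorem exists_solvesDet : ∃ p, InvertibilityAlgorithm.SolvesDet.{v, w} p := by
  refine PF.exists_solves (f := fun I : RawInput => absDet I.2.2.1) (by fun_prop) raw enc_raw
    fun I => ?_
  change enc (absDet (rowList (I.lat.gram I.basis))) = _
  rw [rowList, absDet_ofFn, abs_of_pos (gram_det_pos I.lat.toIntegralLattice I.basis)]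
  rfl

/-! ### The action of the group ring -/

section

variable {G : Type*} [CommGroup G] {u : G} {L : Type*} [AddCommGroup L] (Λ : GLattice G u L)

theorem groupRingAct_of (σ : G) (x : L) :
    Λ.groupRingAct (MonoidAlgebra.of ℤ G σ) x = Λ.act σ x := by
  simp [GLattice.groupRingAct]

/-- A `G`-lattice as a module over the group ring. -/
noncomputable abbrev groupRingModule : Module (MonoidAlgebra ℤ G) L :=
  Module.compHom L Λ.groupRingAct.toRingHom

theorem span_range_of (G : Type*) [CommGroup G] :
    Submodule.span ℤ (Set.range (MonoidAlgebra.of ℤ G)) = ⊤ := by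
  refine eq_top_iff.2 fun x _ => ?_
  induction x using MonoidAlgebra.induction_on with
  | of σ => exact Submodule.subset_span ⟨σ, rfl⟩
  | add x y hx hy => exact add_mem (hx trivial) (hy trivial)
  | smul c x hx => exact Submodule.smul_mem _ _ (hx trivial)

theorem range_groupRingAct (e : L) :
    (LinearMap.range ((LinearMap.applyₗ e : Module.End ℤ L →ₗ[ℤ] L) ∘ₗ
      Λ.groupRingAct.toLinearMap)) = Submodule.span ℤ (Set.range fun σ => Λ.act σ e) := by
  rw [LinearMap.range_eq_map, ← span_range_of, Submodule.map_span, ← Set.range_comp]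
  congr 2
  ext σ
  exact groupRingAct_of Λ σ e

/-- The group elements span `ℤ[G]` over `ℤ`, so the subgroup generated by the translates of `e` is
`ℤ[G] e`. From here on the arguments take place over a commutative ring `R`, for which `ℤ[G]` serves
as well as its quotient `ℤ⟨G⟩`. -/
theorem generatesMod_iff (m : ℕ) (e : L) :
    Λ.GeneratesMod m e ↔ @GenMod (MonoidAlgebra ℤ G) L _ _ (groupRingModule Λ) m e := by
  set π : L →+ L ⧸ (nsmulAddMonoidHom m : L →+ L).range := QuotientAddGroup.mk' _ with hπ
  have hker : ∀ v w, π v = π w ↔ ∃ z, v + m • z = w := by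
    intro v w
    rw [hπ, QuotientAddGroup.mk'_apply, QuotientAddGroup.mk'_apply, QuotientAddGroup.eq]
    constructor
    · rintro ⟨z, hz⟩
      exact ⟨z, by
        have : m • z = -v + w := hz
        rw [this]; abel⟩
    · rintro ⟨z, rfl⟩
      exact ⟨z, by simp⟩
  have hcl : AddSubgroup.closure (Set.range fun σ : G => π (Λ.act σ e)) =
      (Submodule.span ℤ (Set.range fun σ => Λ.act σ e)).toAddSubgroup.map π := by
    rw [Submodule.span_int_eq_addSubgroupClosure, AddMonoidHom.map_closure, ← Set.range_comp]
    rfl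
  have h0 : Λ.GeneratesMod m e ↔
      AddSubgroup.closure (Set.range fun σ : G => π (Λ.act σ e)) = ⊤ := Iff.rfl
  rw [h0, hcl, ← range_groupRingAct]
  constructor
  · intro h v
    have hv : π v ∈ (⊤ : AddSubgroup (L ⧸ (nsmulAddMonoidHom m : L →+ L).range)) := trivial
    rw [← h] at hv
    obtain ⟨_, ⟨ρ, rfl⟩, hx⟩ := hv
    obtain ⟨z, hz⟩ := (hker _ _).1 hx
    exact ⟨ρ, z, by rw [natCast_zsmul]; exact hz⟩
  · intro h
    refine eq_top_iff.2 fun q _ => ?_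
    obtain ⟨v, rfl⟩ := QuotientAddGroup.mk'_surjective _ q
    obtain ⟨ρ, z, hz⟩ := h v
    rw [natCast_zsmul] at hz
    exact ⟨_, ⟨ρ, rfl⟩, (hker _ _).2 ⟨z, hz⟩⟩

end

/-! ### The matrices of the group action, and the second call for generators modulo `m`. -/

theorem ev_map_dot {k l : ℕ} (A : Matrix (Fin k) (Fin l) ℤ) (v : List ℤ) (i : Fin k) :
    ev ((rowList A).map fun row => dot row v) i = ∑ j : Fin l, A i j * ev v j := by
  have h : ev ((rowList A).map fun row => dot row v) i = dot (List.ofFn (A i)) v := by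
    simp [ev, rowList]
  rw [h, dot_eq_sum _ _ (n := l) (by simp), Finset.sum_range]
  simp only [ev_ofFn]

theorem vecL_map_dot (σ : I.G) (v : List ℤ) :
    vecL I.basis (ev ((rowList (actMatrix I σ)).map fun row => dot row v)) =
      I.lat.act σ (vecL I.basis (ev v)) := by
  apply I.basis.repr.injective
  ext i
  rw [repr_vecL, ev_map_dot]
  have h : I.basis.repr (I.lat.act σ (vecL I.basis (ev v))) =
      (actMatrix I σ).mulVec (I.basis.repr (vecL I.basis (ev v))) :=
    (LinearMap.toMatrix_mulVec_repr I.basis I.basis (I.lat.act σ).toLinearMap _).symm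
  rw [h]
  simp only [Matrix.mulVec, dotProduct, repr_vecL]

theorem rep_cols {m : ℤ} (tmpl : List (List ℤ)) (ht : tmpl.length = I.r) (σ : I.G) :
    Rep I.basis m (cols (units tmpl) (rowList (actMatrix I σ))) (I.lat.act σ).toLinearMap := by
  have hl : (units tmpl).length = I.r := by simp [units_eq, ht]
  constructor
  · intro i
    have h1 : ev2 (cols (units tmpl) (rowList (actMatrix I σ))) i =
        ev ((rowList (actMatrix I σ)).map fun row => dot row (unitVec i)) := by
      rw [cols, ev2_map_of_lt (by rw [hl]; exact i.2)]
      simp [units_eq, ht]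
    rw [h1, vecL_map_dot, ev_unitVec, vecL_single]
    simp
  · intro i hi j
    rw [ev2_of_le (by simpa [cols, hl] using hi)]
    simp

theorem exists_solvesCyclic : ∃ p, InvertibilityAlgorithm.SolvesCyclic.{v, w} p := by
  refine PF.cyclicFun.exists_solves (fun i => (raw i.1, (i.2 : ℤ)))
    (fun i => by rw [enc_pair, enc_raw]; rfl) fun ⟨I, m, hm⟩ => ?_
  let _ := groupRingModule I.lat
  have hm' : (0 : ℤ) < m := by exact_mod_cast hm
  set tmpl := (raw I).2.2.1 with htmpl
  have ht : tmpl.length = I.r := by simp [htmpl, raw, rowList]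
  set As := actCols (raw I) with hAs
  have hAs' : As = List.ofFn fun i => cols (units tmpl) (rowList (actMatrix I (I.enum i))) := by
    rw [hAs, actCols, raw, List.map_ofFn]
    rfl
  have hact : ∀ σ : I.G, Algebra.lsmul ℤ ℤ I.L (MonoidAlgebra.of ℤ I.G σ) =
      (I.lat.act σ).toLinearMap := fun σ => LinearMap.ext fun x => groupRingAct_of I.lat σ x
  have hA : ∀ A ∈ As, ∃ ρ : MonoidAlgebra ℤ I.G, Rep I.basis m A (Algebra.lsmul ℤ ℤ I.L ρ) := by
    intro A h
    rw [hAs', List.mem_ofFn] at h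
    obtain ⟨i, rfl⟩ := h
    exact ⟨.of ℤ I.G (I.enum i), by rw [hact]; exact rep_cols I tmpl ht _⟩
  have hspan : Submodule.span ℤ {ρ : MonoidAlgebra ℤ I.G |
      ∃ A ∈ As, Rep I.basis m A (Algebra.lsmul ℤ ℤ I.L ρ)} = ⊤ := by
    rw [eq_top_iff, ← span_range_of]
    refine Submodule.span_mono ?_
    rintro _ ⟨σ, rfl⟩
    refine ⟨cols (units tmpl) (rowList (actMatrix I σ)), ?_, by rw [hact]; exact rep_cols I tmpl ht σ⟩
    rw [hAs', List.mem_ofFn]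
    exact ⟨I.enum.symm σ, by simp⟩
  have := I.lat.fg
  have : Module.Finite (MonoidAlgebra ℤ I.G) I.L := Module.Finite.of_restrictScalars_finite ℤ _ _
  set g := generator (m : ℤ) tmpl (units tmpl) As with hg
  have hspans := spans_eq_one_iff_genMod (b := I.basis) ht hm' hA hspan g
  have hfun : cyclicFun (raw I, (m : ℤ)) =
      if spans (m : ℤ) tmpl (As.map fun A => ((lincomb m g A, []) : Row)) = 1 then [fit tmpl g]
      else [] := rfl
  rw [hfun]
  simp only [generatesMod_iff]
  by_cases h : GenMod (MonoidAlgebra ℤ I.G) (m : ℤ) (vecL I.basis (ev g))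
  · left
    refine ⟨_, h, ?_⟩
    rw [if_pos (hspans.2 h), enc_coords, fit_eq]
    have : (List.ofFn fun i : Fin tmpl.length => ev g i) =
        List.ofFn fun i : Fin I.r => I.basis.repr (vecL I.basis (ev g)) i := by
      simp only [repr_vecL]
      rw [ht]
    rw [this]
    rfl
  · right
    refine ⟨fun hex => h (genMod_generator ht hm' hA hspan hex), ?_⟩
    rw [if_neg fun h1 => h (hspans.1 h1)]
    rfl

end BitCost

namespace BitCost

/-! ### The index of a cyclic submodule -/

theorem zipPad_ofFn {α β δ : Type*} (f : α → β → δ) (g : β → δ) (d : β) {n : ℕ} (a : Fin n → α)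
    (c : Fin n → β) :
    zipPad f g d (List.ofFn a) (List.ofFn c) = List.ofFn fun i => f (a i) (c i) := by
  induction n with
  | zero => simp [zipPad]
  | succ n ih => simp [List.ofFn_succ, zipPad, ih]

theorem nth_natCast {α : Type*} (l : List α) (k : ℕ) (d : α) : nth l k d = l.getD k d := by
  -- Once the counter has passed `0` it remains negative, so the entry found is not overwritten.
  have hneg : ∀ (l : List α) (k : ℤ) (d : α), k < 0 →
      (l.foldl (fun s a => (s.1 - 1, if s.1 = 0 then a else s.2)) (k, d)).2 = d := by
    intro l
    induction l with
    | nil => exact fun k d _ => rfl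
    | cons a l ih =>
      intro k d hk
      rw [List.foldl_cons, ih _ _ (by dsimp only; omega), if_neg hk.ne]
  rw [nth]
  induction l generalizing k with
  | nil => simp
  | cons a l ih =>
    rw [List.foldl_cons]
    cases k with
    | zero => simpa using hneg l (-1) a (by norm_num)
    | succ k =>
      rw [if_neg (by push_cast; omega), List.getD_cons_succ, ← ih]
      push_cast
      rw [add_sub_cancel_right]

theorem foldl_counter_filter {β γ : Type*} (F : β → γ) {n : ℕ} (a : Fin n → β) (t : Fin n → ℤ) :
    (List.ofFn fun i => (a i, t i)).foldl
      (fun s p => (s.1 + 1, if s.1 < p.2 then F p.1 :: s.2 else s.2)) ((0 : ℤ), ([] : List γ)) =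
      ((n : ℤ), (((List.finRange n).filter fun i : Fin n => ((i : ℕ) : ℤ) < t i).reverse.map
        fun i => F (a i))) := by
  induction n with
  | zero => simp
  | succ n ih =>
    rw [List.ofFn_succ', List.concat_eq_append, List.foldl_append,
      ih (fun i => a i.castSucc) fun i => t i.castSucc, List.finRange_succ_last,
      List.filter_append, List.filter_map]
    by_cases h : (n : ℤ) < t (Fin.last n) <;>
      simp [h, List.map_reverse, Function.comp_def]

section

variable {G : Type*} [CommGroup G] {u : G} {L : Type*} [AddCommGroup L] (Λ : GLattice G u L)

theorem mem_cyclicSubgroup {e x : L} :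
    x ∈ Λ.cyclicSubgroup e ↔ ∃ ρ : MonoidAlgebra ℤ G, Λ.groupRingAct ρ e = x := by
  constructor
  · rintro ⟨a, rfl⟩
    obtain ⟨ρ, rfl⟩ := Ideal.Quotient.mk_surjective a
    exact ⟨ρ, rfl⟩
  · rintro ⟨ρ, rfl⟩
    exact ⟨Ideal.Quotient.mk _ ρ, rfl⟩

theorem toIntSubmodule_cyclicSubgroup (e : L) :
    AddSubgroup.toIntSubmodule (Λ.cyclicSubgroup e) =
      Submodule.span ℤ (Set.range fun σ => Λ.act σ e) := by
  rw [← range_groupRingAct]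
  ext x
  exact mem_cyclicSubgroup Λ

/-- Since `u` acts as `-1`, one translate from each pair `{σ, uσ}` suffices to span `ℤ⟨G⟩ e`. A
subgroup of finite index has rank `r`, so `r` spanning vectors form a basis of it, and the index is
the absolute determinant of their coordinates. -/
theorem index_cyclicSubgroup {r : ℕ} (b : Module.Basis (Fin r) ℤ L) (e : L)
    (hfin : Finite (L ⧸ Λ.cyclicSubgroup e)) (s : Fin r → G)
    (hs : ∀ σ, (∃ j, s j = σ) ∨ ∃ j, s j = u * σ) :
    Nat.card (L ⧸ Λ.cyclicSubgroup e) =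
      (Matrix.of fun j i => b.repr (Λ.act (s j) e) i).det.natAbs := by
  have := Module.Free.of_basis b
  have := Module.Finite.of_basis b
  set N := Λ.cyclicSubgroup e with hN
  have hN' := toIntSubmodule_cyclicSubgroup Λ e
  rw [← hN] at hN'
  have hsN : ∀ j, Λ.act (s j) e ∈ AddSubgroup.toIntSubmodule N := fun j => by
    rw [hN']
    exact Submodule.subset_span ⟨s j, rfl⟩
  have hfin' : Finite (L ⧸ AddSubgroup.toIntSubmodule N) := hfin
  have hrank : Module.finrank ℤ (AddSubgroup.toIntSubmodule N) = r := by
    rw [(Submodule.finiteQuotient_iff _).1 hfin', Module.finrank_eq_card_basis b, Fintype.card_fin]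
  have hspan : ⊤ ≤ Submodule.span ℤ (Set.range fun j =>
      (⟨Λ.act (s j) e, hsN j⟩ : AddSubgroup.toIntSubmodule N)) := by
    rintro ⟨x, hx⟩ -
    have hx' := hx
    rw [hN'] at hx'
    have hle : Submodule.span ℤ (Set.range fun σ => Λ.act σ e) ≤
        (Submodule.span ℤ (Set.range fun j =>
          (⟨Λ.act (s j) e, hsN j⟩ : AddSubgroup.toIntSubmodule N))).map
            (AddSubgroup.toIntSubmodule N).subtype := by
      rw [Submodule.span_le]
      rintro _ ⟨σ, rfl⟩
      rw [Submodule.map_span, ← Set.range_comp]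
      rcases hs σ with ⟨j, rfl⟩ | ⟨j, hj⟩
      · exact Submodule.subset_span ⟨j, rfl⟩
      · have : Λ.act σ e = -Λ.act (s j) e := by
          rw [hj, map_mul, LinearEquiv.mul_apply, Λ.act_u, neg_neg]
        change Λ.act σ e ∈ _
        rw [this]
        exact neg_mem (Submodule.subset_span ⟨j, rfl⟩)
    obtain ⟨y, hy, hyx⟩ := hle hx'
    have : y = ⟨x, hx⟩ := Subtype.ext hyx
    rwa [← this]
  let bN := basisOfTopLeSpanOfCardEqFinrank _ hspan (by rw [hrank, Fintype.card_fin])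
  have h := AddSubgroup.index_eq_natAbs_det b N bN
  rw [AddSubgroup.index] at h
  rw [h, Module.Basis.det_apply, ← Matrix.det_transpose]
  congr 2
  ext i j
  have hb : bN i = ⟨Λ.act (s i) e, hsN i⟩ :=
    congrFun (coe_basisOfTopLeSpanOfCardEqFinrank _ hspan _) i
  rw [Matrix.transpose_apply, Module.Basis.toMatrix_apply]
  exact congrArg (fun x : AddSubgroup.toIntSubmodule N => b.repr (x : L) j) hb

end

variable (I : GLatticeInput.{v, w})

/-- Multiplication by `u`, in terms of the enumeration of the group. -/
def translate (i : Fin I.N) : Fin I.N := I.enum.symm (I.u * I.enum i)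

theorem enum_translate (i : Fin I.N) : I.enum (translate I i) = I.u * I.enum i := by
  simp [translate]

theorem u_mul_u : I.u * I.u = 1 := by
  have := pow_orderOf_eq_one I.u
  rwa [I.orderOf_u, sq] at this

theorem translate_translate (i : Fin I.N) : translate I (translate I i) = i := by
  rw [translate, enum_translate, ← mul_assoc, u_mul_u, one_mul, Equiv.symm_apply_apply]

theorem translate_ne (i : Fin I.N) : translate I i ≠ i := by
  intro h
  have h1 := enum_translate I i
  rw [h] at h1
  have h2 : I.u = 1 := by simpa using h1.symm
  have h3 := I.orderOf_u
  rw [h2, orderOf_one] at h3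
  omega

/-- Multiplication by `u` is an involution of the positions without fixed points; it exchanges the
positions that it raises with those that it lowers. -/
theorem card_filter_lt_translate :
    (Finset.univ.filter fun i => i < translate I i).card = I.N / 2 := by
  have h1 : (Finset.univ.filter fun i => ¬ i < translate I i) =
      (Finset.univ.filter fun i => i < translate I i).image (translate I) := by
    ext i
    simp only [Finset.mem_filter, Finset.mem_univ, true_and, Finset.mem_image, not_lt]
    constructor
    · intro h
      exact ⟨translate I i, by
        rw [translate_translate]
        exact lt_of_le_of_ne h (translate_ne I i), translate_translate I i⟩
    · rintro ⟨j, hj, rfl⟩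
      rw [translate_translate]
      exact hj.le
  have h2 := Finset.card_filter_add_card_filter_not (s := (Finset.univ : Finset (Fin I.N)))
    fun i => i < translate I i
  rw [h1, Finset.card_image_of_injective _
    (Function.LeftInverse.injective (translate_translate I)), Finset.card_univ,
    Fintype.card_fin] at h2
  omega

theorem map_dot_coords (σ : I.G) (e : I.L) :
    (rowList (actMatrix I σ)).map (fun row => dot row (List.ofFn fun i => I.basis.repr e i)) =
      List.ofFn fun i => I.basis.repr (I.lat.act σ e) i := by
  have h1 : vecL I.basis (ev (List.ofFn fun i => I.basis.repr e i)) = e := by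
    rw [vecL_apply]
    simp only [ev_ofFn]
    exact I.basis.sum_repr e
  have h2 := vecL_map_dot I σ (List.ofFn fun i => I.basis.repr e i)
  rw [h1] at h2
  rw [← h2]
  simp only [repr_vecL]
  refine List.ext_getElem (by simp [rowList]) fun i h3 h4 => ?_
  simp [ev, rowList] at h3 ⊢

/-- The row of `u` in the multiplication table lists the positions of the `uσ`, and comparing them
with the positions of the `σ` selects one element of each pair. The fold reverses the order, which
is harmless for an absolute determinant. -/
theorem halfOrbit_eq (e : I.L) :
    halfOrbit (raw I, List.ofFn fun i => I.basis.repr e i) =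
      ((List.finRange I.N).filter fun i => i < translate I i).reverse.map
        fun i => List.ofFn fun j => I.basis.repr (I.lat.act (I.enum i) e) j := by
  have h1 : nth (raw I).1 (raw I).2.1 [] = List.ofFn fun j => ((translate I j : ℕ) : ℤ) := by
    change nth (rowList _) ((I.enum.symm I.u : ℕ) : ℤ) [] = _
    rw [nth_natCast]
    simp only [rowList, translate, List.getD_eq_getElem?_getD, List.getElem?_ofFn, Fin.is_lt,
      dite_true, Option.getD_some, Fin.eta]
    congr 1
    ext j
    simp
  have h2 : zipPad Prod.mk (Prod.mk []) 0 (raw I).2.2.2.1 (nth (raw I).1 (raw I).2.1 []) =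
      List.ofFn fun i => (rowList (actMatrix I (I.enum i)), ((translate I i : ℕ) : ℤ)) := by
    rw [h1]
    exact zipPad_ofFn _ _ _ _ _
  rw [halfOrbit]
  simp only [h2]
  have h3 := foldl_counter_filter (fun A : List (List ℤ) =>
    A.map fun row => dot row (List.ofFn fun i => I.basis.repr e i))
    (fun i => rowList (actMatrix I (I.enum i))) fun i => ((translate I i : ℕ) : ℤ)
  simp only [h3, map_dot_coords, Nat.cast_lt, Fin.val_fin_lt]

theorem exists_solvesIndex : ∃ p, InvertibilityAlgorithm.SolvesIndex.{v, w} p := by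
  refine PF.exists_solves (f := fun I => absDet (halfOrbit I)) (by fun_prop)
    (fun i => (raw i.1.1, List.ofFn fun j => i.1.1.basis.repr i.1.2 j))
    (fun i => by rw [enc_pair, enc_raw, enc_coords]) fun ⟨⟨I, e⟩, hrank, hfin⟩ => ?_
  dsimp only at hrank hfin ⊢
  set l := ((List.finRange I.N).filter fun i => i < translate I i).reverse with hl
  have hnodup : l.Nodup := (List.nodup_reverse.2 ((List.nodup_finRange _).filter _))
  have hmem : ∀ i, i ∈ l ↔ i < translate I i := by simp [hl]
  have hlen : l.length = I.r := by
    rw [Module.finrank_eq_card_basis I.basis, Fintype.card_fin, card_eq,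
      ← card_filter_lt_translate] at hrank
    rw [hrank, ← List.toFinset_card_of_nodup hnodup]
    congr 1
    ext i
    simp [hmem]
  have hrows : halfOrbit (raw I, List.ofFn fun i => I.basis.repr e i) =
      List.ofFn fun j : Fin I.r => List.ofFn
        (Matrix.of (fun j i => I.basis.repr
          (I.lat.act (I.enum (l.get (j.cast hlen.symm))) e) i) j) := by
    rw [halfOrbit_eq, ← hl]
    refine List.ext_getElem (by simp [hlen]) fun i h3 h4 => ?_
    simp
    rfl
  rw [index_cyclicSubgroup I.lat I.basis e hfin
    (fun j => I.enum (l.get (j.cast hlen.symm))) fun σ => ?_, hrows, absDet_ofFn,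
    Int.natCast_natAbs]
  · rfl
  · obtain ⟨i, rfl⟩ := I.enum.surjective σ
    have key : ∀ i, i ∈ l → ∃ j : Fin I.r, l.get (j.cast hlen.symm) = i := by
      intro i hi
      obtain ⟨j, rfl⟩ := List.mem_iff_get.1 hi
      exact ⟨j.cast hlen, rfl⟩
    rcases lt_or_gt_of_ne (translate_ne I i) with h | h
    · right
      obtain ⟨j, hj⟩ := key (translate I i) ((hmem _).2 (by rwa [translate_translate]))
      exact ⟨j, by rw [hj, enum_translate]⟩
    · left
      obtain ⟨j, hj⟩ := key i ((hmem i).2 h)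
      exact ⟨j, by rw [hj]⟩

end BitCost

namespace BitCost

/-! ### Invertible lattices -/

section

variable {R L : Type*} [CommRing R] [AddCommGroup L] [Module R L]

/-- The remainder `z` in the expansion of `v` modulo `a` is itself expanded modulo `c`. No
coprimality is needed, so a generator modulo a prime is one modulo each of its powers. -/
theorem GenMod.mul {a c : ℤ} {e : L} (ha : GenMod R a e) (hc : GenMod R c e) :
    GenMod R (a * c) e := by
  intro v
  obtain ⟨ρ, z, rfl⟩ := ha v
  obtain ⟨σ, y, rfl⟩ := hc z
  refine ⟨ρ + a • σ, y, ?_⟩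
  rw [add_smul, smul_add, smul_assoc, mul_smul]
  abel

theorem GenMod.pow {a : ℤ} {e : L} (ha : GenMod R a e) (k : ℕ) : GenMod R (a ^ k) e := by
  induction k with
  | zero => exact fun v => ⟨0, v, by simp⟩
  | succ k ih => rw [pow_succ]; exact ih.mul ha

theorem GenMod.of_dvd {a c : ℤ} {e : L} (ha : GenMod R a e) (hc : c ∣ a) : GenMod R c e := by
  obtain ⟨d, rfl⟩ := hc
  intro v
  obtain ⟨ρ, z, rfl⟩ := ha v
  exact ⟨ρ, d • z, by rw [smul_smul]⟩

theorem GenMod.add_smul_right {a : ℤ} {e : L} (ha : GenMod R a e) (y : L) :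
    GenMod R a (e + a • y) := by
  intro v
  obtain ⟨ρ, z, rfl⟩ := ha v
  refine ⟨ρ, z - ρ • y, ?_⟩
  rw [smul_add, smul_sub, smul_comm ρ a]
  abel

/-- By Bézout's identity there is a vector congruent to `e` modulo `a` and to `f` modulo `c`. It
generates for both moduli, hence for their product. -/
theorem exists_genMod_mul {a c : ℕ} (hac : Nat.Coprime a c) (ha : ∃ e : L, GenMod R a e)
    (hc : ∃ e : L, GenMod R c e) : ∃ e : L, GenMod R ((a * c : ℕ) : ℤ) e := by
  obtain ⟨e, he⟩ := ha
  obtain ⟨f, hf⟩ := hc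
  have hb := Nat.gcd_eq_gcd_ab a c
  rw [hac.gcd_eq_one, Nat.cast_one] at hb
  have h1 := he.add_smul_right (a.gcdA c • (f - e))
  have h2 := hf.add_smul_right (a.gcdB c • (e - f))
  have h3 : f + (c : ℤ) • a.gcdB c • (e - f) = e + (a : ℤ) • a.gcdA c • (f - e) := by
    rw [smul_smul, smul_smul, ← sub_eq_zero]
    have : f + ((c : ℤ) * a.gcdB c) • (e - f) - (e + ((a : ℤ) * a.gcdA c) • (f - e)) =
        (1 - ((a : ℤ) * a.gcdA c + (c : ℤ) * a.gcdB c)) • (f - e) := by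
      module
    rw [this, ← hb, sub_self, zero_smul]
  rw [h3] at h2
  exact ⟨_, by rw [Nat.cast_mul]; exact h1.mul h2⟩

/-- Induction over coprime factors reduces to a prime `p`. If `p` divides `q`, a generator modulo
`q` works. If not, `q` is invertible modulo `p`, and `qL ⊆ Re` makes `e` a generator. -/
theorem exists_genMod {q : ℕ} {e : L} (hq : ∀ v : L, ∃ ρ : R, ρ • e = q • v)
    (h : ∃ f : L, GenMod R q f) {m : ℕ} (hm : 0 < m) : ∃ f : L, GenMod R m f := by
  induction m using Nat.recOnPosPrimePosCoprime with
  | zero => exact absurd hm (lt_irrefl 0)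
  | one => exact ⟨0, fun v => ⟨0, v, by simp⟩⟩
  | coprime a c ha hc hac iha ihc => exact exists_genMod_mul hac (iha (by omega)) (ihc (by omega))
  | prime_pow p n hp hn =>
    suffices h : ∃ f : L, GenMod R p f by
      obtain ⟨f, hf⟩ := h
      exact ⟨f, by rw [Nat.cast_pow]; exact hf.pow n⟩
    by_cases hpq : p ∣ q
    · obtain ⟨f, hf⟩ := h
      exact ⟨f, hf.of_dvd (Int.natCast_dvd_natCast.2 hpq)⟩
    · refine ⟨e, fun v => ?_⟩
      have hb := Nat.gcd_eq_gcd_ab p q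
      rw [((Nat.Prime.coprime_iff_not_dvd hp).2 hpq).gcd_eq_one, Nat.cast_one] at hb
      obtain ⟨ρ, hρ⟩ := hq (p.gcdB q • v)
      refine ⟨ρ, p.gcdA q • v, ?_⟩
      rw [hρ, ← natCast_zsmul, smul_smul, smul_smul, ← add_smul, add_comm, ← hb, one_smul]

end

section

variable {G : Type*} [CommGroup G] {u : G} {L : Type*} [AddCommGroup L] (Λ : GLattice G u L)

/-- The quotient `Q` satisfies `Q = 2Q`, so by Nakayama's lemma some integer congruent to `1` modulo
`2` kills it. This integer is not zero, and a finitely generated torsion group is finite. -/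
theorem finite_quotient_cyclicSubgroup {e : L} (he : Λ.GeneratesMod 2 e) :
    Finite (L ⧸ Λ.cyclicSubgroup e) := by
  have := Λ.fg
  rw [generatesMod_iff] at he
  set N := AddSubgroup.toIntSubmodule (Λ.cyclicSubgroup e) with hN
  have hle : (⊤ : Submodule ℤ (L ⧸ N)) ≤ Ideal.span {(2 : ℤ)} • ⊤ := by
    intro q _
    obtain ⟨v, rfl⟩ := Submodule.Quotient.mk_surjective _ q
    obtain ⟨ρ, z, hv⟩ := he v
    have h1 : (Submodule.Quotient.mk v : L ⧸ N) = (2 : ℤ) • Submodule.Quotient.mk z := by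
      rw [← Submodule.Quotient.mk_smul, eq_comm, Submodule.Quotient.eq, ← neg_mem_iff]
      refine (mem_cyclicSubgroup Λ).2 ⟨ρ, ?_⟩
      rw [neg_sub, ← hv]
      exact (add_sub_cancel_right _ _).symm
    rw [h1]
    exact Submodule.smul_mem_smul (Ideal.mem_span_singleton_self _) trivial
  obtain ⟨c, hc, hc0⟩ := Submodule.exists_sub_one_mem_and_smul_eq_zero_of_fg_of_le_smul _ _
    (Module.Finite.fg_top) hle
  have hcne : c ≠ 0 := by
    rintro rfl
    rw [Ideal.mem_span_singleton] at hc
    omega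
  have htor : Module.IsTorsion ℤ (L ⧸ N) := fun {x} =>
    ⟨⟨c, mem_nonZeroDivisors_of_ne_zero hcne⟩, hc0 x trivial⟩
  have hfin : Finite (L ⧸ N) := Module.finite_of_fg_torsion _ htor
  exact hfin

theorem invertible_iff {r : ℕ} (b : Module.Basis (Fin r) ℤ L) {e : L}
    (he : Λ.GeneratesMod 2 e) (hrank : Module.finrank ℤ L = Nat.card G / 2)
    (hdet : (Λ.gram b).det = 1) :
    Λ.Invertible ↔ ∃ f, Λ.GeneratesMod (Nat.card (L ⧸ Λ.cyclicSubgroup e)) f := by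
  have hfin := finite_quotient_cyclicSubgroup Λ he
  refine ⟨fun h => h.exists_generatesMod _ Nat.card_pos, fun h =>
    ⟨hrank, (unimodular_iff_gram_det _ b).2 hdet, fun m hm => ?_⟩⟩
  simp only [generatesMod_iff] at h ⊢
  let _ := groupRingModule Λ
  refine exists_genMod (e := e) (fun v => ?_) h hm
  exact (mem_cyclicSubgroup Λ).1 (AddSubgroup.nsmul_index_mem (Λ.cyclicSubgroup e) v)

end

/-! ### Running the algorithm -/

/-- On the instances that satisfy `S`, the program `p` computes `y` from `x` in polynomial time. -/
def RunsOn {ι : Type*} (S : ι → Prop) (p : Prog) (x y : ι → Data) : Prop :=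
  ∃ P : Polynomial ℕ, ∀ i, S i → ∃ t, Run p (x i) (y i) t ∧ t ≤ P.eval (x i).size

namespace RunsOn

variable {ι : Type*} {S S' : ι → Prop} {p q c : Prog} {x y z : ι → Data}

theorem of_solves {κ : Type*} {inp : κ → Data} {Q : κ → Data → Prop}
    (h : SolvesInPolyTime p inp Q) : ∃ y, RunsOn (fun _ => True) p inp y ∧ ∀ k, Q k (y k) := by
  obtain ⟨P, hP⟩ := h
  choose y t h1 h2 h3 using hP
  exact ⟨y, ⟨P, fun k _ => ⟨t k, h1 k, h2 k⟩⟩, h3⟩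

theorem reindex {κ : Type*} {T : κ → Prop} {x y : κ → Data} {x' y' : ι → Data}
    (h : RunsOn T p x y) (hk : ∀ i, S i → ∃ k, T k ∧ x k = x' i ∧ y k = y' i) :
    RunsOn S p x' y' := by
  obtain ⟨P, hP⟩ := h
  refine ⟨P, fun i hi => ?_⟩
  obtain ⟨k, hT, h1, h2⟩ := hk i hi
  rw [← h1, ← h2]
  exact hP k hT

theorem mono (h : RunsOn S p x y) (hS : ∀ i, S' i → S i) : RunsOn S' p x y :=
  h.reindex fun i hi => ⟨i, hS i hi, rfl, rfl⟩

theorem congr (h : RunsOn S p x y) (hy : ∀ i, S i → y i = z i) : RunsOn S p x z :=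
  h.reindex fun i hi => ⟨i, hi, rfl, hy i hi⟩

theorem id : RunsOn S .id x x := ⟨1 + .X, fun i _ => ⟨_, .id _, by simp⟩⟩

theorem const (k : ℤ) : RunsOn S (.const k) x fun _ => .int k :=
  ⟨1 + .X + .C (Data.int k).size, fun i _ => ⟨_, .const k _, by simp⟩⟩

theorem fst : RunsOn S .fst (fun i => .pair (x i) (y i)) x :=
  ⟨1 + .X, fun i _ => ⟨_, .fst _ _, by simp⟩⟩

theorem snd : RunsOn S .snd (fun i => .pair (x i) (y i)) y :=
  ⟨1 + .X, fun i _ => ⟨_, .snd _ _, by simp⟩⟩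

theorem pair (hp : RunsOn S p x y) (hq : RunsOn S q x z) :
    RunsOn S (.pair p q) x fun i => .pair (y i) (z i) := by
  obtain ⟨P, hP⟩ := hp
  obtain ⟨Q, hQ⟩ := hq
  refine ⟨1 + .X + P + Q, fun i hi => ?_⟩
  obtain ⟨s, h1, h2⟩ := hP i hi
  obtain ⟨t, h3, h4⟩ := hQ i hi
  refine ⟨_, .pair h1 h3, ?_⟩
  simp only [Polynomial.eval_add, Polynomial.eval_one, Polynomial.eval_X]
  omega

/-- The output of the first program is no larger than the cost of producing it, so the second
program starts from data of polynomial size. -/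
theorem seq (hp : RunsOn S p x y) (hq : RunsOn S q y z) : RunsOn S (.seq p q) x z := by
  obtain ⟨P, hP⟩ := hp
  obtain ⟨Q, hQ⟩ := hq
  refine ⟨1 + P + Q.comp P, fun i hi => ?_⟩
  obtain ⟨s, h1, h2⟩ := hP i hi
  obtain ⟨t, h3, h4⟩ := hQ i hi
  refine ⟨_, .seq h1 h3, ?_⟩
  have h5 := polynomial_eval_mono Q (h1.size_le.trans h2)
  simp only [Polynomial.eval_add, Polynomial.eval_one, Polynomial.eval_comp]
  omega

/-- Each branch is only required to behave well on the instances that reach it. This allows a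
subroutine such as `index` to be called where its specification applies and to be arbitrary
elsewhere. -/
theorem ite {C : ι → Prop} (hc : RunsOn S c x y) (hC : ∀ i, S i → C i → ∃ k ≠ 0, y i = .int k)
    (hC' : ∀ i, S i → ¬ C i → y i = .int 0) (hp : RunsOn (fun i => S i ∧ C i) p x z)
    (hq : RunsOn (fun i => S i ∧ ¬ C i) q x z) : RunsOn S (.ite c p q) x z := by
  obtain ⟨Q, hQ⟩ := hc
  obtain ⟨P₁, hP₁⟩ := hp
  obtain ⟨P₂, hP₂⟩ := hq
  refine ⟨1 + .X + Q + P₁ + P₂, fun i hi => ?_⟩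
  obtain ⟨s, h1, h2⟩ := hQ i hi
  simp only [Polynomial.eval_add, Polynomial.eval_one, Polynomial.eval_X]
  by_cases h : C i
  · obtain ⟨t, h3, h4⟩ := hP₁ i ⟨hi, h⟩
    obtain ⟨k, hk, hy⟩ := hC i hi h
    rw [hy] at h1
    exact ⟨_, .ite_true h1 hk h3, by omega⟩
  · obtain ⟨t, h3, h4⟩ := hP₂ i ⟨hi, h⟩
    rw [hC' i hi h] at h1
    exact ⟨_, .ite_false h1 h3, by omega⟩

end RunsOn

open InvertibilityAlgorithm

theorem runsOn_isOne {ι : Type*} {S : ι → Prop} (k : ι → ℤ) :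
    RunsOn S isOne (fun i => .int (k i)) fun i => .int (if k i = 1 then 1 else 0) := by
  refine .seq (.pair .id (.const 1)) ⟨.X ^ 2, fun i _ => ⟨_, .op .eq _ _, by simp⟩⟩

theorem runsOn_isPair {ι : Type*} {S : ι → Prop} {C : ι → Prop} [DecidablePred C] {x : ι → Data}
    (h1 : ∀ i, S i → C i → ∃ a d, x i = .pair a d) (h2 : ∀ i, S i → ¬ C i → ∃ k, x i = .int k) :
    RunsOn S .isPair x fun i => .int (if C i then 1 else 0) := by
  refine ⟨1 + .X, fun i hi => ⟨1 + (x i).size, ?_, by simp⟩⟩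
  beta_reduce
  by_cases h : C i
  · obtain ⟨a, d, e⟩ := h1 i hi h
    rw [if_pos h, e]
    exact .isPair_pair a d
  · obtain ⟨k, e⟩ := h2 i hi h
    rw [if_neg h, e]
    exact .isPair_int k

open Classical in
theorem decides_algorithm {rank det cyclic index : Prog} (hrank : SolvesRank.{v, w} rank)
    (hdet : SolvesDet.{v, w} det) (hcyclic : SolvesCyclic.{v, w} cyclic)
    (hindex : SolvesIndex.{v, w} index) :
    DecidesInPolyTime (algorithm rank det cyclic index) GLatticeInput.encode.{v, w}
      fun I => I.lat.Invertible := by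
  obtain ⟨yr, hr, hyr⟩ := RunsOn.of_solves hrank
  obtain ⟨yd, hd, hyd⟩ := RunsOn.of_solves hdet
  obtain ⟨yc, hc, hyc⟩ := RunsOn.of_solves hcyclic
  obtain ⟨yi, hi, hyi⟩ := RunsOn.of_solves hindex
  let ans : GLatticeInput.{v, w} → Data := fun I => .int (if I.lat.Invertible then 1 else 0)
  suffices h : RunsOn (fun _ => True) (algorithm rank det cyclic index)
      GLatticeInput.encode.{v, w} ans by
    obtain ⟨P, hP⟩ := h
    refine ⟨P, fun I => ?_⟩
    obtain ⟨t, h1, h2⟩ := hP I trivial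
    refine ⟨_, t, h1, h2, ?_⟩
    by_cases h : I.lat.Invertible
    · exact Or.inl ⟨h, by simp [ans, h]⟩
    · exact Or.inr ⟨h, by simp [ans, h]⟩
  have hno : ∀ {S : GLatticeInput.{v, w} → Prop} {x : GLatticeInput.{v, w} → Data},
      (∀ I, S I → ¬ I.lat.Invertible) → RunsOn S (.const 0) x ans := fun h =>
    (RunsOn.const 0).congr fun I hI => by simp [ans, h I hI]
  -- the generators modulo `m`, and the answers of the program that finds them
  have hcyc : ∀ (m : ℕ) (hm : 0 < m) (I : GLatticeInput.{v, w}) (y : Data),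
      yc (I, ⟨m, hm⟩) = y →
      ((∃ e : I.L, I.lat.GeneratesMod m e) →
        ∃ e : I.L, I.lat.GeneratesMod m e ∧ y = .pair (I.encodeElt e) (.int 0)) ∧
      ((¬ ∃ e : I.L, I.lat.GeneratesMod m e) → y = .int 0) := by
    rintro m hm I _ rfl
    rcases hyc (I, ⟨m, hm⟩) with ⟨e, he, hy⟩ | ⟨hne, hy⟩
    · exact ⟨fun _ => ⟨e, he, hy⟩, fun h => absurd ⟨e, he⟩ h⟩
    · exact ⟨fun h => absurd h hne, fun _ => hy⟩
  let y₂ : GLatticeInput.{v, w} → Data := fun I => yc (I, ⟨2, two_pos⟩)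
  -- The lattice element that the answer `y₂ I` encodes; the default `0` stands for instances on
  -- which the algorithm stops before using it.
  let e₂ : (I : GLatticeInput.{v, w}) → I.L := fun I =>
    if h : ∃ e : I.L, I.lat.GeneratesMod 2 e then
      Classical.choose ((hcyc 2 two_pos I _ rfl).1 h) else 0
  have he₂ : ∀ I : GLatticeInput.{v, w}, (∃ e : I.L, I.lat.GeneratesMod 2 e) →
      I.lat.GeneratesMod 2 (e₂ I) ∧ y₂ I = .pair (I.encodeElt (e₂ I)) (.int 0) := by
    intro I h
    have := Classical.choose_spec ((hcyc 2 two_pos I _ rfl).1 h)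
    simpa only [e₂, dif_pos h] using this
  let q : GLatticeInput.{v, w} → ℕ := fun I => Nat.card (I.L ⧸ I.lat.cyclicSubgroup (e₂ I))
  -- Every instance that reaches the second call has `q I > 0`, by `hq`; the default only makes `yq`
  -- defined everywhere.
  let yq : GLatticeInput.{v, w} → Data := fun I =>
    if h : 0 < q I then yc (I, ⟨q I, h⟩) else .int 0
  have hq : ∀ I : GLatticeInput.{v, w}, (∃ e : I.L, I.lat.GeneratesMod 2 e) → 0 < q I := by
    intro I h
    have := finite_quotient_cyclicSubgroup I.lat (he₂ I h).1
    exact Nat.card_pos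
  refine .ite (C := fun I => Module.finrank ℤ I.L = Nat.card I.G / 2) hr
    (fun I _ h => ⟨1, one_ne_zero, ?_⟩) (fun I _ h => ?_) ?_ (hno fun I h h' => h.2 h'.finrank_eq)
  · exact (hyr I).elim (fun h' => h'.2) fun h' => absurd h h'.1
  · exact (hyr I).elim (fun h' => absurd h'.1 h) fun h' => h'.2
  refine .ite (C := fun I => (I.lat.gram I.basis).det = 1)
    (.seq ((hd.mono fun _ _ => trivial).congr fun I _ => hyd I) (runsOn_isOne _))
    (fun I _ h => ⟨1, one_ne_zero, by rw [if_pos h]⟩) (fun I _ h => by rw [if_neg h]) ?_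
    (hno fun I h h' => h.2 ((unimodular_iff_gram_det _ I.basis).1 h'.unimodular))
  refine .seq (y := fun I => .pair I.encode (y₂ I)) (.pair (y := GLatticeInput.encode) (z := y₂) .id
    (.seq (y := fun I => .pair I.encode (.int 2))
      (.pair (y := GLatticeInput.encode) (z := fun _ => .int 2) .id (.const 2)) (hc.reindex fun I _ => ⟨(I, ⟨2, two_pos⟩), trivial, rfl, rfl⟩))) ?_
  refine .ite (C := fun I => ∃ e : I.L, I.lat.GeneratesMod 2 e) (.seq .snd
    (runsOn_isPair (C := fun I => ∃ e : I.L, I.lat.GeneratesMod 2 e)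
      (fun I _ h => ⟨_, _, (he₂ I h).2⟩)
      fun I _ h => ⟨0, (hcyc 2 two_pos I _ rfl).2 h⟩))
    (fun I _ h => ⟨1, one_ne_zero, by rw [if_pos h]⟩) (fun I _ h => by rw [if_neg h]) ?_
    (hno fun I h h' => h.2 (h'.exists_generatesMod 2 two_pos))
  refine .seq (y := fun I => .pair I.encode (I.encodeElt (e₂ I)))
    (.pair (y := GLatticeInput.encode) (z := fun I => I.encodeElt (e₂ I)) .fst ?_) ?_
  · refine .seq (y := fun I => .pair (I.encodeElt (e₂ I)) (.int 0)) ?_ .fst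
    exact RunsOn.snd.congr fun I h => (he₂ I h.2).2
  refine .seq (y := fun I => .pair I.encode (.int (q I)))
    (.pair (y := GLatticeInput.encode) (z := fun I => .int (q I)) .fst ?_) ?_
  -- The earlier branches guarantee what the specification of `index` demands: the correct rank, and
  -- a finite quotient because `e₂ I` generates modulo `2`.
  · refine hi.reindex fun I h => ⟨⟨⟨I, e₂ I⟩, h.1.1.2,
      finite_quotient_cyclicSubgroup I.lat (he₂ I h.2).1⟩, trivial, rfl, hyi _⟩
  refine .seq (y := yq) (hc.reindex fun I h => ⟨(I, ⟨q I, hq I h.2⟩), trivial, rfl, ?_⟩) ?_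
  · simp only [yq, dif_pos (hq I h.2)]
  have hyq : ∀ I : GLatticeInput.{v, w}, (∃ e : I.L, I.lat.GeneratesMod 2 e) → ∃ h,
      yc (I, ⟨q I, h⟩) = yq I := fun I h => ⟨hq I h, by simp only [yq, dif_pos (hq I h)]⟩
  refine runsOn_isPair (C := fun I : GLatticeInput.{v, w} => I.lat.Invertible) (fun I h h' => ?_) fun I h h' => ?_
  -- On the instances that are left, invertibility is equivalent to the existence of a generator
  -- modulo `q I`, which the last answer reveals by being a pair or an integer.
  all_goals
    rw [invertible_iff I.lat I.basis (he₂ I h.2).1 h.1.1.2 h.1.2] at h'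
    obtain ⟨hpos, hy⟩ := hyq I h.2
  · obtain ⟨f, -, hf⟩ := (hcyc _ hpos I _ hy).1 h'
    exact ⟨_, _, hf⟩
  · exact ⟨0, (hcyc _ hpos I _ hy).2 h'⟩

end BitCost

theorem mainTheorem12 :
    (∃ rank det cyclic index : BitCost.Prog,
      InvertibilityAlgorithm.SolvesRank.{v, w} rank ∧
      InvertibilityAlgorithm.SolvesDet.{v, w} det ∧
      InvertibilityAlgorithm.SolvesCyclic.{v, w} cyclic ∧
      InvertibilityAlgorithm.SolvesIndex.{v, w} index) ∧
    ∀ rank det cyclic index : BitCost.Prog,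
      InvertibilityAlgorithm.SolvesRank.{v, w} rank →
      InvertibilityAlgorithm.SolvesDet.{v, w} det →
      InvertibilityAlgorithm.SolvesCyclic.{v, w} cyclic →
      InvertibilityAlgorithm.SolvesIndex.{v, w} index →
      BitCost.DecidesInPolyTime (InvertibilityAlgorithm.algorithm rank det cyclic index)
        GLatticeInput.encode.{v, w} fun I => I.lat.Invertible := by
  obtain ⟨rank, hrank⟩ := BitCost.exists_solvesRank.{v, w}
  obtain ⟨det, hdet⟩ := BitCost.exists_solvesDet.{v, w}
  obtain ⟨cyclic, hcyclic⟩ := BitCost.exists_solvesCyclic.{v, w}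
  obtain ⟨index, hindex⟩ := BitCost.exists_solvesIndex.{v, w}
  exact ⟨⟨rank, det, cyclic, index, hrank, hdet, hcyclic, hindex⟩,
    fun _ _ _ _ h₁ h₂ h₃ h₄ => BitCost.decides_algorithm h₁ h₂ h₃ h₄⟩
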